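/- Let $\mathcal S$ be a finite non-empty set, let $P=(p(i,j))_{i,j\in\mathcal S}$ be an irreducible stochastic matrix with invariant probability distribution $(\mu_k)_{k\in\mathcal S}$, and partition $\mathcal S$ into two disjoint sets $\mathcal S^{\rm one}$ and $\mathcal S^{\rm sym}$ (either may be empty). For each $k\in\mathcal S$ let $\alpha_k,c_k\in(0,\infty)$ and let $v_k$ be a Borel probability density on $\mathbb R$ with $v_k(y)=0$ for $y\le 0$ and $v_k(y)=c_k(y)\,y^{-1-\alpha_k}$ for $y>0$, where $c_k(\cdot):[0,\infty)\to(0,\infty)$ is bounded and $\lim_{y\to\infty}c_k(y)=c_k$. Put $w_k(y)=v_k(-y)$ if $k\in\mathcal S^{\rm one}$ and $w_k(y)=\tfrac12 v_k(|y|)$ if $k\in\mathcal S^{\rm sym}$; put $\chi_k=1$ if $k\in\mathcal S^{\rm one}$ and $\chi_k=\tfrac12$ if $k\in\mathcal S^{\rm sym}$. Let $(X_n,\xi_n)_{n\ge 0}$ be the time-homogeneous Markov chain on $[0,\infty)\times\mathcal S$ with transition kernel $$\Pr_{x,i}[(X_1,\xi_1)\in B\times\{j\}]=p(i,j)\int_B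 w_i(-z-x)\,dz+\mathbf 1\{i=j\}\int_B w_i(z-x)\,dz$$ for Borel $B\subseteq[0,\infty)$, where $\Pr_{x,i}$ and $\mathbb E_{x,i}$ refer to the chain started at $(x,i)$. For $a>0$ let $\tau_a=\min\{n\ge 0: X_n\le a\}$, with $\min\emptyset=+\infty$. Suppose that either (a) $\max_{k}\chi_k\alpha_k\ge 1$, or (b)(i) $\max_{k}\chi_k\alpha_k<1$ and $\sum_{k\in\mathcal S}\mu_k\cot(\chi_k\pi\alpha_k)<0$. Then there is $q_\star\in(0,\infty)$ such that for all $a>0$, all $x>a$, all $k\in\mathcal S$ and all real $q$, $$\mathbb E_{x,k}[\tau_a^q]<\infty\ \text{ if } q<q_\star,\qquad \mathbb E_{x,k}[\tau_a^q]=\infty\ \text{ if } q>q_\star .$$ -/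

import Mathlib

open Set Filter Topology MeasureTheory ProbabilityTheory
open scoped NNReal ENNReal

/-- Borel probability density functions on `ℝ`. -/
structure IsProbDensity (v : ℝ → ℝ) : Prop where
  measurable : Measurable v
  nonneg : ∀ y, 0 ≤ v y
  lintegral_eq_one : ∫⁻ y, ENNReal.ofReal (v y) = 1

/-- The class `𝔇_{α,c}`: probability densities of the form `v y = C y * y ^ (-1 - α)` for `y > 0`
and `v y = 0` for `y ≤ 0`, where `C : [0,∞) → (0,∞)` is bounded and tends to `c` at infinity.
(The values of `C` on the negative half-line are not used.) -/
def TailClass (α c : ℝ) (v : ℝ → ℝ) : Prop :=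
  IsProbDensity v ∧
    ∃ C : ℝ → ℝ, (∀ y, 0 ≤ y → 0 < C y) ∧ (∃ K, ∀ y, 0 ≤ y → C y ≤ K) ∧
      Tendsto C atTop (𝓝 c) ∧
      (∀ y, 0 < y → v y = C y * y ^ (-1 - α)) ∧ (∀ y, y ≤ 0 → v y = 0)

/-- The two kinds of branches. A map `S → BranchType` is a partition of `S` into the branches with
one-sided jumps and the branches with symmetric jumps. -/
inductive BranchType where
  | oneSided
  | symmetric

/-- `χ = 1` on one-sided branches and `χ = 1/2` on symmetric ones. -/
noncomputable def BranchType.chi : BranchType → ℝ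
  | .oneSided => 1
  | .symmetric => 1 / 2

/-- The increment density built from `v`: `v (-y)` on a one-sided branch and `v |y| / 2` on a
symmetric one. -/
noncomputable def BranchType.stepDensity : BranchType → (ℝ → ℝ) → ℝ → ℝ
  | .oneSided, v => fun y => v (-y)
  | .symmetric, v => fun y => 1 / 2 * v |y|

/-- The data of a random walk on the complex of half-lines `ℝ≥0 × S`: an irreducible stochastic
matrix on `S` and, for each branch, the probability density of the increments. -/
structure BranchWalk (S : Type*) [Fintype S] where
  /-- the routing matrix -/
  p : Matrix S S ℝ
  irreducible : p.IsIrreducible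
  row_sum : ∀ i, ∑ j, p i j = 1
  /-- the increment densities -/
  w : S → ℝ → ℝ
  isProbDensity : ∀ i, IsProbDensity (w i)

namespace BranchWalk

section

variable {S : Type*} [MeasurableSpace S]

/-- The measure `B × {j'} ↦ 𝟙{j' = j} ∫_B g(z) dz` on `ℝ≥0 × S`. -/
noncomputable def onBranch (g : ℝ → ℝ) (j : S) : Measure (ℝ≥0 × S) :=
  ((volume.restrict (Ici (0 : ℝ))).withDensity fun z => ENNReal.ofReal (g z)).map
    fun z => (z.toNNReal, j)

theorem onBranch_apply {g : ℝ → ℝ} (j : S) {A : Set (ℝ≥0 × S)} (hA : MeasurableSet A) :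
    onBranch g j A =
      ∫⁻ z, ((Ici (0 : ℝ)) ∩ {z | (z.toNNReal, j) ∈ A}).indicator
        (fun z => ENNReal.ofReal (g z)) z := by
  have hm : Measurable fun z : ℝ => (z.toNNReal, j) := by fun_prop
  have hs : MeasurableSet {z : ℝ | (z.toNNReal, j) ∈ A} := hm hA
  rw [onBranch, Measure.map_apply hm hA, withDensity_apply _ (hm hA), Measure.restrict_restrict
    (hm hA), lintegral_indicator (measurableSet_Ici.inter hs), inter_comm]
  rfl

theorem measurable_onBranch {g : ℝ≥0 → ℝ → ℝ} (hg : Measurable (Function.uncurry g)) (j : S) :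
    Measurable fun x => onBranch (g x) j := by
  refine Measure.measurable_of_measurable_coe _ fun A hA => ?_
  simp only [onBranch_apply j hA]
  have hm : Measurable fun z : ℝ => (z.toNNReal, j) := by fun_prop
  have hs : MeasurableSet ((Ici (0 : ℝ)) ∩ {z : ℝ | (z.toNNReal, j) ∈ A}) :=
    measurableSet_Ici.inter (hm hA)
  refine Measurable.lintegral_prod_right' (f := fun q : ℝ≥0 × ℝ =>
    ((Ici (0 : ℝ)) ∩ {z | (z.toNNReal, j) ∈ A}).indicator
      (fun z => ENNReal.ofReal (g q.1 z)) q.2) ?_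
  have : (fun q : ℝ≥0 × ℝ => ((Ici (0 : ℝ)) ∩ {z | (z.toNNReal, j) ∈ A}).indicator
      (fun z => ENNReal.ofReal (g q.1 z)) q.2) =
      (Prod.snd ⁻¹' ((Ici (0 : ℝ)) ∩ {z | (z.toNNReal, j) ∈ A})).indicator
        (fun q : ℝ≥0 × ℝ => ENNReal.ofReal (Function.uncurry g q)) := by
    rfl
  rw [this]
  exact (hg.ennreal_ofReal).indicator (measurable_snd hs)

theorem onBranch_univ (g : ℝ → ℝ) (j : S) :
    onBranch g j univ = ∫⁻ z in Ici (0 : ℝ), ENNReal.ofReal (g z) := by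
  rw [onBranch_apply j MeasurableSet.univ]
  simp [lintegral_indicator measurableSet_Ici]

end

section

variable {S : Type*} [Fintype S] (W : BranchWalk S)

/-- `μ` is the invariant probability distribution of the routing matrix. -/
def IsInvariant (μ : S → ℝ) : Prop :=
  (∀ k, 0 ≤ μ k) ∧ ∑ k, μ k = 1 ∧ ∀ k, (∑ j, μ j * W.p j k) - μ k = 0

/-- The walk has heavy-tailed increments: with `v k ∈ 𝔇_{α k, c k}`, `α k, c k > 0`, the increment
density on branch `k` is the one-sided or symmetric density built from `v k`. -/
def HeavyTailed (ty : S → BranchType) (α c : S → ℝ) (v : S → ℝ → ℝ) : Prop :=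
  (∀ k, 0 < α k) ∧ (∀ k, 0 < c k) ∧ (∀ k, TailClass (α k) (c k) (v k)) ∧
    ∀ k y, W.w k y = (ty k).stepDensity (v k) y

/-- The one-step law from `(x, i)`:
`B × {j} ↦ p i j * ∫_B w i (-z - x) dz + 𝟙{i = j} ∫_B w i (z - x) dz`. -/
noncomputable def stepMeasure [MeasurableSpace S] (s : ℝ≥0 × S) : Measure (ℝ≥0 × S) :=
  (∑ j, ENNReal.ofReal (W.p s.2 j) • onBranch (fun z => W.w s.2 (-z - s.1)) j)
    + onBranch (fun z => W.w s.2 (z - s.1)) s.2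

variable [MeasurableSpace S]

theorem measurable_stepMeasure [DiscreteMeasurableSpace S] : Measurable W.stepMeasure := by
  refine measurable_from_prod_countable_left (fun i : S => ?_)
  have hw := (W.isProbDensity i).measurable
  have h1 : ∀ j : S, Measurable fun x : ℝ≥0 => onBranch (fun z => W.w i (-z - x)) j := fun j =>
    measurable_onBranch (g := fun x z => W.w i (-z - x))
      (hw.comp (by fun_prop : Measurable fun q : ℝ≥0 × ℝ => -q.2 - q.1)) j
  have h2 : Measurable fun x : ℝ≥0 => onBranch (fun z => W.w i (z - x)) i :=
    measurable_onBranch (g := fun x z => W.w i (z - x))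
      (hw.comp (by fun_prop : Measurable fun q : ℝ≥0 × ℝ => q.2 - q.1)) i
  refine Measure.measurable_of_measurable_coe _ fun A hA => ?_
  simp only [stepMeasure, Measure.add_apply, Measure.finsetSum_apply, Measure.smul_apply,
    smul_eq_mul]
  refine Measurable.add (Finset.measurable_sum _ fun j _ => ?_) ?_
  · exact ((Measure.measurable_coe hA).comp (h1 j)).const_mul _
  · exact (Measure.measurable_coe hA).comp h2

theorem stepMeasure_univ (s : ℝ≥0 × S) : W.stepMeasure s univ = 1 := by
  obtain ⟨x, i⟩ := s
  have hp : ∑ j, ENNReal.ofReal (W.p i j) = 1 := by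
    rw [← ENNReal.ofReal_sum_of_nonneg fun j _ => W.irreducible.nonneg i j, W.row_sum,
      ENNReal.ofReal_one]
  simp only [stepMeasure, Measure.add_apply, Measure.finsetSum_apply, Measure.smul_apply,
    smul_eq_mul, onBranch_univ]
  rw [← Finset.sum_mul, hp, one_mul, ← (W.isProbDensity i).lintegral_eq_one,
    ← lintegral_add_compl (fun y => ENNReal.ofReal (W.w i y)) (measurableSet_Iic (a := -(x : ℝ)))]
  congr 1
  · have h := (Measure.measurePreserving_sub_left volume (-(x : ℝ))).setLIntegral_comp_preimage_emb
      (MeasurableEquiv.subLeft (-(x : ℝ))).measurableEmbedding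
      (fun y => ENNReal.ofReal (W.w i y)) (Iic (-(x : ℝ)))
    rw [← h]
    have hset : (fun z : ℝ => -(x : ℝ) - z) ⁻¹' Iic (-(x : ℝ)) = Ici 0 := by
      ext z; simp
    rw [hset]
    refine lintegral_congr fun z => ?_
    rw [show -z - (x : ℝ) = -(x : ℝ) - z by ring]
  · have h := (measurePreserving_sub_right volume (x : ℝ)).setLIntegral_comp_preimage_emb
      (MeasurableEquiv.subRight (x : ℝ)).measurableEmbedding
      (fun y => ENNReal.ofReal (W.w i y)) (Iic (-(x : ℝ)))ᶜ
    rw [← h]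
    have hset : (fun z : ℝ => z - (x : ℝ)) ⁻¹' (Iic (-(x : ℝ)))ᶜ = Ioi 0 := by
      ext z; simp
    rw [hset, restrict_Ioi_eq_restrict_Ici]

variable [DiscreteMeasurableSpace S]

/-- The transition kernel of `(X_n, ξ_n)`. -/
noncomputable def kernel : Kernel (ℝ≥0 × S) (ℝ≥0 × S) where
  toFun := W.stepMeasure
  measurable' := W.measurable_stepMeasure

instance : IsMarkovKernel W.kernel := ⟨fun s => ⟨W.stepMeasure_univ s⟩⟩

/-- The transition kernel, as a kernel from the past up to time `n` to the state at time `n + 1`. -/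
noncomputable def historyKernel (n : ℕ) :
    Kernel (Π _ : Finset.Iic n, ℝ≥0 × S) (ℝ≥0 × S) :=
  W.kernel.comap (fun h => h ⟨n, Finset.mem_Iic.2 le_rfl⟩) (measurable_pi_apply _)

instance (n : ℕ) : IsMarkovKernel (W.historyKernel n) := by
  unfold historyKernel
  infer_instance

/-- `ℙ_{x,i}`: the law on trajectories `ω n = (X_n, ξ_n)` of the time-homogeneous Markov chain with
transition kernel `W.kernel` started at `s = (x, i)`. -/
noncomputable def law (s : ℝ≥0 × S) : Measure (ℕ → ℝ≥0 × S) :=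
  Kernel.traj (X := fun _ => ℝ≥0 × S) W.historyKernel 0 fun _ => s

end

end BranchWalk

/-- The passage time `τ_a = min {n ≥ 0 : X_n ≤ a}`, equal to `∞` if there is no such `n`. -/
noncomputable def passageTime {S : Type*} (a : ℝ) (ω : ℕ → ℝ≥0 × S) : ℝ≥0∞ :=
  ⨅ (n : ℕ) (_ : ((ω n).1 : ℝ) ≤ a), (n : ℝ≥0∞)

/-- The moment `𝔼_{x,k}[τ_a ^ q]`, an element of `[0,∞]`. -/
noncomputable def BranchWalk.passageMoment {S : Type*} [Fintype S] [MeasurableSpace S]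
    [DiscreteMeasurableSpace S] (W : BranchWalk S) (a : ℝ) (x : ℝ≥0) (k : S) (q : ℝ) : ℝ≥0∞ :=
  ∫⁻ ω, passageTime a ω ^ q ∂(W.law (x, k))

/-- Case (a): `max_k χ_k α_k ≥ 1`. -/
def CaseA {S : Type*} [Fintype S] [Nonempty S] (ty : S → BranchType) (α : S → ℝ) : Prop :=
  1 ≤ Finset.univ.sup' Finset.univ_nonempty fun k => (ty k).chi * α k

/-- Case (b)(i): `max_k χ_k α_k < 1` and `∑_k μ_k cot (χ_k π α_k) < 0`. -/
def CaseBI {S : Type*} [Fintype S] [Nonempty S] (ty : S → BranchType) (α μ : S → ℝ) : Prop :=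
  (Finset.univ.sup' Finset.univ_nonempty fun k => (ty k).chi * α k) < 1 ∧
    ∑ k, μ k * Real.cot ((ty k).chi * Real.pi * α k) < 0

/-! The exponent is the supremum of the set of `q > 0` for which some branch, some level `a > 0` and
some start above `a` give a finite moment. Three facts make this supremum the required threshold.
Each is read off from the probability `survival a n s` of staying above `a` up to time `n`, since
moments of order `q` and decay of order `n ^ (-q)` determine each other up to an arbitrarily small
loss in `q`.

The set is bounded above (`HeavyTailed.exists_passageMoment_eq_top`). With at least polynomially
small probability the first jump overshoots the origin so far that `n` further jumps of moderate
size cannot bring the walk back to `a`. Hence survival decays at most polynomially.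

The set is non-empty (`HeavyTailed.exists_passageMoment_lt_top`), and only here is (a) or (b)(i)
used. The Lyapunov function is `(1 + ν θ_i) x ^ ν` with small `ν > 0`. To first order in `ν`, its
drift on branch `i` at height `x` is a positive multiple of `x ^ (ν - α_i)` times `α_i ∫ logProfile
u * u ^ (-1 - α_i) du + (Pθ - θ)_i`. The integral equals `π cot (χ_i π α_i)` when `χ_i α_i < 1`, and
it diverges to `-∞` at `u = 0` when `χ_i α_i ≥ 1`. By the Fredholm alternative for `P - 1`, a `θ`
making all these quantities negative exists as soon as their `μ`-average without the `θ` terms is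
negative. Small jumps contribute non-positively by concavity, so every integral may be cut off at
some `η > 0`; this treats both cases alike. Balancing the time spent below height `n ^ (1 / β)`
against the chance of exceeding it turns the drift into polynomial decay of survival
(`HeavyTailed.exists_survival_le`).

Finiteness does not depend on the start or the level (`HeavyTailed.passageMoment_lt_top_of_lt`), up
to a small loss in `q`. Let `G s = ∑ (n + 1) ^ (q - 1) * survival a n s`. One step of the kernel
increases `G` at most by a constant factor, so finiteness at one point spreads by irreducibility to
almost every point of every branch, and then to integrability of `G` against power weights. Since
`survival a n ≤ C (n + 1) ^ (-q) G`, this bounds the contribution of jumps longer than `1`. Shorter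
jumps have total mass `ρ < 1`, and an induction on `n` gives survival of order `exp (ε x) (n + 1) ^
(-q)` from every start. A renewal inequality then passes from one level to any other. -/

namespace BranchWalk

/-- The states strictly above level `a`. -/
def above (S : Type*) (a : ℝ) : Set (ℝ≥0 × S) := {s | a < s.1}

theorem measurableSet_above {S : Type*} [MeasurableSpace S] (a : ℝ) :
    MeasurableSet (above S a) :=
  measurableSet_lt measurable_const (by fun_prop)

/-! ### Survival probabilities and the trajectory law -/

section survival

variable {S : Type*} [Fintype S] (W : BranchWalk S) [MeasurableSpace S] [DiscreteMeasurableSpace S]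

/-- The probability that the chain started at `s` stays above `a` up to time `n`. -/
noncomputable def survival (a : ℝ) : ℕ → ℝ≥0 × S → ℝ≥0∞
  | 0 => (above S a).indicator 1
  | n + 1 => (above S a).indicator fun s => ∫⁻ s', survival a n s' ∂W.kernel s

theorem measurable_survival (a : ℝ) (n : ℕ) : Measurable (W.survival a n) := by
  induction n with
  | zero => exact measurable_one.indicator (measurableSet_above a)
  | succ n ih => exact (ih.lintegral_kernel).indicator (measurableSet_above a)

theorem survival_zero_of_lt {a : ℝ} {s : ℝ≥0 × S} (h : a < s.1) : W.survival a 0 s = 1 :=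
  indicator_of_mem (show s ∈ above S a from h) _

theorem survival_succ_of_lt {a : ℝ} {s : ℝ≥0 × S} (h : a < s.1) (n : ℕ) :
    W.survival a (n + 1) s = ∫⁻ s', W.survival a n s' ∂W.kernel s :=
  indicator_of_mem (show s ∈ above S a from h) _

theorem survival_of_le {a : ℝ} {s : ℝ≥0 × S} (h : (s.1 : ℝ) ≤ a) (n : ℕ) :
    W.survival a n s = 0 := by
  have : s ∉ above S a := not_lt.2 h
  cases n <;> exact indicator_of_notMem this _

theorem survival_succ_le (a : ℝ) (n : ℕ) (s : ℝ≥0 × S) :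
    W.survival a (n + 1) s ≤ ∫⁻ s', W.survival a n s' ∂W.kernel s :=
  indicator_le_self _ _ _

theorem survival_le_one (a : ℝ) (n : ℕ) (s : ℝ≥0 × S) : W.survival a n s ≤ 1 := by
  induction n generalizing s with
  | zero => exact indicator_le_self _ _ _
  | succ n ih =>
    refine (W.survival_succ_le a n s).trans ?_
    calc _ ≤ ∫⁻ _, 1 ∂W.kernel s := lintegral_mono ih
      _ = 1 := by simp

theorem survival_succ_le_self (a : ℝ) (n : ℕ) (s : ℝ≥0 × S) :
    W.survival a (n + 1) s ≤ W.survival a n s := by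
  induction n generalizing s with
  | zero =>
    by_cases h : a < s.1
    · rw [W.survival_zero_of_lt h]; exact W.survival_le_one _ _ _
    · rw [W.survival_of_le (not_lt.1 h)]; exact zero_le
  | succ n ih =>
    by_cases h : a < s.1
    · rw [W.survival_succ_of_lt h, W.survival_succ_of_lt h]
      exact lintegral_mono ih
    · rw [W.survival_of_le (not_lt.1 h)]; exact zero_le

theorem survival_antitone (a : ℝ) (s : ℝ≥0 × S) : Antitone fun n => W.survival a n s :=
  antitone_nat_of_succ_le fun n => W.survival_succ_le_self a n s

/-- This is the Markov property at time `n`: the trajectory law is disintegrated over the history up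
to `n`, which fixes `F` and leaves one application of the kernel for `g`. -/
theorem lintegral_law_succ (s : ℝ≥0 × S) (n : ℕ)
    {F : (Π _ : Finset.Iic n, ℝ≥0 × S) → ℝ≥0∞} (hF : Measurable F) {g : ℝ≥0 × S → ℝ≥0∞}
    (hg : Measurable g) :
    ∫⁻ ω, F (Preorder.frestrictLe n ω) * g (ω (n + 1)) ∂W.law s =
      ∫⁻ ω, F (Preorder.frestrictLe n ω) * ∫⁻ s', g s' ∂W.kernel (ω n) ∂W.law s := by
  have key : ∀ {f : (ℕ → ℝ≥0 × S) → ℝ≥0∞}, Measurable f → ∫⁻ ω, f ω ∂W.law s =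
      ∫⁻ h, ∫⁻ ω, f (Function.updateFinset ω _ h) ∂(Kernel.traj (X := fun _ => ℝ≥0 × S)
        W.historyKernel n h) ∂(Kernel.partialTraj (X := fun _ => ℝ≥0 × S)
          W.historyKernel 0 n fun _ => s) := by
    intro f hf
    rw [law, ← Kernel.traj_comp_partialTraj (Nat.zero_le n), Kernel.lintegral_comp _ _ _ hf]
    refine lintegral_congr fun h => ?_
    rw [Kernel.lintegral_traj _ hf]
  have hm1 : Measurable fun ω : ℕ → ℝ≥0 × S => F (Preorder.frestrictLe n ω) := by fun_prop
  have hm2 : Measurable fun ω : ℕ → ℝ≥0 × S => ∫⁻ s', g s' ∂W.kernel (ω n) :=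
    (hg.lintegral_kernel (κ := W.kernel)).comp (measurable_pi_apply n)
  rw [key (by fun_prop), key (f := fun ω => F (Preorder.frestrictLe n ω) *
    ∫⁻ s', g s' ∂W.kernel (ω n)) (hm1.mul hm2)]
  refine lintegral_congr fun h => ?_
  have h1 : ∀ ω : ℕ → ℝ≥0 × S, Preorder.frestrictLe n
      (Function.updateFinset ω (Finset.Iic n) h) = h := by
    intro ω; ext1 i; simp [Function.updateFinset]
  have h2 : ∀ ω : ℕ → ℝ≥0 × S, Function.updateFinset ω (Finset.Iic n) h (n + 1) = ω (n + 1) := by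
    intro ω; simp [Function.updateFinset]
  have h3 : ∀ ω : ℕ → ℝ≥0 × S, Function.updateFinset ω (Finset.Iic n) h n =
      h ⟨n, Finset.mem_Iic.2 le_rfl⟩ := by
    intro ω; simp [Function.updateFinset]
  simp only [h1, h2, h3]
  rw [lintegral_const_mul _ (by fun_prop), lintegral_const, measure_univ, mul_one]
  congr 1
  have := Kernel.map_traj_succ_self (X := fun _ => ℝ≥0 × S) (κ := W.historyKernel) (a := n)
  rw [show W.kernel (h ⟨n, Finset.mem_Iic.2 le_rfl⟩) = W.historyKernel n h from rfl, ← this,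
    Kernel.map_apply _ (by fun_prop), lintegral_map hg (by fun_prop)]

theorem law_zero (s : ℝ≥0 × S) {g : ℝ≥0 × S → ℝ≥0∞} (hg : Measurable g) :
    ∫⁻ ω, g (ω 0) ∂W.law s = g s := by
  rw [law, Kernel.lintegral_traj _ (by fun_prop)]
  simp [Function.updateFinset]

theorem law_forall_lt (a : ℝ) (s : ℝ≥0 × S) (n : ℕ) :
    W.law s {ω | ∀ m ≤ n, a < (ω m).1} = W.survival a n s := by
  let A : ∀ n : ℕ, Set (Π _ : Finset.Iic n, ℝ≥0 × S) := fun n => {h | ∀ i, a < (h i).1}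
  have hA : ∀ n, MeasurableSet (A n) := by
    intro n
    simp only [A, ofPred_forall]
    exact MeasurableSet.iInter fun i => measurableSet_lt measurable_const (by fun_prop)
  have hmem : ∀ n (ω : ℕ → ℝ≥0 × S), Preorder.frestrictLe n ω ∈ A n ↔ ∀ m ≤ n, a < (ω m).1 := by
    intro n ω
    simp [A, Preorder.frestrictLe]
  -- The remaining time `k` stays free in the induction, so that the Markov property can shift one
  -- step at a time from the path into `survival`; `k = 0` gives the claim.
  have key : ∀ n k, ∫⁻ ω, (A n).indicator 1 (Preorder.frestrictLe n ω) * W.survival a k (ω n)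
      ∂W.law s = W.survival a (n + k) s := by
    intro n
    induction n with
    | zero =>
      intro k
      have : ∀ ω : ℕ → ℝ≥0 × S, (A 0).indicator 1 (Preorder.frestrictLe 0 ω) *
          W.survival a k (ω 0) = W.survival a k (ω 0) := by
        intro ω
        by_cases h : Preorder.frestrictLe 0 ω ∈ A 0
        · simp [h]
        · rw [indicator_of_notMem h, zero_mul, W.survival_of_le]
          rw [hmem] at h
          simpa using h
      simp only [this, zero_add]
      exact W.law_zero s (W.measurable_survival a k)
    | succ n ih =>
      intro k
      rw [show n + 1 + k = n + (k + 1) by ring, ← ih (k + 1)]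
      have : ∀ ω : ℕ → ℝ≥0 × S, (A (n + 1)).indicator 1 (Preorder.frestrictLe (n + 1) ω) *
          W.survival a k (ω (n + 1)) = (A n).indicator 1 (Preorder.frestrictLe n ω) *
          W.survival a k (ω (n + 1)) := by
        intro ω
        by_cases h : a < (ω (n + 1)).1
        · congr 1
          have : Preorder.frestrictLe (n + 1) ω ∈ A (n + 1) ↔ Preorder.frestrictLe n ω ∈ A n := by
            rw [hmem, hmem]
            constructor
            · intro h' m hm; exact h' m (hm.trans n.le_succ)
            · intro h' m hm
              rcases Nat.le_succ_iff.1 hm with h1 | rfl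
              · exact h' m h1
              · exact h
          by_cases h' : Preorder.frestrictLe n ω ∈ A n
          · simp [h', this.2 h']
          · simp [h', mt this.1 h']
        · simp [W.survival_of_le (not_lt.1 h)]
      simp only [this]
      rw [W.lintegral_law_succ s n (measurable_one.indicator (hA n)) (W.measurable_survival a k)]
      refine lintegral_congr fun ω => ?_
      by_cases h : Preorder.frestrictLe n ω ∈ A n
      · rw [W.survival_succ_of_lt (((hmem n ω).1 h) n le_rfl)]
      · rw [indicator_of_notMem h, zero_mul, zero_mul]
  have h0 := key n 0
  rw [add_zero] at h0
  rw [← h0, ← lintegral_indicator_one]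
  · refine lintegral_congr fun ω => ?_
    by_cases h : ∀ m ≤ n, a < (ω m).1
    · rw [indicator_of_mem (show ω ∈ {ω : ℕ → ℝ≥0 × S | ∀ m ≤ n, a < (ω m).1} from h),
        indicator_of_mem ((hmem n ω).2 h), W.survival_zero_of_lt (h n le_rfl)]
      simp
    · rw [indicator_of_notMem (show ω ∉ {ω : ℕ → ℝ≥0 × S | ∀ m ≤ n, a < (ω m).1} from h),
        indicator_of_notMem (mt (hmem n ω).1 h), zero_mul]
  · have : {ω : ℕ → ℝ≥0 × S | ∀ m ≤ n, a < (ω m).1} = Preorder.frestrictLe n ⁻¹' A n := by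
      ext ω; exact (hmem n ω).symm
    rw [this]
    exact (hA n).preimage (by fun_prop)

end survival

end BranchWalk

/-! ### Moments of the passage time in terms of survival probabilities -/

theorem Nat.succ_rpow_le_add (q : ℝ) (n : ℕ) :
    ((n : ℝ) + 1) ^ q ≤ (n : ℝ) ^ q + max q 1 * ((n : ℝ) + 1) ^ (q - 1) := by
  have hn : (0 : ℝ) < (n : ℝ) + 1 := by positivity
  have hx : 1 + (-(1 / ((n : ℝ) + 1))) = n / (n + 1) := by field_simp; ring
  have hx0 : (0 : ℝ) ≤ n / (n + 1) := by positivity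
  have hx1 : (n : ℝ) / (n + 1) ≤ 1 := by rw [div_le_one hn]; linarith
  have key : 1 - max q 1 * (1 / ((n : ℝ) + 1)) ≤ ((n : ℝ) / (n + 1)) ^ q := by
    rcases le_total 1 q with h | h
    · have := one_add_mul_self_le_rpow_one_add (s := -(1 / ((n : ℝ) + 1)))
        (by rw [neg_le_neg_iff, div_le_one hn]; linarith) h
      rw [hx] at this
      rw [max_eq_left h]
      linarith
    · rw [max_eq_right h]
      calc _ = (n : ℝ) / (n + 1) := by rw [← hx]; ring
        _ ≤ _ := Real.self_le_rpow_of_le_one hx0 hx1 h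
  have h1 : ((n : ℝ) / (n + 1)) ^ q = (n : ℝ) ^ q / ((n : ℝ) + 1) ^ q :=
    Real.div_rpow (by positivity) hn.le q
  have h2 : ((n : ℝ) + 1) ^ (q - 1) = ((n : ℝ) + 1) ^ q * (1 / ((n : ℝ) + 1)) := by
    rw [Real.rpow_sub_one hn.ne']; ring
  rw [h1] at key
  have h3 : (0 : ℝ) < ((n : ℝ) + 1) ^ q := by positivity
  rw [h2]
  rw [le_div_iff₀ h3] at key
  linarith

theorem Nat.rpow_le_sum {q : ℝ} (hq : 0 < q) (N : ℕ) :
    (N : ℝ) ^ q ≤ max q 1 * ∑ n ∈ Finset.range N, ((n : ℝ) + 1) ^ (q - 1) := by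
  induction N with
  | zero => simp [Real.zero_rpow hq.ne']
  | succ N ih =>
    rw [Finset.sum_range_succ, mul_add]
    push_cast
    linarith [Nat.succ_rpow_le_add q N]

section passageTime

variable {S : Type*}

theorem le_passageTime {a : ℝ} {ω : ℕ → ℝ≥0 × S} {n : ℕ} (h : ∀ m ≤ n, a < (ω m).1) :
    ((n + 1 : ℕ) : ℝ≥0∞) ≤ passageTime a ω := by
  refine le_iInf₂ fun m hm => ?_
  by_contra! hlt
  have : m < n + 1 := by exact_mod_cast hlt
  exact absurd (h m (by omega)) (not_lt.2 hm)

theorem passageTime_eq_natCast_or_eq_top (a : ℝ) (ω : ℕ → ℝ≥0 × S) :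
    (∃ N : ℕ, passageTime a ω = N ∧ ∀ m < N, a < (ω m).1) ∨
      (passageTime a ω = ⊤ ∧ ∀ m, a < (ω m).1) := by
  classical
  by_cases h : ∃ n, ((ω n).1 : ℝ) ≤ a
  · refine Or.inl ⟨Nat.find h, le_antisymm (iInf₂_le (Nat.find h) (Nat.find_spec h)) ?_, fun m hm =>
      not_le.1 (Nat.find_min h hm)⟩
    refine le_iInf₂ fun m hm => ?_
    exact_mod_cast Nat.find_min' h hm
  · push Not at h
    refine Or.inr ⟨?_, h⟩
    refine iInf₂_eq_top.2 fun n hn => ?_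
    exact absurd (h n) (not_lt.2 hn)

theorem passageTime_rpow_le_tsum {q : ℝ} (hq : 0 < q) (a : ℝ) (ω : ℕ → ℝ≥0 × S) :
    passageTime a ω ^ q ≤ ENNReal.ofReal (max q 1) * ∑' n : ℕ,
      ENNReal.ofReal (((n : ℝ) + 1) ^ (q - 1)) *
        {ω : ℕ → ℝ≥0 × S | ∀ m ≤ n, a < (ω m).1}.indicator 1 ω := by
  have key : ∀ N : ℕ, (∀ m < N, a < (ω m).1) → (N : ℝ≥0∞) ^ q ≤ ENNReal.ofReal (max q 1) *
      ∑' n : ℕ, ENNReal.ofReal (((n : ℝ) + 1) ^ (q - 1)) *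
        {ω : ℕ → ℝ≥0 × S | ∀ m ≤ n, a < (ω m).1}.indicator 1 ω := by
    intro N hN
    calc (N : ℝ≥0∞) ^ q = ENNReal.ofReal ((N : ℝ) ^ q) := by
          rw [← ENNReal.ofReal_rpow_of_nonneg (by positivity) hq.le, ENNReal.ofReal_natCast]
      _ ≤ ENNReal.ofReal (max q 1 * ∑ n ∈ Finset.range N, ((n : ℝ) + 1) ^ (q - 1)) :=
          ENNReal.ofReal_le_ofReal (Nat.rpow_le_sum hq N)
      _ = ENNReal.ofReal (max q 1) *
          ∑ n ∈ Finset.range N, ENNReal.ofReal (((n : ℝ) + 1) ^ (q - 1)) := by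
          rw [ENNReal.ofReal_mul (by positivity), ENNReal.ofReal_sum_of_nonneg]
          intro i _; positivity
      _ = ENNReal.ofReal (max q 1) * ∑ n ∈ Finset.range N,
          ENNReal.ofReal (((n : ℝ) + 1) ^ (q - 1)) *
          {ω : ℕ → ℝ≥0 × S | ∀ m ≤ n, a < (ω m).1}.indicator 1 ω := by
          congr 1
          refine Finset.sum_congr rfl fun n hn => ?_
          rw [indicator_of_mem (show ω ∈ {ω : ℕ → ℝ≥0 × S | ∀ m ≤ n, a < (ω m).1} from
            fun m hm => hN m (lt_of_le_of_lt hm (Finset.mem_range.1 hn)))]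
          simp
      _ ≤ _ := by gcongr; exact ENNReal.sum_le_tsum _
  rcases passageTime_eq_natCast_or_eq_top a ω with ⟨N, h, hN⟩ | ⟨h, hN⟩
  · rw [h]; exact key N hN
  · rw [h, ENNReal.top_rpow_of_pos hq]
    -- If the level is never reached, the bound holds for every finite `N`, hence in the limit.
    refine le_of_tendsto' (f := fun N : ℕ => (N : ℝ≥0∞) ^ q) (x := atTop) ?_
      fun N => key N fun m _ => hN m
    have := (ENNReal.continuous_rpow_const (y := q)).tendsto ⊤
    rw [ENNReal.top_rpow_of_pos hq] at this
    exact this.comp ENNReal.tendsto_nat_nhds_top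

end passageTime

namespace BranchWalk

theorem measurableSet_forall_lt {S : Type*} [MeasurableSpace S] (a : ℝ) (n : ℕ) :
    MeasurableSet {ω : ℕ → ℝ≥0 × S | ∀ m ≤ n, a < (ω m).1} := by
  simp only [ofPred_forall]
  exact MeasurableSet.iInter fun m => MeasurableSet.iInter fun _ =>
    measurableSet_lt measurable_const (by fun_prop)

variable {S : Type*} [Fintype S] (W : BranchWalk S) [MeasurableSpace S] [DiscreteMeasurableSpace S]

theorem mul_survival_le_passageMoment {q : ℝ} (hq : 0 ≤ q) (a : ℝ) (x : ℝ≥0) (k : S) (n : ℕ) :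
    ENNReal.ofReal (((n : ℝ) + 1) ^ q) * W.survival a n (x, k) ≤ W.passageMoment a x k q := by
  rw [passageMoment, ← W.law_forall_lt, ← setLIntegral_const]
  refine (setLIntegral_mono' (measurableSet_forall_lt a n) fun ω hω => ?_).trans
    (setLIntegral_le_lintegral _ _)
  rw [← ENNReal.ofReal_rpow_of_nonneg (by positivity) hq]
  refine ENNReal.rpow_le_rpow ?_ hq
  refine le_trans (le_of_eq ?_) (le_passageTime hω)
  rw [← ENNReal.ofReal_natCast]
  push_cast
  rfl

theorem passageMoment_le_tsum {q : ℝ} (hq : 0 < q) (a : ℝ) (x : ℝ≥0) (k : S) :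
    W.passageMoment a x k q ≤ ENNReal.ofReal (max q 1) * ∑' n : ℕ,
      ENNReal.ofReal (((n : ℝ) + 1) ^ (q - 1)) * W.survival a n (x, k) := by
  have hm : ∀ n : ℕ, Measurable ({ω : ℕ → ℝ≥0 × S | ∀ m ≤ n, a < (ω m).1}.indicator
      (1 : (ℕ → ℝ≥0 × S) → ℝ≥0∞)) := fun n =>
    measurable_one.indicator (measurableSet_forall_lt a n)
  refine (lintegral_mono fun ω => passageTime_rpow_le_tsum hq a ω).trans (le_of_eq ?_)
  rw [lintegral_const_mul _ (Measurable.tsum fun n => (hm n).const_mul _),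
    lintegral_tsum fun n => ((hm n).const_mul _).aemeasurable]
  congr 1
  refine tsum_congr fun n => ?_
  rw [lintegral_const_mul _ (hm n), lintegral_indicator_one (measurableSet_forall_lt a n),
    W.law_forall_lt]

theorem summable_succ_rpow {p : ℝ} (hp : p < -1) : Summable fun n : ℕ => ((n : ℝ) + 1) ^ p := by
  have := (summable_nat_add_iff (f := fun n : ℕ => (n : ℝ) ^ p) 1).2 (Real.summable_nat_rpow.2 hp)
  simpa using this

theorem tsum_mul_survival_lt_top {r p : ℝ} (hrp : r + 1 < p) {a : ℝ} {s : ℝ≥0 × S} {C : ℝ≥0∞}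
    (hC : C ≠ ⊤) (h : ∀ n : ℕ, W.survival a n s ≤ C * ENNReal.ofReal (((n : ℝ) + 1) ^ (-p))) :
    ∑' n : ℕ, ENNReal.ofReal (((n : ℝ) + 1) ^ r) * W.survival a n s < ⊤ := by
  calc _ ≤ ∑' n : ℕ, C * ENNReal.ofReal (((n : ℝ) + 1) ^ (r - p)) := by
        refine ENNReal.tsum_le_tsum fun n => ?_
        calc _ ≤ ENNReal.ofReal (((n : ℝ) + 1) ^ r) *
              (C * ENNReal.ofReal (((n : ℝ) + 1) ^ (-p))) := by gcongr; exact h n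
          _ = C * ENNReal.ofReal (((n : ℝ) + 1) ^ (r - p)) := by
            rw [mul_left_comm, ← ENNReal.ofReal_mul (by positivity),
              ← Real.rpow_add (by positivity), sub_eq_add_neg]
    _ = C * ∑' n : ℕ, ENNReal.ofReal (((n : ℝ) + 1) ^ (r - p)) := ENNReal.tsum_mul_left
    _ < ⊤ := by
      refine ENNReal.mul_lt_top hC.lt_top ?_
      rw [← ENNReal.ofReal_tsum_of_nonneg (fun n => by positivity)
        (summable_succ_rpow (by linarith))]
      exact ENNReal.ofReal_lt_top

theorem passageMoment_lt_top_of_survival_le {q p : ℝ} (hqp : q < p) {a : ℝ} {x : ℝ≥0}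
    {k : S} (hx : a < x) {C : ℝ≥0∞} (hC : C ≠ ⊤)
    (h : ∀ n : ℕ, W.survival a n (x, k) ≤ C * ENNReal.ofReal (((n : ℝ) + 1) ^ (-p))) :
    W.passageMoment a x k q < ⊤ := by
  rcases lt_or_ge 0 q with hq | hq
  · exact (W.passageMoment_le_tsum hq a x k).trans_lt
      (ENNReal.mul_lt_top ENNReal.ofReal_lt_top
        (W.tsum_mul_survival_lt_top (by linarith) hC h))
  · have h0 : ∀ᵐ ω ∂W.law (x, k), a < (ω 0).1 := by
      have h1 := W.law_forall_lt a (x, k) 0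
      rw [W.survival_zero_of_lt hx] at h1
      have : IsProbabilityMeasure (W.law (x, k)) := by unfold law; infer_instance
      have h2 := (prob_compl_eq_zero_iff (measurableSet_forall_lt a 0)).2 h1
      filter_upwards [measure_eq_zero_iff_ae_notMem.1 h2] with ω hω
      simpa using hω
    have : IsProbabilityMeasure (W.law (x, k)) := by unfold law; infer_instance
    calc W.passageMoment a x k q ≤ ∫⁻ _, 1 ∂W.law (x, k) := by
          refine lintegral_mono_ae ?_
          filter_upwards [h0] with ω hω
          rcases hq.eq_or_lt with rfl | hq
          · simp
          -- The start above `a` forces the passage time to be at least `1`. This matters because a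
          -- negative power of zero is infinite in `ℝ≥0∞`.
          refine ENNReal.rpow_le_one_of_one_le_of_neg ?_ hq
          have := le_passageTime (ω := ω) (a := a) (n := 0) (by simpa using hω)
          simpa using this
      _ < ⊤ := by simp

end BranchWalk

/-! ### One-step integrals in the signed coordinate -/

theorem lintegral_eq_Ici_add_Ioi_neg {f : ℝ → ℝ≥0∞} :
    ∫⁻ z, f z = (∫⁻ z in Ici 0, f z) + ∫⁻ z in Ioi 0, f (-z) := by
  rw [← lintegral_add_compl f (measurableSet_Ici (a := (0 : ℝ))), compl_Ici]
  congr 1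
  rw [← lintegral_indicator measurableSet_Iio, ← lintegral_indicator measurableSet_Ioi,
    ← lintegral_neg_eq_self]
  congr 1 with z
  by_cases h : 0 < z <;> simp [indicator, h]

namespace BranchType

/-- The average of `F` over the two positions `x - t`, `x + t` on a symmetric branch; the value
at `x - t` on a one-sided branch. -/
noncomputable def avg : BranchType → (ℝ → ℝ≥0∞) → ℝ → ℝ → ℝ≥0∞
  | .oneSided, F, x, t => F (x - t)
  | .symmetric, F, x, t => (F (x - t) + F (x + t)) / 2

theorem avg_mono (b : BranchType) {F G : ℝ → ℝ≥0∞} (x t : ℝ) (h1 : F (x - t) ≤ G (x - t))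
    (h2 : F (x + t) ≤ G (x + t)) : b.avg F x t ≤ b.avg G x t := by
  cases b
  · exact h1
  · simp only [avg]; gcongr

theorem avg_const (b : BranchType) {F : ℝ → ℝ≥0∞} {c : ℝ≥0∞} (x t : ℝ) (h1 : F (x - t) = c)
    (h2 : F (x + t) = c) : b.avg F x t = c := by
  cases b
  · exact h1
  · simp only [avg, h1, h2]
    rw [ENNReal.add_div, ENNReal.add_halves]

theorem half_le_avg (b : BranchType) (F : ℝ → ℝ≥0∞) (x t : ℝ) :
    F (x - t) / 2 ≤ b.avg F x t := by
  cases b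
  · exact ENNReal.half_le_self
  · simp only [avg]; gcongr; exact le_self_add

end BranchType

namespace BranchWalk

theorem lintegral_onBranch {S : Type*} [MeasurableSpace S] {g : ℝ → ℝ} (hg : Measurable g)
    (j : S) {h : ℝ≥0 × S → ℝ≥0∞} (hh : Measurable h) :
    ∫⁻ s, h s ∂onBranch g j = ∫⁻ z in Ici 0, ENNReal.ofReal (g z) * h (z.toNNReal, j) := by
  have hm : Measurable fun z : ℝ => (z.toNNReal, j) := by fun_prop
  have hm' : Measurable fun z : ℝ => h (z.toNNReal, j) := hh.comp hm
  rw [onBranch, lintegral_map hh hm, lintegral_withDensity_eq_lintegral_mul _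
    hg.ennreal_ofReal hm']
  rfl

variable {S : Type*} [Fintype S] (W : BranchWalk S)

/-- The function obtained from `h : ℝ≥0 × S → ℝ≥0∞` by averaging over the branch reached when the
signed position on branch `i` becomes `z`. -/
noncomputable def landing (i : S) (h : ℝ≥0 × S → ℝ≥0∞) (z : ℝ) : ℝ≥0∞ :=
  if 0 ≤ z then h (z.toNNReal, i) else ∑ j, ENNReal.ofReal (W.p i j) * h ((-z).toNNReal, j)

theorem sum_ofReal_p (i : S) : ∑ j, ENNReal.ofReal (W.p i j) = 1 := by
  rw [← ENNReal.ofReal_sum_of_nonneg fun j _ => W.irreducible.nonneg i j, W.row_sum,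
    ENNReal.ofReal_one]

theorem landing_of_nonneg (i : S) (h : ℝ≥0 × S → ℝ≥0∞) {z : ℝ} (hz : 0 ≤ z) :
    W.landing i h z = h (z.toNNReal, i) := if_pos hz

theorem landing_of_neg (i : S) (h : ℝ≥0 × S → ℝ≥0∞) {z : ℝ} (hz : z < 0) :
    W.landing i h z = ∑ j, ENNReal.ofReal (W.p i j) * h ((-z).toNNReal, j) :=
  if_neg (not_le.2 hz)

theorem landing_le (i : S) {h : ℝ≥0 × S → ℝ≥0∞} {z : ℝ} {c : ℝ≥0∞}
    (hc : ∀ j, h (|z|.toNNReal, j) ≤ c) : W.landing i h z ≤ c := by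
  rcases le_or_gt 0 z with hz | hz
  · rw [W.landing_of_nonneg i h hz]; simpa [abs_of_nonneg hz] using hc i
  · rw [W.landing_of_neg i h hz]
    rw [abs_of_neg hz] at hc
    calc _ ≤ ∑ j, ENNReal.ofReal (W.p i j) * c := by gcongr with j _; exact hc j
      _ = c := by rw [← Finset.sum_mul, W.sum_ofReal_p, one_mul]

theorem le_landing (i : S) {h : ℝ≥0 × S → ℝ≥0∞} {z : ℝ} {c : ℝ≥0∞}
    (hc : ∀ j, c ≤ h (|z|.toNNReal, j)) : c ≤ W.landing i h z := by
  rcases le_or_gt 0 z with hz | hz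
  · rw [W.landing_of_nonneg i h hz]; simpa [abs_of_nonneg hz] using hc i
  · rw [W.landing_of_neg i h hz]
    rw [abs_of_neg hz] at hc
    calc c = ∑ j, ENNReal.ofReal (W.p i j) * c := by
          rw [← Finset.sum_mul, W.sum_ofReal_p, one_mul]
      _ ≤ _ := by gcongr with j _; exact hc j

variable [MeasurableSpace S]

theorem measurable_landing (i : S) {h : ℝ≥0 × S → ℝ≥0∞} (hh : Measurable h) :
    Measurable (W.landing i h) := by
  refine Measurable.ite measurableSet_Ici (hh.comp (by fun_prop)) ?_
  exact Finset.measurable_sum _ fun j _ => (hh.comp (by fun_prop)).const_mul _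

variable [DiscreteMeasurableSpace S]

/-- The step is an ordinary increment on the whole line, followed by routing when the signed
position is negative. Both parts of the kernel thus become a single integral against `W.w i`. -/
theorem lintegral_kernel (x : ℝ≥0) (i : S) {h : ℝ≥0 × S → ℝ≥0∞} (hh : Measurable h) :
    ∫⁻ s, h s ∂W.kernel (x, i) =
      ∫⁻ y, ENNReal.ofReal (W.w i y) * W.landing i h (x + y) := by
  have hw := (W.isProbDensity i).measurable
  have hR : ∫⁻ y, ENNReal.ofReal (W.w i y) * W.landing i h (x + y) =
      ∫⁻ z, ENNReal.ofReal (W.w i (z - x)) * W.landing i h z := by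
    rw [← lintegral_sub_right_eq_self _ (x : ℝ)]
    simp
  have hm : ∀ j, Measurable fun z : ℝ => h (z.toNNReal, j) := fun j => hh.comp (by fun_prop)
  rw [hR, lintegral_eq_Ici_add_Ioi_neg, add_comm]
  have hw1 : Measurable fun z : ℝ => W.w i (-z - x) := hw.comp (by fun_prop)
  have hw2 : Measurable fun z : ℝ => W.w i (z - x) := hw.comp (by fun_prop)
  have hk : W.kernel (x, i) = (∑ j, ENNReal.ofReal (W.p i j) •
      onBranch (fun z => W.w i (-z - x)) j) + onBranch (fun z => W.w i (z - x)) i := rfl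
  rw [hk, lintegral_add_measure, lintegral_finsetSum_measure]
  congr 1
  · simp only [lintegral_smul_measure, smul_eq_mul]
    have : ∀ j, ∫⁻ s, h s ∂onBranch (fun z => W.w i (-z - x)) j =
        ∫⁻ z in Ioi 0, ENNReal.ofReal (W.w i (-z - x)) * h (z.toNNReal, j) := fun j => by
      rw [lintegral_onBranch hw1 j hh, restrict_Ioi_eq_restrict_Ici]
    simp only [this]
    have hm2 : ∀ j, Measurable fun z : ℝ =>
        ENNReal.ofReal (W.w i (-z - x)) * h (z.toNNReal, j) := fun j =>
      hw1.ennreal_ofReal.mul (hm j)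
    have hc : ∀ j, ENNReal.ofReal (W.p i j) * ∫⁻ z in Ioi 0,
        ENNReal.ofReal (W.w i (-z - x)) * h (z.toNNReal, j) = ∫⁻ z in Ioi 0,
        ENNReal.ofReal (W.p i j) * (ENNReal.ofReal (W.w i (-z - x)) * h (z.toNNReal, j)) := fun j =>
      (lintegral_const_mul _ (hm2 j)).symm
    simp only [hc]
    rw [← lintegral_finsetSum _ fun j _ => (hm2 j).const_mul _]
    refine setLIntegral_congr_fun measurableSet_Ioi fun z hz => ?_
    have hz' : -z < 0 := neg_lt_zero.2 hz
    simp only [W.landing_of_neg i h hz', neg_neg, Finset.mul_sum]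
    exact Finset.sum_congr rfl fun j _ => mul_left_comm _ _ _
  · rw [lintegral_onBranch hw2 i hh]
    refine setLIntegral_congr_fun measurableSet_Ici fun z hz => ?_
    simp only [W.landing_of_nonneg i h hz]

variable {W} {ty : S → BranchType} {α c : S → ℝ} {v : S → ℝ → ℝ}

theorem HeavyTailed.lintegral_kernel (hW : W.HeavyTailed ty α c v) (x : ℝ≥0) (i : S)
    {h : ℝ≥0 × S → ℝ≥0∞} (hh : Measurable h) :
    ∫⁻ s, h s ∂W.kernel (x, i) =
      ∫⁻ t in Ioi 0, ENNReal.ofReal (v i t) * (ty i).avg (W.landing i h) x t := by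
  rw [W.lintegral_kernel x i hh]
  obtain ⟨-, -, hv, hw⟩ := hW
  obtain ⟨hd, C, -, -, -, -, h0⟩ := hv i
  have hl := W.measurable_landing i hh
  have hvm := hd.measurable.ennreal_ofReal
  simp only [hw]
  rw [lintegral_eq_Ici_add_Ioi_neg, ← restrict_Ioi_eq_restrict_Ici]
  cases hty : ty i
  · simp only [BranchType.stepDensity, BranchType.avg, neg_neg]
    have : ∫⁻ z in Ioi (0 : ℝ), ENNReal.ofReal (v i (-z)) * W.landing i h (x + z) = 0 := by
      rw [setLIntegral_congr_fun (g := fun _ => 0) measurableSet_Ioi fun z hz => ?_]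
      · simp
      · simp [h0 (-z) (neg_nonpos.2 (le_of_lt hz))]
    rw [this, zero_add]
    rfl
  · have hhalf : ENNReal.ofReal (1 / 2) = 2⁻¹ := by
      rw [one_div, ENNReal.ofReal_inv_of_pos two_pos, ENNReal.ofReal_ofNat]
    simp only [BranchType.stepDensity, BranchType.avg, abs_neg, ← sub_eq_add_neg]
    have hv1 : Measurable fun z : ℝ => v i |z| := hd.measurable.comp (by fun_prop)
    have hl1 : Measurable fun z : ℝ => W.landing i h (x + z) := hl.comp (by fun_prop)
    have hv2 : Measurable fun z : ℝ => ENNReal.ofReal (1 / 2 * v i |z|) * W.landing i h (x + z) :=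
      (hv1.const_mul _).ennreal_ofReal.mul hl1
    rw [← lintegral_add_left hv2]
    refine setLIntegral_congr_fun measurableSet_Ioi fun z hz => ?_
    simp only [abs_of_pos (show 0 < z from hz)]
    rw [ENNReal.ofReal_mul (by norm_num), hhalf, ENNReal.div_eq_inv_mul]
    ring

end BranchWalk

/-! ### Power bounds for the jump tails -/

section TailClass

variable {α c : ℝ} {v : ℝ → ℝ}

theorem TailClass.measurable (hv : TailClass α c v) : Measurable v := hv.1.measurable

theorem TailClass.nonneg (hv : TailClass α c v) (y : ℝ) : 0 ≤ v y := hv.1.nonneg y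

theorem TailClass.pos (hv : TailClass α c v) {y : ℝ} (hy : 0 < y) : 0 < v y := by
  obtain ⟨-, C, hC, -, -, h, -⟩ := hv
  rw [h y hy]
  exact mul_pos (hC y hy.le) (Real.rpow_pos_of_pos hy _)

theorem TailClass.exists_le (hv : TailClass α c v) :
    ∃ K, 0 < K ∧ ∀ y, 0 < y → v y ≤ K * y ^ (-1 - α) := by
  obtain ⟨-, C, hC, ⟨K, hK⟩, -, h, -⟩ := hv
  refine ⟨K, (hC 0 le_rfl).trans_le (hK 0 le_rfl), fun y hy => ?_⟩
  rw [h y hy]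
  exact mul_le_mul_of_nonneg_right (hK y hy.le) (Real.rpow_nonneg hy.le _)

theorem TailClass.exists_ge (hc : 0 < c) (hv : TailClass α c v) :
    ∃ k R, 0 < k ∧ 1 ≤ R ∧ ∀ y, R ≤ y → k * y ^ (-1 - α) ≤ v y := by
  obtain ⟨-, C, hC, -, hlim, h, -⟩ := hv
  obtain ⟨R, hR⟩ := eventually_atTop.1 (hlim.eventually (lt_mem_nhds (half_lt_self hc)))
  refine ⟨c / 2, max R 1, half_pos hc, le_max_right _ _, fun y hy => ?_⟩
  have hy0 : 0 < y := one_pos.trans_le ((le_max_right _ _).trans hy)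
  rw [h y hy0]
  exact mul_le_mul_of_nonneg_right (hR y ((le_max_left _ _).trans hy)).le
    (Real.rpow_nonneg hy0.le _)

theorem TailClass.lintegral_Ioi_eq_one (hv : TailClass α c v) :
    ∫⁻ y in Ioi 0, ENNReal.ofReal (v y) = 1 := by
  rw [← hv.1.lintegral_eq_one, ← lintegral_indicator measurableSet_Ioi]
  congr 1 with y
  by_cases hy : 0 < y
  · simp [hy]
  · obtain ⟨-, C, -, -, -, -, h⟩ := hv
    simp [hy, h y (not_lt.1 hy)]

theorem lintegral_Ioi_const_mul_rpow (hα : 0 < α) {K D : ℝ} (hK : 0 ≤ K) (hD : 0 < D) :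
    ∫⁻ y in Ioi D, ENNReal.ofReal (K * y ^ (-1 - α)) = ENNReal.ofReal (K / α * D ^ (-α)) := by
  rw [← ofReal_integral_eq_lintegral_ofReal]
  · rw [integral_const_mul, integral_Ioi_rpow_of_lt (by linarith) hD]
    congr 1
    rw [show -1 - α + 1 = -α by ring]
    field_simp
  · exact (integrableOn_Ioi_rpow_of_lt (by linarith) hD).const_mul _
  · filter_upwards [ae_restrict_mem measurableSet_Ioi] with y hy
    exact mul_nonneg hK (Real.rpow_nonneg (hD.trans hy).le _)

theorem TailClass.exists_lintegral_Ioi_le (hα : 0 < α) (hv : TailClass α c v) :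
    ∃ K, 0 < K ∧ ∀ D, 0 < D → ∫⁻ y in Ioi D, ENNReal.ofReal (v y) ≤
      ENNReal.ofReal (K * D ^ (-α)) := by
  obtain ⟨K, hK, h⟩ := hv.exists_le
  refine ⟨K / α, by positivity, fun D hD => ?_⟩
  rw [← lintegral_Ioi_const_mul_rpow hα hK.le hD]
  exact setLIntegral_mono' measurableSet_Ioi fun y hy =>
    ENNReal.ofReal_le_ofReal (h y (hD.trans hy))

theorem TailClass.exists_le_lintegral_Ioi (hα : 0 < α) (hc : 0 < c) (hv : TailClass α c v) :
    ∃ k, 0 < k ∧ ∀ D, 1 ≤ D → ENNReal.ofReal (k * D ^ (-α)) ≤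
      ∫⁻ y in Ioi D, ENNReal.ofReal (v y) := by
  obtain ⟨k, R, hk, hR, h⟩ := hv.exists_ge hc
  have hR0 : 0 < R := one_pos.trans_le hR
  refine ⟨k / α * R ^ (-α), by positivity, fun D hD => ?_⟩
  have hD0 : 0 < D := one_pos.trans_le hD
  calc ENNReal.ofReal (k / α * R ^ (-α) * D ^ (-α)) = ENNReal.ofReal (k / α * (R * D) ^ (-α)) := by
        rw [Real.mul_rpow hR0.le hD0.le, mul_assoc]
    _ = ∫⁻ y in Ioi (R * D), ENNReal.ofReal (k * y ^ (-1 - α)) :=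
        (lintegral_Ioi_const_mul_rpow hα hk.le (by positivity)).symm
    _ ≤ ∫⁻ y in Ioi (R * D), ENNReal.ofReal (v y) :=
        setLIntegral_mono' measurableSet_Ioi fun y hy => ENNReal.ofReal_le_ofReal
          (h y (le_of_lt (lt_of_le_of_lt (le_mul_of_one_le_right hR0.le hD) hy)))
    _ ≤ _ := lintegral_mono_set (Ioi_subset_Ioi (le_mul_of_one_le_left hD0.le hR))

end TailClass

/-! ### A polynomial lower bound for survival -/

namespace BranchWalk

variable {S : Type*} [Fintype S] {W : BranchWalk S} {ty : S → BranchType} {α c : S → ℝ}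
  {v : S → ℝ → ℝ}

theorem HeavyTailed.alpha_pos (hW : W.HeavyTailed ty α c v) (k : S) : 0 < α k := hW.1 k

theorem HeavyTailed.c_pos (hW : W.HeavyTailed ty α c v) (k : S) : 0 < c k := hW.2.1 k

theorem HeavyTailed.tailClass (hW : W.HeavyTailed ty α c v) (k : S) :
    TailClass (α k) (c k) (v k) := hW.2.2.1 k

variable [MeasurableSpace S] [DiscreteMeasurableSpace S]

/-- A jump of size at most `D` lowers the position by at most `D`, so from above `a + m * D` it
suffices that `m` consecutive jumps are that small; each is so with probability at least `1 - ε`. -/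
theorem HeavyTailed.one_sub_pow_le_survival (hW : W.HeavyTailed ty α c v) {a D ε : ℝ} (ha : 0 ≤ a)
    (hD : 0 < D) (hε : 0 ≤ ε) (hε1 : ε ≤ 1)
    (h : ∀ j, ∫⁻ y in Ioi D, ENNReal.ofReal (v j y) ≤ ENNReal.ofReal ε)
    (m : ℕ) (s : ℝ≥0 × S) (hs : a + m * D < s.1) :
    ENNReal.ofReal ((1 - ε) ^ m) ≤ W.survival a m s := by
  induction m generalizing s with
  | zero => rw [W.survival_zero_of_lt (by simpa using hs)]; simp
  | succ m ih =>
    obtain ⟨x, i⟩ := s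
    push_cast at hs
    have hx : a + m * D + D < x := by linarith
    have hmD : 0 ≤ m * D := by positivity
    rw [W.survival_succ_of_lt (by change a < x; linarith),
      hW.lintegral_kernel x i (W.measurable_survival a m)]
    have h1 : ENNReal.ofReal (1 - ε) ≤ ∫⁻ t in Ioc 0 D, ENNReal.ofReal (v i t) := by
      rw [ENNReal.ofReal_sub _ hε, ENNReal.ofReal_one, tsub_le_iff_right,
        ← (hW.tailClass i).lintegral_Ioi_eq_one, ← Ioc_union_Ioi_eq_Ioi hD.le,
        lintegral_union measurableSet_Ioi (Ioc_disjoint_Ioi le_rfl)]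
      gcongr
      exact h i
    calc ENNReal.ofReal ((1 - ε) ^ (m + 1))
        = ENNReal.ofReal (1 - ε) * ENNReal.ofReal ((1 - ε) ^ m) := by
          rw [← ENNReal.ofReal_mul (by linarith), pow_succ']
      _ ≤ (∫⁻ t in Ioc 0 D, ENNReal.ofReal (v i t)) * ENNReal.ofReal ((1 - ε) ^ m) := by gcongr
      _ = ∫⁻ t in Ioc 0 D, ENNReal.ofReal (v i t) * ENNReal.ofReal ((1 - ε) ^ m) :=
          (lintegral_mul_const _ (hW.tailClass i).measurable.ennreal_ofReal).symm
      _ ≤ ∫⁻ t in Ioc 0 D, ENNReal.ofReal (v i t) *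
            (ty i).avg (W.landing i (W.survival a m)) x t := by
          refine setLIntegral_mono' measurableSet_Ioc fun t ht => ?_
          gcongr
          rw [← (ty i).avg_const (F := fun _ => ENNReal.ofReal ((1 - ε) ^ m)) x t rfl rfl]
          refine (ty i).avg_mono x t ?_ ?_
          · refine W.le_landing i fun j => ih _ ?_
            have : 0 ≤ (x : ℝ) - t := by linarith [ht.2]
            rw [Real.coe_toNNReal _ (abs_nonneg _), abs_of_nonneg this]
            linarith [ht.2]
          · refine W.le_landing i fun j => ih _ ?_
            have : 0 ≤ (x : ℝ) + t := by linarith [ht.1]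
            rw [Real.coe_toNNReal _ (abs_nonneg _), abs_of_nonneg this]
            linarith [ht.1]
      _ ≤ _ := lintegral_mono_set Ioc_subset_Ioi_self

/-- One jump of size more than `x + (a + m * D)` towards the origin lands beyond `a + m * D` on
whichever branch is chosen. The factor `1 / 2` is the chance of this direction on a symmetric
branch. -/
theorem HeavyTailed.half_mul_le_survival_succ (hW : W.HeavyTailed ty α c v) {a D ε : ℝ}
    (ha : 0 ≤ a) (hD : 0 < D) (hε : 0 ≤ ε) (hε1 : ε ≤ 1)
    (h : ∀ j, ∫⁻ y in Ioi D, ENNReal.ofReal (v j y) ≤ ENNReal.ofReal ε)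
    (m : ℕ) (x : ℝ≥0) (k : S) (hx : a < x) :
    ENNReal.ofReal ((1 - ε) ^ m) / 2 * ∫⁻ y in Ioi (x + (a + m * D)), ENNReal.ofReal (v k y) ≤
      W.survival a (m + 1) (x, k) := by
  have hmD : 0 ≤ m * D := by positivity
  have h0 : 0 ≤ x + (a + m * D) := by positivity
  rw [W.survival_succ_of_lt hx, hW.lintegral_kernel x k (W.measurable_survival a m),
    ← lintegral_const_mul _ (hW.tailClass k).measurable.ennreal_ofReal]
  refine le_trans ?_ (lintegral_mono_set (Ioi_subset_Ioi h0))
  refine setLIntegral_mono' measurableSet_Ioi fun t ht => ?_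
  rw [mul_comm]
  gcongr
  refine le_trans ?_ ((ty k).half_le_avg _ _ _)
  gcongr
  refine W.le_landing k fun j => hW.one_sub_pow_le_survival ha hD hε hε1 h m _ ?_
  have ht' : x + (a + m * D) < t := ht
  rw [Real.coe_toNNReal _ (abs_nonneg _), abs_of_neg (by linarith)]
  linarith

theorem HeavyTailed.exists_le_survival (hW : W.HeavyTailed ty α c v) :
    ∃ Q : ℝ, 0 < Q ∧ ∀ a : ℝ, 0 < a → ∀ x : ℝ≥0, a < x → ∀ k : S, ∃ b : ℝ, 0 < b ∧
      ∀ n : ℕ, ENNReal.ofReal (b * ((n : ℝ) + 1) ^ (-Q)) ≤ W.survival a (n + 1) (x, k) := by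
  classical
  rcases isEmpty_or_nonempty S with hS | hS
  · exact ⟨1, one_pos, fun a _ x _ k => (IsEmpty.false k).elim⟩
  choose K hK hK' using fun j => (hW.tailClass j).exists_lintegral_Ioi_le (hW.alpha_pos j)
  obtain ⟨β, hβ, hβα⟩ : ∃ β : ℝ, 0 < β ∧ ∀ j, β ≤ α j := by
    obtain ⟨j, -, hj⟩ := Finset.exists_min_image Finset.univ α Finset.univ_nonempty
    exact ⟨α j, hW.alpha_pos j, fun i => hj i (Finset.mem_univ i)⟩
  obtain ⟨A, hA, hAα⟩ : ∃ A : ℝ, 0 < A ∧ ∀ j, α j ≤ A := by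
    obtain ⟨j, -, hj⟩ := Finset.exists_max_image Finset.univ α Finset.univ_nonempty
    exact ⟨α j, hW.alpha_pos j, fun i => hj i (Finset.mem_univ i)⟩
  obtain ⟨L, hL1, hKL⟩ : ∃ L : ℝ, 1 ≤ L ∧ ∀ j, K j ≤ L := by
    obtain ⟨j, -, hj⟩ := Finset.exists_max_image Finset.univ K Finset.univ_nonempty
    exact ⟨max 1 (K j), le_max_left _ _, fun i =>
      (hj i (Finset.mem_univ i)).trans (le_max_right _ _)⟩
  -- The first jump must have size of order `n * D`, that is `n ^ (1 + 1 / β)`, whose tail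
  -- probability is at least of order `n ^ (-(1 + 1 / β) * A)`.
  refine ⟨(1 + 1 / β) * A, by positivity, fun a ha x hx k => ?_⟩
  obtain ⟨b, hb, hb'⟩ := (hW.tailClass k).exists_le_lintegral_Ioi (hW.alpha_pos k) (hW.c_pos k)
  set M : ℝ := x + a + (2 * L) ^ (1 / β) + 1 with hM
  have hM0 : 0 < M := by positivity
  refine ⟨b / 4 * M ^ (-α k), by positivity, fun n => ?_⟩
  have hn : (1 : ℝ) ≤ (n : ℝ) + 1 := by simp
  have hn0 : (0 : ℝ) < (n : ℝ) + 1 := by positivity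
  -- Chosen so that a jump exceeds `D` with probability at most `1 / (2 (n + 1))`; by Bernoulli's
  -- inequality, `n` jumps in a row stay below `D` with probability at least `1 / 2`.
  set D : ℝ := (2 * L * ((n : ℝ) + 1)) ^ (1 / β) with hD
  have hD1 : 1 ≤ D := Real.one_le_rpow (by nlinarith) (by positivity)
  have hD0 : 0 < D := one_pos.trans_le hD1
  have hDβ : D ^ (-β) = 1 / (2 * L * ((n : ℝ) + 1)) := by
    rw [hD, ← Real.rpow_mul (by positivity), show 1 / β * -β = -1 by field_simp,
      Real.rpow_neg_one, one_div]
  have hε : ∀ j, ∫⁻ y in Ioi D, ENNReal.ofReal (v j y) ≤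
      ENNReal.ofReal (1 / (2 * ((n : ℝ) + 1))) := by
    intro j
    refine (hK' j D hD0).trans (ENNReal.ofReal_le_ofReal ?_)
    calc K j * D ^ (-α j) ≤ L * D ^ (-β) := by
          gcongr
          · exact hKL j
          · exact hβα j
      _ = 1 / (2 * ((n : ℝ) + 1)) := by rw [hDβ]; field_simp
  have hε1 : 1 / (2 * ((n : ℝ) + 1)) ≤ 1 := by
    rw [div_le_one (by positivity)]; linarith
  have key := hW.half_mul_le_survival_succ ha.le hD0 (by positivity) hε1 hε n x k hx
  refine le_trans ?_ key
  have hpow : 1 / 2 ≤ (1 - 1 / (2 * ((n : ℝ) + 1))) ^ n := by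
    have h1 := one_add_mul_le_pow (a := -(1 / (2 * ((n : ℝ) + 1)))) (by linarith) n
    rw [← sub_eq_add_neg] at h1
    refine le_trans ?_ h1
    have : (n : ℝ) * (1 / (2 * ((n : ℝ) + 1))) ≤ 1 / 2 := by
      rw [mul_one_div, div_le_div_iff₀ (by positivity) (by positivity)]; linarith
    linarith
  have hle : x + (a + n * D) ≤ M * ((n : ℝ) + 1) ^ (1 + 1 / β) := by
    have e1 : D = (2 * L) ^ (1 / β) * ((n : ℝ) + 1) ^ (1 / β) :=
      Real.mul_rpow (by positivity) hn0.le
    have e2 : ((n : ℝ) + 1) ^ (1 + 1 / β) = ((n : ℝ) + 1) * ((n : ℝ) + 1) ^ (1 / β) := by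
      rw [Real.rpow_add hn0, Real.rpow_one]
    have e3 : 1 ≤ ((n : ℝ) + 1) ^ (1 + 1 / β) := Real.one_le_rpow hn (by positivity)
    have e4 : n * D ≤ (2 * L) ^ (1 / β) * ((n : ℝ) + 1) ^ (1 + 1 / β) := by
      rw [e1, e2]
      have : 0 ≤ (2 * L) ^ (1 / β) * ((n : ℝ) + 1) ^ (1 / β) := by positivity
      nlinarith
    have e5 : 0 ≤ (x : ℝ) + a := by positivity
    rw [hM]
    nlinarith
  have hbig : 1 ≤ M * ((n : ℝ) + 1) ^ (1 + 1 / β) := by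
    have e3 : 1 ≤ ((n : ℝ) + 1) ^ (1 + 1 / β) := Real.one_le_rpow hn (by positivity)
    have : 1 ≤ M := by
      rw [hM]
      have : 0 ≤ (x : ℝ) + a + (2 * L) ^ (1 / β) := by positivity
      linarith
    nlinarith
  calc ENNReal.ofReal (b / 4 * M ^ (-α k) * ((n : ℝ) + 1) ^ (-((1 + 1 / β) * A)))
      ≤ ENNReal.ofReal (1 / 2 / 2 * (b * (M * ((n : ℝ) + 1) ^ (1 + 1 / β)) ^ (-α k))) := by
        apply ENNReal.ofReal_le_ofReal
        rw [Real.mul_rpow hM0.le (by positivity), ← Real.rpow_mul hn0.le]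
        have : ((n : ℝ) + 1) ^ (-((1 + 1 / β) * A)) ≤ ((n : ℝ) + 1) ^ ((1 + 1 / β) * -α k) := by
          refine Real.rpow_le_rpow_of_exponent_le hn ?_
          have : 0 ≤ 1 + 1 / β := by positivity
          nlinarith [hAα k]
        have h2 : 0 ≤ b / 4 * M ^ (-α k) := by positivity
        calc _ ≤ b / 4 * M ^ (-α k) * ((n : ℝ) + 1) ^ ((1 + 1 / β) * -α k) := by gcongr
          _ = _ := by ring
    _ = ENNReal.ofReal (1 / 2) / 2 *
          ENNReal.ofReal (b * (M * ((n : ℝ) + 1) ^ (1 + 1 / β)) ^ (-α k)) := by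
        rw [ENNReal.ofReal_mul (by norm_num), ENNReal.ofReal_div_of_pos two_pos]
        simp
    _ ≤ _ := by
        gcongr
        exact (hb' _ hbig).trans (lintegral_mono_set (Ioi_subset_Ioi hle))

theorem HeavyTailed.exists_passageMoment_eq_top (hW : W.HeavyTailed ty α c v) :
    ∃ Q : ℝ, 0 < Q ∧ ∀ a : ℝ, 0 < a → ∀ x : ℝ≥0, a < x → ∀ (k : S) (q : ℝ), Q < q →
      W.passageMoment a x k q = ⊤ := by
  obtain ⟨Q, hQ, h⟩ := hW.exists_le_survival
  refine ⟨Q, hQ, fun a ha x hx k q hq => ?_⟩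
  obtain ⟨b, hb, hbn⟩ := h a ha x hx k
  have h1 : Tendsto (fun n : ℕ => b * ((n : ℝ) + 1) ^ (q - Q)) atTop atTop := by
    refine Tendsto.const_mul_atTop hb ((tendsto_rpow_atTop (sub_pos.2 hq)).comp ?_)
    exact tendsto_atTop_add_const_right _ _ tendsto_natCast_atTop_atTop
  refine top_unique (le_of_tendsto' (ENNReal.tendsto_ofReal_atTop.comp h1) fun n => ?_)
  refine le_trans ?_ (W.mul_survival_le_passageMoment (hQ.trans hq).le a x k (n + 1))
  calc ENNReal.ofReal (b * ((n : ℝ) + 1) ^ (q - Q))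
      = ENNReal.ofReal (((n : ℝ) + 1) ^ q) * ENNReal.ofReal (b * ((n : ℝ) + 1) ^ (-Q)) := by
        rw [← ENNReal.ofReal_mul (by positivity), sub_eq_add_neg, Real.rpow_add (by positivity)]
        ring_nf
    _ ≤ _ := by
        gcongr
        · exact (hQ.trans hq).le
        · exact n.le_succ
        · exact hbn n

end BranchWalk

/-! ### Logarithmic integrals and the cotangent -/

theorem integrableOn_and_integral_of_hasSum {s : Set ℝ} (hs : MeasurableSet s) {f : ℕ → ℝ → ℝ}
    {g : ℝ → ℝ} (hg : Measurable g) (hf : ∀ n, IntegrableOn (f n) s)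
    (h0 : ∀ n, ∀ x ∈ s, 0 ≤ f n x) (hsum : ∀ x ∈ s, HasSum (fun n => f n x) (g x))
    (hc : Summable fun n => ∫ x in s, f n x) :
    IntegrableOn g s ∧ ∫ x in s, g x = ∑' n, ∫ x in s, f n x := by
  have hnorm : ∀ n, ∫ x in s, ‖f n x‖ = ∫ x in s, f n x := fun n =>
    setIntegral_congr_fun hs fun x hx => Real.norm_of_nonneg (h0 n x hx)
  have h := hasSum_integral_of_summable_integral_norm hf (by simpa only [hnorm] using hc)
  have hgt : ∫ x in s, g x = ∫ x in s, ∑' n, f n x :=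
    setIntegral_congr_fun hs fun x hx => (hsum x hx).tsum_eq.symm
  refine ⟨⟨hg.aestronglyMeasurable, ?_⟩, by rw [hgt, h.tsum_eq]⟩
  rw [hasFiniteIntegral_iff_ofReal
    ((ae_restrict_mem hs).mono fun x hx => (hsum x hx).nonneg fun n => h0 n x hx)]
  calc ∫⁻ x in s, ENNReal.ofReal (g x) = ∫⁻ x in s, ∑' n, ENNReal.ofReal (f n x) :=
        setLIntegral_congr_fun hs fun x hx => by
          rw [← (hsum x hx).tsum_eq]
          exact ENNReal.ofReal_tsum_of_nonneg (fun n => h0 n x hx) (hsum x hx).summable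
    _ = ∑' n, ∫⁻ x in s, ENNReal.ofReal (f n x) :=
        lintegral_tsum fun n => (hf n).aestronglyMeasurable.aemeasurable.ennreal_ofReal
    _ = ∑' n, ENNReal.ofReal (∫ x in s, f n x) := by
        congr 1 with n
        rw [ofReal_integral_eq_lintegral_ofReal (hf n)
          ((ae_restrict_mem hs).mono fun x hx => h0 n x hx)]
    _ = ENNReal.ofReal (∑' n, ∫ x in s, f n x) :=
        (ENNReal.ofReal_tsum_of_nonneg (fun n => setIntegral_nonneg hs (h0 n)) hc).symm
    _ < ⊤ := ENNReal.ofReal_lt_top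

theorem integrableOn_integral_Ioo_rpow {p : ℝ} (hp : -1 < p) :
    IntegrableOn (fun u : ℝ => u ^ p) (Ioo 0 1) ∧ ∫ u in Ioo (0 : ℝ) 1, u ^ p = 1 / (p + 1) := by
  refine ⟨(intervalIntegral.integrableOn_Ioo_rpow_iff one_pos).2 hp, ?_⟩
  rw [← integral_Ioc_eq_integral_Ioo, ← intervalIntegral.integral_of_le zero_le_one,
    integral_rpow (Or.inl hp), Real.one_rpow, Real.zero_rpow (by linarith)]
  ring

theorem summable_one_div_mul_add {β : ℝ} (hβ : -1 < β) :
    Summable fun n : ℕ => 1 / (((n : ℝ) + 1) * ((n : ℝ) + 1 + β)) := by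
  have h1 : Summable fun n : ℕ => (1 / min 1 (1 + β)) * (1 / ((n : ℝ) + 1) ^ 2) := by
    have := (summable_nat_add_iff (f := fun n : ℕ => 1 / (n : ℝ) ^ 2) 1).2
      (Real.summable_one_div_nat_pow.2 (by norm_num))
    exact (by simpa using this : Summable fun n : ℕ => 1 / ((n : ℝ) + 1) ^ 2).mul_left _
  have hm : 0 < min 1 (1 + β) := lt_min one_pos (by linarith)
  have hb : ∀ n : ℕ, min 1 (1 + β) * ((n : ℝ) + 1) ≤ (n : ℝ) + 1 + β := fun n => by
    have hn : (0 : ℝ) ≤ n := n.cast_nonneg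
    rcases le_total β 0 with h | h
    · rw [min_eq_right (by linarith)]; nlinarith
    · rw [min_eq_left (by linarith)]; linarith
  have hp : ∀ n : ℕ, 0 < (n : ℝ) + 1 + β := fun n => lt_of_lt_of_le (by positivity) (hb n)
  refine Summable.of_nonneg_of_le (fun n => ?_) (fun n => ?_) h1
  · have := hp n; positivity
  · rw [div_mul_div_comm, one_mul]
    refine one_div_le_one_div_of_le (by positivity) ?_
    nlinarith [hb n, (by positivity : 0 ≤ (n : ℝ) + 1)]

theorem log_one_sub_mul_rpow_Ioo {α : ℝ} (hα1 : α < 1) :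
    IntegrableOn (fun u : ℝ => Real.log (1 - u) * u ^ (-1 - α)) (Ioo 0 1) ∧
      ∫ u in Ioo (0 : ℝ) 1, Real.log (1 - u) * u ^ (-1 - α) =
        -∑' n : ℕ, 1 / (((n : ℝ) + 1) * ((n : ℝ) + 1 + -α)) := by
  have hint : ∀ n : ℕ, IntegrableOn (fun u : ℝ => 1 / ((n : ℝ) + 1) * u ^ ((n : ℝ) - α)) (Ioo 0 1) ∧
      ∫ u in Ioo (0 : ℝ) 1, 1 / ((n : ℝ) + 1) * u ^ ((n : ℝ) - α) =
        1 / (((n : ℝ) + 1) * ((n : ℝ) + 1 + -α)) := fun n => by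
    have hn : (0 : ℝ) ≤ n := n.cast_nonneg
    obtain ⟨h1, h2⟩ := integrableOn_integral_Ioo_rpow (p := (n : ℝ) - α) (by linarith)
    refine ⟨h1.const_mul _, ?_⟩
    rw [integral_const_mul, h2, div_mul_div_comm, one_mul]
    ring_nf
  have hsum : ∀ u ∈ Ioo (0 : ℝ) 1, HasSum (fun n : ℕ => 1 / ((n : ℝ) + 1) * u ^ ((n : ℝ) - α))
      (-(Real.log (1 - u) * u ^ (-1 - α))) := fun u hu => by
    have := (Real.hasSum_pow_div_log_of_abs_lt_one (x := u)
      (by rw [abs_of_pos hu.1]; exact hu.2)).mul_right (u ^ (-1 - α))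
    rw [neg_mul] at this
    refine this.congr_fun fun n => ?_
    rw [show (n : ℝ) - α = ((n + 1 : ℕ) : ℝ) + (-1 - α) by push_cast; ring,
      Real.rpow_add hu.1, Real.rpow_natCast]
    ring
  have hm : Measurable fun u : ℝ => -(Real.log (1 - u) * u ^ (-1 - α)) := by fun_prop
  obtain ⟨h1, h2⟩ := integrableOn_and_integral_of_hasSum measurableSet_Ioo hm
    (fun n => (hint n).1) (fun n u hu => by have := hu.1; positivity) hsum (by
      simp only [(hint _).2]; exact summable_one_div_mul_add (by linarith))
  refine ⟨by simpa using! h1.neg, ?_⟩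
  simp only [(hint _).2] at h2
  rw [← h2, integral_neg, neg_neg]

theorem log_mul_rpow_Ioi {α : ℝ} (hα : 0 < α) :
    IntegrableOn (fun u : ℝ => Real.log u * u ^ (-1 - α)) (Ioi 1) ∧
      ∫ u in Ioi (1 : ℝ), Real.log u * u ^ (-1 - α) = 1 / α ^ 2 := by
  set g : ℝ → ℝ := fun u => -(Real.log u * u ^ (-α) / α) - u ^ (-α) / α ^ 2 with hg
  have hd : ∀ u ∈ Ici (1 : ℝ), HasDerivAt g (Real.log u * u ^ (-1 - α)) u := by
    intro u hu
    have hu0 : 0 < u := one_pos.trans_le hu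
    have h1 : HasDerivAt (fun u : ℝ => u ^ (-α)) (-α * u ^ (-α - 1)) u :=
      Real.hasDerivAt_rpow_const (Or.inl hu0.ne')
    have h2 := (((Real.hasDerivAt_log hu0.ne').mul h1).div_const α).neg.sub (h1.div_const (α ^ 2))
    refine h2.congr_deriv ?_
    have h3 : u ^ (-α) = u ^ (-1 - α) * u := by
      rw [← Real.rpow_add_one hu0.ne']; ring_nf
    rw [show -α - 1 = -1 - α by ring, h3]
    field_simp
    ring
  have hpos : ∀ u ∈ Ioi (1 : ℝ), 0 ≤ Real.log u * u ^ (-1 - α) := fun u hu =>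
    mul_nonneg (Real.log_nonneg (le_of_lt hu))
      (Real.rpow_nonneg (zero_le_one.trans (le_of_lt hu)) _)
  have hlim : Tendsto g atTop (𝓝 0) := by
    have h1 : Tendsto (fun u : ℝ => Real.log u * u ^ (-α)) atTop (𝓝 0) := by
      refine ((isLittleO_log_rpow_atTop hα).tendsto_div_nhds_zero).congr' ?_
      filter_upwards [eventually_gt_atTop 0] with u hu
      rw [Real.rpow_neg hu.le, div_eq_mul_inv]
    have h2 := tendsto_rpow_neg_atTop hα
    simpa using ((h1.div_const α).neg).sub (h2.div_const (α ^ 2))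
  refine ⟨integrableOn_Ioi_deriv_of_nonneg' hd hpos hlim, ?_⟩
  rw [integral_Ioi_of_hasDerivAt_of_nonneg' hd hpos hlim]
  simp [hg]

theorem log_one_sub_inv_mul_rpow_Ioi {α : ℝ} (hα : 0 < α) :
    IntegrableOn (fun u : ℝ => Real.log (1 - u⁻¹) * u ^ (-1 - α)) (Ioi 1) ∧
      ∫ u in Ioi (1 : ℝ), Real.log (1 - u⁻¹) * u ^ (-1 - α) =
        -∑' n : ℕ, 1 / (((n : ℝ) + 1) * ((n : ℝ) + 1 + α)) := by
  have hint : ∀ n : ℕ, IntegrableOn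
      (fun u : ℝ => 1 / ((n : ℝ) + 1) * u ^ (-1 - ((n : ℝ) + 1 + α))) (Ioi 1) ∧
      ∫ u in Ioi (1 : ℝ), 1 / ((n : ℝ) + 1) * u ^ (-1 - ((n : ℝ) + 1 + α)) =
        1 / (((n : ℝ) + 1) * ((n : ℝ) + 1 + α)) := fun n => by
    have hn : (0 : ℝ) < (n : ℝ) + 1 + α := by positivity
    refine ⟨(integrableOn_Ioi_rpow_of_lt (by linarith) one_pos).const_mul _, ?_⟩
    rw [integral_const_mul, integral_Ioi_rpow_of_lt (by linarith) one_pos, Real.one_rpow]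
    rw [show -1 - ((n : ℝ) + 1 + α) + 1 = -((n : ℝ) + 1 + α) by ring, neg_div_neg_eq,
      div_mul_div_comm, one_mul]
  have hsum : ∀ u ∈ Ioi (1 : ℝ), HasSum
      (fun n : ℕ => 1 / ((n : ℝ) + 1) * u ^ (-1 - ((n : ℝ) + 1 + α)))
      (-(Real.log (1 - u⁻¹) * u ^ (-1 - α))) := fun u hu => by
    have hu0 : 0 < u := one_pos.trans hu
    have := (Real.hasSum_pow_div_log_of_abs_lt_one (x := u⁻¹)
      (by rw [abs_of_pos (by positivity)]; exact inv_lt_one_of_one_lt₀ hu)).mul_right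
        (u ^ (-1 - α))
    rw [neg_mul] at this
    refine this.congr_fun fun n => ?_
    rw [show -1 - ((n : ℝ) + 1 + α) = -((n + 1 : ℕ) : ℝ) + (-1 - α) by push_cast; ring,
      Real.rpow_add hu0, Real.rpow_neg hu0.le, Real.rpow_natCast, inv_pow]
    ring
  have hm : Measurable fun u : ℝ => -(Real.log (1 - u⁻¹) * u ^ (-1 - α)) := by fun_prop
  obtain ⟨h1, h2⟩ := integrableOn_and_integral_of_hasSum measurableSet_Ioi hm
    (fun n => (hint n).1)
    (fun n u hu => mul_nonneg (by positivity) (Real.rpow_nonneg (one_pos.trans hu).le _)) hsum (by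
      simp only [(hint _).2]; exact summable_one_div_mul_add (by linarith))
  refine ⟨by simpa using! h1.neg, ?_⟩
  simp only [(hint _).2] at h2
  rw [← h2, integral_neg, neg_neg]

theorem pi_mul_cot_eq_tsum {α : ℝ} (hα : 0 < α) (hα1 : α < 1) :
    Real.pi * Real.cot (Real.pi * α) = 1 / α +
      ∑' n : ℕ, (1 / (α - ((n : ℝ) + 1)) + 1 / (α + ((n : ℝ) + 1))) := by
  have hmem : (α : ℂ) ∈ Complex.integerComplement := by
    rw [Complex.mem_integerComplement_iff]
    rintro ⟨n, hn⟩
    have hn' : (n : ℝ) = α := by exact_mod_cast hn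
    rw [← hn'] at hα hα1
    have h1 : 0 < n := by exact_mod_cast hα
    have h2 : n < 1 := by exact_mod_cast hα1
    omega
  have h := cot_series_rep' hmem
  have h' : ((Real.pi * Real.cot (Real.pi * α) - 1 / α : ℝ) : ℂ) =
      ((∑' n : ℕ, (1 / (α - ((n : ℝ) + 1)) + 1 / (α + ((n : ℝ) + 1))) : ℝ) : ℂ) := by
    push_cast
    exact h
  have h'' := Complex.ofReal_injective h'
  linarith

/-- The integral is split at `1` and the logarithm expanded in powers of `u`, respectively `u⁻¹`.
Integration term by term produces the partial fraction series of the cotangent. As `Real.log`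
ignores signs, `log (1 - u)` means `log |1 - u|`. -/
theorem log_one_sub_mul_rpow_Ioi {α : ℝ} (hα : 0 < α) (hα1 : α < 1) :
    IntegrableOn (fun u : ℝ => Real.log (1 - u) * u ^ (-1 - α)) (Ioi 0) ∧
      α * ∫ u in Ioi (0 : ℝ), Real.log (1 - u) * u ^ (-1 - α) =
        Real.pi * Real.cot (Real.pi * α) := by
  obtain ⟨i1, e1⟩ := log_one_sub_mul_rpow_Ioo hα1
  obtain ⟨i2, e2⟩ := log_mul_rpow_Ioi hα
  obtain ⟨i3, e3⟩ := log_one_sub_inv_mul_rpow_Ioi hα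
  -- Beyond `1` one has `|1 - u| = u (1 - u⁻¹)`, and `u⁻¹` is in the range of the power series.
  have heq : EqOn (fun u : ℝ => Real.log u * u ^ (-1 - α) + Real.log (1 - u⁻¹) * u ^ (-1 - α))
      (fun u : ℝ => Real.log (1 - u) * u ^ (-1 - α)) (Ioi 1) := by
    intro u hu
    have hu1 : 1 < u := hu
    have hu0 : 0 < u := one_pos.trans hu1
    have : u⁻¹ < 1 := inv_lt_one_of_one_lt₀ hu
    simp only
    rw [← add_mul, ← Real.log_mul hu0.ne' (by linarith), mul_sub, mul_one,
      mul_inv_cancel₀ hu0.ne', ← Real.log_neg_eq_log, neg_sub]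
  have i4 := (i2.add i3).congr_fun heq measurableSet_Ioi
  have e4 : ∫ u in Ioi (1 : ℝ), Real.log (1 - u) * u ^ (-1 - α) =
      1 / α ^ 2 - ∑' n : ℕ, 1 / (((n : ℝ) + 1) * ((n : ℝ) + 1 + α)) := by
    rw [← setIntegral_congr_fun measurableSet_Ioi heq, integral_add i2 i3, e2, e3, sub_eq_add_neg]
  have i1' := (integrableOn_Ioc_iff_integrableOn_Ioo (μ := volume)).2 i1
  have hunion : Ioc (0 : ℝ) 1 ∪ Ioi 1 = Ioi 0 := Ioc_union_Ioi_eq_Ioi zero_le_one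
  refine ⟨hunion ▸ i1'.union i4, ?_⟩
  rw [← hunion, setIntegral_union (Ioc_disjoint_Ioi le_rfl) measurableSet_Ioi i1' i4,
    integral_Ioc_eq_integral_Ioo, e1, e4, pi_mul_cot_eq_tsum hα hα1]
  have s1 := summable_one_div_mul_add (β := -α) (by linarith)
  have s2 := summable_one_div_mul_add (β := α) (by linarith)
  have : ∑' n : ℕ, (1 / (α - ((n : ℝ) + 1)) + 1 / (α + ((n : ℝ) + 1))) =
      -α * (∑' n : ℕ, 1 / (((n : ℝ) + 1) * ((n : ℝ) + 1 + -α)) +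
        ∑' n : ℕ, 1 / (((n : ℝ) + 1) * ((n : ℝ) + 1 + α))) := by
    rw [← s1.tsum_add s2, ← tsum_mul_left]
    refine tsum_congr fun n => ?_
    have hn : (0 : ℝ) ≤ n := n.cast_nonneg
    have h1 : (n : ℝ) + 1 + -α ≠ 0 := by linarith
    have h2 : α - ((n : ℝ) + 1) ≠ 0 := by linarith
    have h3 : (n : ℝ) + 1 + α ≠ 0 := by positivity
    have h4 : α + ((n : ℝ) + 1) ≠ 0 := by positivity
    field_simp
    ring
  rw [this]
  field_simp
  ring

/-- The two logarithms combine to `log |1 - u ^ 2|`, and substituting `u ^ 2` reduces to the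
one-sided integral with `α / 2`. This is the origin of the factor `χ = 1 / 2`. -/
theorem log_one_sub_add_log_one_add_mul_rpow_Ioi {α : ℝ} (hα : 0 < α) (hα1 : α < 2) :
    IntegrableOn (fun u : ℝ => (Real.log (1 - u) + Real.log (1 + u)) * u ^ (-1 - α)) (Ioi 0) ∧
      α * ∫ u in Ioi (0 : ℝ), (Real.log (1 - u) + Real.log (1 + u)) * u ^ (-1 - α) =
        Real.pi * Real.cot (Real.pi * (α / 2)) := by
  obtain ⟨i1, e1⟩ := log_one_sub_mul_rpow_Ioi (half_pos hα) (by linarith : α / 2 < 1)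
  rw [← integrableOn_Ioi_comp_rpow_iff _ two_ne_zero] at i1
  rw [← integral_comp_rpow_Ioi _ two_ne_zero] at e1
  have heq : ∀ᵐ u : ℝ ∂volume.restrict (Ioi 0), (|(2 : ℝ)| * u ^ ((2 : ℝ) - 1)) •
      (Real.log (1 - u ^ (2 : ℝ)) * (u ^ (2 : ℝ)) ^ (-1 - α / 2)) =
      2 * ((Real.log (1 - u) + Real.log (1 + u)) * u ^ (-1 - α)) := by
    have hne : ∀ᵐ u : ℝ ∂volume.restrict (Ioi 0), u ≠ 1 := by
      refine ae_restrict_of_ae ?_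
      simp [ae_iff]
    filter_upwards [ae_restrict_mem measurableSet_Ioi, hne] with u hu hu1
    have hu0 : 0 < u := hu
    have h1 : (1 - u ^ (2 : ℝ)) = (1 - u) * (1 + u) := by
      rw [Real.rpow_two]; ring
    rw [h1, Real.log_mul (sub_ne_zero.2 hu1.symm) (by positivity), ← Real.rpow_mul hu0.le,
      smul_eq_mul, abs_of_pos two_pos]
    rw [show (-1 - α) = (2 - 1) + 2 * (-1 - α / 2) by ring, Real.rpow_add hu0]
    ring
  have i2 := (integrable_congr heq).1 i1
  have i3 := i2.const_mul (1 / 2)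
  simp only [← mul_assoc, one_div, inv_mul_cancel₀ (two_ne_zero' ℝ), one_mul] at i3
  refine ⟨i3, ?_⟩
  rw [integral_congr_ae heq, integral_const_mul] at e1
  rw [← e1]
  ring

/-! ### Bounds uniform in small exponents -/

/-- Bernoulli's inequality with exponent `ν₀ / ν`, applied to `y ^ ν` if `y ≥ 1`; for `y ≤ 1` one
passes to `y⁻¹`. The bound does not involve `ν`, so it dominates the difference quotients whose
limit as `ν → 0` is `log y`. -/
theorem abs_rpow_sub_one_div_le {ν ν₀ y : ℝ} (hν : 0 < ν) (hν₀ : ν ≤ ν₀) (hy : 0 < y) :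
    |ν⁻¹ * (y ^ ν - 1)| ≤ ν₀⁻¹ * (y ^ (-ν₀) + y ^ ν₀) := by
  have h0 : 0 < ν₀ := hν.trans_le hν₀
  have key : ∀ z : ℝ, 1 ≤ z → ν⁻¹ * (z ^ ν - 1) ≤ ν₀⁻¹ * z ^ ν₀ := by
    intro z hz
    have hz0 : 0 ≤ z := zero_le_one.trans hz
    have h1 : 1 ≤ z ^ ν := Real.one_le_rpow hz hν.le
    have h2 := one_add_mul_self_le_rpow_one_add (s := z ^ ν - 1) (p := ν₀ / ν) (by linarith)
      ((one_le_div hν).2 hν₀)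
    rw [add_sub_cancel, ← Real.rpow_mul hz0, mul_div_cancel₀ _ hν.ne'] at h2
    rw [inv_mul_le_iff₀ hν]
    have h3 : ν₀ / ν * (z ^ ν - 1) ≤ z ^ ν₀ := by linarith
    rw [div_mul_eq_mul_div, div_le_iff₀ hν] at h3
    rw [← mul_assoc, mul_comm ν, mul_assoc, ← div_eq_inv_mul, le_div_iff₀ h0]
    linarith
  rcases le_total 1 y with h | h
  · have h1 : 1 ≤ y ^ ν := Real.one_le_rpow h hν.le
    rw [abs_of_nonneg (mul_nonneg (inv_nonneg.2 hν.le) (by linarith))]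
    refine (key y h).trans ?_
    gcongr
    have := Real.rpow_nonneg hy.le (-ν₀)
    linarith
  · have h1 : y ^ ν ≤ 1 := Real.rpow_le_one hy.le h hν.le
    have hyν : 0 < y ^ ν := Real.rpow_pos_of_pos hy ν
    rw [abs_of_nonpos (mul_nonpos_of_nonneg_of_nonpos (inv_nonneg.2 hν.le) (by linarith))]
    have h2 := key y⁻¹ ((one_le_inv₀ hy).2 h)
    rw [Real.inv_rpow hy.le, Real.inv_rpow hy.le, ← Real.rpow_neg hy.le ν₀] at h2
    have h3 : -(ν⁻¹ * (y ^ ν - 1)) ≤ ν⁻¹ * ((y ^ ν)⁻¹ - 1) := by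
      rw [← mul_neg]
      gcongr
      have h4 : 2 ≤ (y ^ ν)⁻¹ + y ^ ν := by
        have h5 : (y ^ ν)⁻¹ * y ^ ν = 1 := inv_mul_cancel₀ hyν.ne'
        nlinarith [sq_nonneg ((y ^ ν)⁻¹ - y ^ ν), inv_pos.2 hyν]
      linarith
    refine h3.trans (h2.trans ?_)
    gcongr
    have := Real.rpow_nonneg hy.le ν₀
    linarith

theorem abs_log_le_rpow_add_rpow {ν y : ℝ} (hν : 0 < ν) (hy : 0 < y) :
    |Real.log y| ≤ ν⁻¹ * (y ^ (-ν) + y ^ ν) := by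
  have h := (tendsto_rpow_sub_one_log hy).abs
  refine le_of_tendsto h ?_
  filter_upwards [Ioc_mem_nhdsGT hν] with p hp
  exact abs_rpow_sub_one_div_le hp.1 hp.2 hy

theorem integrableOn_Icc_abs_one_sub_rpow {ν a b : ℝ} (hν : ν < 1) (ha : a ≤ 1) (hb : 1 ≤ b) :
    IntegrableOn (fun u : ℝ => |1 - u| ^ (-ν)) (Icc a b) := by
  have h : ∀ c d : ℝ, IntervalIntegrable (fun u : ℝ => u ^ (-ν)) volume c d := fun c d =>
    intervalIntegral.intervalIntegrable_rpow' (by linarith)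
  have h1 : IntegrableOn (fun u : ℝ => |1 - u| ^ (-ν)) (Ioc a 1) := by
    have := (h (1 - a) 0).comp_sub_left 1
    rw [show (1 : ℝ) - (1 - a) = a by ring, sub_zero,
      intervalIntegrable_iff_integrableOn_Ioc_of_le ha] at this
    refine this.congr_fun (fun u hu => ?_) measurableSet_Ioc
    simp only
    rw [abs_of_nonneg (sub_nonneg.2 hu.2)]
  have h2 : IntegrableOn (fun u : ℝ => |1 - u| ^ (-ν)) (Ioc 1 b) := by
    have := (h 0 (b - 1)).comp_sub_right 1
    rw [zero_add, sub_add_cancel, intervalIntegrable_iff_integrableOn_Ioc_of_le hb] at this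
    refine this.congr_fun (fun u hu => ?_) measurableSet_Ioc
    simp only
    rw [abs_of_neg (sub_neg.2 hu.1), neg_sub]
  rw [integrableOn_Icc_iff_integrableOn_Ioc, ← Ioc_union_Ioc_eq_Ioc ha hb]
  exact h1.union h2

theorem integrableOn_Ioi_rpow_add_rpow_mul_rpow {ν α η : ℝ} (hν : 0 < ν) (hν1 : ν < 1) (hνα : ν < α)
    (hη : 0 < η) (hη1 : η ≤ 1) :
    IntegrableOn (fun u : ℝ => (|1 - u| ^ (-ν) + (1 + u) ^ ν) * u ^ (-1 - α)) (Ioi η) := by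
  have hm : Measurable fun u : ℝ => (|1 - u| ^ (-ν) + (1 + u) ^ ν) * u ^ (-1 - α) := by fun_prop
  have h1 : IntegrableOn (fun u : ℝ => (|1 - u| ^ (-ν) + (1 + u) ^ ν) * u ^ (-1 - α))
      (Icc η 2) := by
    refine IntegrableOn.mul_continuousOn ?_ ?_ isCompact_Icc
    · refine (integrableOn_Icc_abs_one_sub_rpow hν1 hη1 one_le_two).add ?_
      refine ContinuousOn.integrableOn_Icc fun u hu => ?_
      exact (ContinuousAt.rpow_const (by fun_prop)
        (Or.inr hν.le)).continuousWithinAt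
    · intro u hu
      exact (Real.continuousAt_rpow_const _ _ (Or.inl (hη.trans_le hu.1).ne')).continuousWithinAt
  have h2 : IntegrableOn (fun u : ℝ => (|1 - u| ^ (-ν) + (1 + u) ^ ν) * u ^ (-1 - α)) (Ioi 2) := by
    have i1 : IntegrableOn (fun u : ℝ => u ^ (-1 - α)) (Ioi 2) :=
      integrableOn_Ioi_rpow_of_lt (by linarith) two_pos
    have i2 : IntegrableOn (fun u : ℝ => u ^ (ν + (-1 - α))) (Ioi 2) :=
      integrableOn_Ioi_rpow_of_lt (by linarith) two_pos
    refine Integrable.mono' (i1.add (i2.const_mul (2 ^ ν))) hm.aestronglyMeasurable ?_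
    filter_upwards [ae_restrict_mem measurableSet_Ioi] with u hu
    have hu2 : 2 < u := hu
    have hu0 : 0 < u := two_pos.trans hu2
    rw [Real.norm_of_nonneg (by positivity), Pi.add_apply, add_mul]
    have e1 : |1 - u| ^ (-ν) ≤ 1 := by
      refine Real.rpow_le_one_of_one_le_of_nonpos ?_ (by linarith)
      rw [abs_of_neg (by linarith)]; linarith
    have e2 : (1 + u) ^ ν ≤ 2 ^ ν * u ^ ν := by
      rw [← Real.mul_rpow two_pos.le hu0.le]
      exact Real.rpow_le_rpow (by positivity) (by linarith) hν.le
    have hp : 0 < u ^ (-1 - α) := Real.rpow_pos_of_pos hu0 _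
    rw [Real.rpow_add hu0]
    nlinarith
  rw [← Ioc_union_Ioi_eq_Ioi (by linarith : η ≤ 2)]
  exact (h1.mono_set Ioc_subset_Icc_self).union h2

/-! ### Truncated logarithmic integrals on the two kinds of branches -/

namespace BranchType

/-- The logarithm of the relative position after a jump of relative size `u` on a one-sided
branch; on a symmetric one, the sum of the logarithms for the two directions. -/
noncomputable def logProfile : BranchType → ℝ → ℝ
  | .oneSided, u => Real.log (1 - u)
  | .symmetric, u => Real.log (1 - u) + Real.log (1 + u)

theorem measurable_logProfile (b : BranchType) : Measurable b.logProfile := by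
  cases b
  · exact (by fun_prop : Measurable fun u : ℝ => Real.log (1 - u))
  · exact (by fun_prop : Measurable fun u : ℝ => Real.log (1 - u) + Real.log (1 + u))

theorem ae_ne_one (s : Set ℝ) : ∀ᵐ u : ℝ ∂volume.restrict s, u ≠ 1 :=
  ae_restrict_of_ae (by simp [ae_iff])

theorem abs_one_sub_rpow_le {ν u : ℝ} (hν : 0 < ν) (hu : 0 < u) : |1 - u| ^ ν ≤ (1 + u) ^ ν :=
  Real.rpow_le_rpow (abs_nonneg _) (abs_le.2 ⟨by linarith, by linarith⟩) hν.le

theorem abs_logProfile_le (b : BranchType) {ν u : ℝ} (hν : 0 < ν) (hu : 0 < u) (hu1 : u ≠ 1) :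
    |b.logProfile u| ≤ 3 * ν⁻¹ * (|1 - u| ^ (-ν) + (1 + u) ^ ν) := by
  have h0 : 0 < |1 - u| := abs_pos.2 (sub_ne_zero.2 hu1.symm)
  have h1 := abs_log_le_rpow_add_rpow hν h0
  rw [Real.log_abs] at h1
  have h2 := abs_log_le_rpow_add_rpow hν (by linarith : 0 < 1 + u)
  have h3 := abs_one_sub_rpow_le hν hu
  have h4 : (1 + u) ^ (-ν) ≤ (1 + u) ^ ν :=
    Real.rpow_le_rpow_of_exponent_le (by linarith) (by linarith)
  have h5 : 0 < |1 - u| ^ (-ν) := Real.rpow_pos_of_pos h0 _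
  have h6 : |Real.log (1 - u)| ≤ ν⁻¹ * (|1 - u| ^ (-ν) + (1 + u) ^ ν) :=
    h1.trans (by gcongr)
  have h7 : |Real.log (1 + u)| ≤ 2 * (ν⁻¹ * (|1 - u| ^ (-ν) + (1 + u) ^ ν)) := by
    refine h2.trans ?_
    rw [mul_left_comm]
    gcongr
    linarith
  have h8 : 0 ≤ ν⁻¹ * (|1 - u| ^ (-ν) + (1 + u) ^ ν) := (abs_nonneg _).trans h6
  cases b
  · simp only [logProfile]; linarith
  · simp only [logProfile]
    refine (abs_add_le _ _).trans ?_
    linarith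

theorem integrableOn_logProfile (b : BranchType) {α η : ℝ} (hα : 0 < α) (hη : 0 < η)
    (hη1 : η ≤ 1) : IntegrableOn (fun u => b.logProfile u * u ^ (-1 - α)) (Ioi η) := by
  obtain ⟨ν, hν, hν'⟩ := exists_between (lt_min one_pos hα)
  have hi := (integrableOn_Ioi_rpow_add_rpow_mul_rpow hν (hν'.trans_le (min_le_left _ _))
    (hν'.trans_le (min_le_right _ _)) hη hη1).const_mul (3 * ν⁻¹)
  refine hi.mono' (b.measurable_logProfile.mul (by fun_prop)).aestronglyMeasurable ?_
  filter_upwards [ae_restrict_mem measurableSet_Ioi, ae_ne_one _] with u hu hu1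
  have hu0 : 0 < u := hη.trans hu
  rw [norm_mul, Real.norm_eq_abs, Real.norm_of_nonneg (Real.rpow_nonneg hu0.le _), ← mul_assoc]
  have := Real.rpow_nonneg hu0.le (-1 - α)
  gcongr
  exact b.abs_logProfile_le hν hu0 hu1

theorem chi_pos (b : BranchType) : 0 < b.chi := by cases b <;> norm_num [chi]

theorem logProfile_mul_rpow_Ioi (b : BranchType) {α : ℝ} (hα : 0 < α) (h : b.chi * α < 1) :
    IntegrableOn (fun u => b.logProfile u * u ^ (-1 - α)) (Ioi 0) ∧
      α * ∫ u in Ioi 0, b.logProfile u * u ^ (-1 - α) =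
        Real.pi * Real.cot (b.chi * Real.pi * α) := by
  cases b
  · simp only [chi, one_mul] at h ⊢
    exact log_one_sub_mul_rpow_Ioi hα h
  · simp only [chi] at h ⊢
    rw [show 1 / 2 * Real.pi * α = Real.pi * (α / 2) by ring]
    exact log_one_sub_add_log_one_add_mul_rpow_Ioi hα (by linarith)

theorem exists_mul_integral_logProfile_lt_cot (b : BranchType) {α ε : ℝ} (hα : 0 < α)
    (h : b.chi * α < 1) (hε : 0 < ε) : ∃ η, 0 < η ∧ η < 1 ∧
      α * ∫ u in Ioi η, b.logProfile u * u ^ (-1 - α) <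
        Real.pi * Real.cot (b.chi * Real.pi * α) + ε := by
  obtain ⟨hi, he⟩ := b.logProfile_mul_rpow_Ioi hα h
  have hlim : Tendsto (fun η => α * ∫ u in Ioi η, b.logProfile u * u ^ (-1 - α)) (𝓝[>] 0)
      (𝓝 (α * ∫ u in Ioi 0, b.logProfile u * u ^ (-1 - α))) := by
    refine Tendsto.const_mul _ ?_
    have : ∀ᶠ η : ℝ in 𝓝[>] 0, ∫ u in Ioi 0, (Ioi η).indicator
        (fun u => b.logProfile u * u ^ (-1 - α)) u =
          ∫ u in Ioi η, b.logProfile u * u ^ (-1 - α) := by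
      filter_upwards [self_mem_nhdsWithin] with η hη
      rw [setIntegral_indicator measurableSet_Ioi, Ioi_inter_Ioi, max_eq_right (le_of_lt hη)]
    refine Tendsto.congr' this ?_
    refine tendsto_integral_filter_of_dominated_convergence
      (fun u => ‖b.logProfile u * u ^ (-1 - α)‖) ?_ ?_ hi.norm ?_
    · exact .of_forall fun η => hi.aestronglyMeasurable.indicator measurableSet_Ioi
    · exact .of_forall fun η => .of_forall fun u => norm_indicator_le_norm_self _ _
    · filter_upwards [ae_restrict_mem measurableSet_Ioi] with u hu
      refine tendsto_const_nhds.congr' ?_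
      filter_upwards [Ioo_mem_nhdsGT (show (0 : ℝ) < u from hu)] with η hη
      rw [indicator_of_mem (show u ∈ Ioi η from hη.2)]
  rw [he] at hlim
  obtain ⟨η, h1, h2⟩ := ((hlim.eventually (gt_mem_nhds (lt_add_of_pos_right _ hε))).and
    (Ioo_mem_nhdsGT one_pos)).exists
  exact ⟨η, h2.1, h2.2, h1⟩

theorem logProfile_mul_rpow_le_neg_inv (b : BranchType) {α u : ℝ} (h : 1 ≤ b.chi * α) (hu : 0 < u)
    (hu1 : u < 1) : b.logProfile u * u ^ (-1 - α) ≤ -u⁻¹ := by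
  have key : ∀ p : ℝ, 1 ≤ p → ∀ t : ℝ, t ≤ -(u ^ (α + 1 - p)) → t * u ^ (-1 - α) ≤ -u⁻¹ := by
    intro p hp t ht
    calc t * u ^ (-1 - α) ≤ -(u ^ (α + 1 - p)) * u ^ (-1 - α) := by
          have := Real.rpow_nonneg hu.le (-1 - α)
          gcongr
      _ = -(u ^ (-p)) := by rw [neg_mul, ← Real.rpow_add hu]; ring_nf
      _ ≤ -(u ^ (-1 : ℝ)) :=
          neg_le_neg (Real.rpow_le_rpow_of_exponent_ge hu hu1.le (by linarith))
      _ = -u⁻¹ := by rw [Real.rpow_neg_one]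
  cases b
  · simp only [chi, one_mul] at h
    refine key α h _ ?_
    simp only [logProfile]
    rw [show α + 1 - α = 1 by ring, Real.rpow_one]
    linarith [Real.log_le_sub_one_of_pos (sub_pos.2 hu1)]
  · simp only [chi] at h
    refine key (α - 1) (by linarith) _ ?_
    simp only [logProfile]
    rw [← Real.log_mul (by linarith) (by linarith), show α + 1 - (α - 1) = 2 by ring, Real.rpow_two]
    have : 0 < (1 - u) * (1 + u) := mul_pos (by linarith) (by linarith)
    linarith [Real.log_le_sub_one_of_pos this]

/-- For `χ α ≥ 1` the integrand is at most `-u⁻¹` on `(0, 1)`, so the truncated integral tends to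
`-∞` as the cutoff shrinks. -/
theorem exists_mul_integral_logProfile_lt (b : BranchType) {α : ℝ} (hα : 0 < α)
    (h : 1 ≤ b.chi * α) (M : ℝ) : ∃ η, 0 < η ∧ η < 1 ∧
      α * ∫ u in Ioi η, b.logProfile u * u ^ (-1 - α) < M := by
  set I := ∫ u in Ioi (1 / 2), b.logProfile u * u ^ (-1 - α) with hI
  -- With the cutoff `exp (-T) / 2`, the integral of `u⁻¹` from the cutoff to `1 / 2` is exactly
  -- `T`.
  set T : ℝ := max 1 (I - M / α + 1) with hT
  have hT0 : 0 < T := one_pos.trans_le (le_max_left _ _)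
  have he : Real.exp (-T) < 1 := Real.exp_lt_one_iff.2 (by linarith)
  have hη : 0 < 1 / 2 * Real.exp (-T) := by positivity
  have hη2 : 1 / 2 * Real.exp (-T) ≤ 1 / 2 := by linarith
  refine ⟨1 / 2 * Real.exp (-T), hη, by linarith, ?_⟩
  have hint := b.integrableOn_logProfile hα hη (by linarith)
  have hint2 := hint.mono_set
    (show Ioc (1 / 2 * Real.exp (-T)) (1 / 2) ⊆ _ from Ioc_subset_Ioi_self)
  rw [← Ioc_union_Ioi_eq_Ioi hη2, setIntegral_union (Ioc_disjoint_Ioi le_rfl) measurableSet_Ioi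
    hint2 (b.integrableOn_logProfile hα (by norm_num) (by norm_num)), ← hI]
  have h1 : ∫ u in Ioc (1 / 2 * Real.exp (-T)) (1 / 2), b.logProfile u * u ^ (-1 - α) ≤
      ∫ u in Ioc (1 / 2 * Real.exp (-T)) (1 / 2), -u⁻¹ := by
    refine setIntegral_mono_on hint2 ?_ measurableSet_Ioc fun u hu =>
      b.logProfile_mul_rpow_le_neg_inv h (hη.trans hu.1) (by linarith [hu.2])
    refine IntegrableOn.mono_set (ContinuousOn.integrableOn_Icc ?_) Ioc_subset_Icc_self
    exact (continuousOn_inv₀.mono fun u hu => (hη.trans_le hu.1).ne').neg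
  rw [integral_neg, ← intervalIntegral.integral_of_le (f := fun u : ℝ => u⁻¹) hη2,
    integral_inv_of_pos hη (by norm_num),
    show 1 / 2 / (1 / 2 * Real.exp (-T)) = Real.exp T by
      rw [Real.exp_neg]; field_simp, Real.log_exp] at h1
  have h2 : I - M / α + 1 ≤ T := le_max_right _ _
  calc _ ≤ α * (-T + I) := by gcongr
    _ ≤ α * (M / α - 1) := by gcongr; linarith
    _ = M - α := by field_simp
    _ < M := by linarith

end BranchType

/-! ### First-order expansion of the Lyapunov growth -/

namespace BranchType

/-- The expected relative change of `(1 + ν θ) x ^ ν` under a jump of relative size `u`, when the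
weight `θ` is replaced by `Θ` on crossing the origin. -/
noncomputable def growth : BranchType → ℝ → ℝ → ℝ → ℝ → ℝ
  | .oneSided, ν, θ, Θ, u => (1 + ν * if u ≤ 1 then θ else Θ) * |1 - u| ^ ν
  | .symmetric, ν, θ, Θ, u =>
    ((1 + ν * if u ≤ 1 then θ else Θ) * |1 - u| ^ ν + (1 + ν * θ) * (1 + u) ^ ν) / 2

theorem measurable_growth (b : BranchType) (ν θ Θ : ℝ) : Measurable (b.growth ν θ Θ) := by
  have h : Measurable fun u : ℝ => if u ≤ 1 then θ else Θ :=
    Measurable.ite measurableSet_Iic measurable_const measurable_const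
  cases b
  · exact ((h.const_mul ν).const_add 1).mul (by fun_prop)
  · exact ((((h.const_mul ν).const_add 1).mul (by fun_prop)).add (by fun_prop)).div_const 2

theorem growth_nonneg (b : BranchType) {ν θ Θ u : ℝ} (hν : 0 ≤ ν) (hθ : 0 ≤ θ) (hΘ : 0 ≤ Θ)
    (hu : 0 ≤ u) : 0 ≤ b.growth ν θ Θ u := by
  have h : 0 ≤ if u ≤ 1 then θ else Θ := by split_ifs <;> assumption
  cases b <;> simp only [growth] <;> positivity

/-- Concavity of the `ν`-th power: jumps that do not cross the origin never help on average. This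
permits discarding all jumps of relative size below a cutoff. -/
theorem growth_le (b : BranchType) {ν θ Θ u : ℝ} (hν : 0 ≤ ν) (hν1 : ν ≤ 1) (hθ : 0 ≤ θ)
    (hu : 0 ≤ u) (hu1 : u ≤ 1) : b.growth ν θ Θ u ≤ 1 + ν * θ := by
  have hb : 0 ≤ 1 + ν * θ := by positivity
  have h1 : |1 - u| ^ ν ≤ 1 + ν * -u := by
    rw [abs_of_nonneg (by linarith), sub_eq_add_neg]
    exact rpow_one_add_le_one_add_mul_self (by linarith) hν hν1
  have h2 : (1 + u) ^ ν ≤ 1 + ν * u := rpow_one_add_le_one_add_mul_self (by linarith) hν hν1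
  have h3 : 0 ≤ ν * u := by positivity
  cases b
  · simp only [growth, if_pos hu1]
    nlinarith
  · simp only [growth, if_pos hu1]
    nlinarith

theorem inv_mul_growth_sub (b : BranchType) {ν θ Θ u : ℝ} (hν : ν ≠ 0) :
    ν⁻¹ * (b.growth ν θ Θ u - (1 + ν * θ)) = match b with
      | .oneSided => (1 + ν * if u ≤ 1 then θ else Θ) * (ν⁻¹ * (|1 - u| ^ ν - 1)) +
          ((if u ≤ 1 then θ else Θ) - θ)
      | .symmetric => ((1 + ν * if u ≤ 1 then θ else Θ) * (ν⁻¹ * (|1 - u| ^ ν - 1)) +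
          ((if u ≤ 1 then θ else Θ) - θ) + (1 + ν * θ) * (ν⁻¹ * ((1 + u) ^ ν - 1))) / 2 := by
  cases b <;> simp only [growth] <;> field_simp <;> ring

theorem abs_inv_mul_growth_sub_le (b : BranchType) {ν ν₀ θ Θ u : ℝ} (hν : 0 < ν) (hν₀ : ν ≤ ν₀)
    (hν1 : ν₀ ≤ 1) (hθ : 0 ≤ θ) (hΘ : 0 ≤ Θ) (hu : 0 < u) (hu1 : u ≠ 1) :
    |ν⁻¹ * (b.growth ν θ Θ u - (1 + ν * θ))| ≤
      4 * ν₀⁻¹ * (1 + θ + Θ) * (|1 - u| ^ (-ν₀) + (1 + u) ^ ν₀) := by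
  have h0 : 0 < ν₀ := hν.trans_le hν₀
  set T : ℝ := if u ≤ 1 then θ else Θ with hT
  have hT0 : 0 ≤ T := by rw [hT]; split_ifs <;> assumption
  have hT1 : T ≤ θ + Θ := by rw [hT]; split_ifs <;> linarith
  have hy : 0 < |1 - u| := abs_pos.2 (sub_ne_zero.2 hu1.symm)
  have hp1 : 0 < |1 - u| ^ (-ν₀) := Real.rpow_pos_of_pos hy _
  have hp2 : 1 ≤ (1 + u) ^ ν₀ := Real.one_le_rpow (by linarith) h0.le
  have hp3 : (1 + u) ^ (-ν₀) ≤ (1 + u) ^ ν₀ :=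
    Real.rpow_le_rpow_of_exponent_le (by linarith) (by linarith)
  set E := |1 - u| ^ (-ν₀) + (1 + u) ^ ν₀ with hE
  have hE1 : 1 ≤ E := by linarith
  have hi : 1 ≤ ν₀⁻¹ := (one_le_inv₀ h0).2 hν1
  have h1 : |ν⁻¹ * (|1 - u| ^ ν - 1)| ≤ ν₀⁻¹ * E := by
    refine (abs_rpow_sub_one_div_le hν hν₀ hy).trans ?_
    gcongr
    linarith [abs_one_sub_rpow_le h0 hu]
  have h2 : |ν⁻¹ * ((1 + u) ^ ν - 1)| ≤ 2 * (ν₀⁻¹ * E) := by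
    refine (abs_rpow_sub_one_div_le hν hν₀ (by linarith : 0 < 1 + u)).trans ?_
    rw [mul_left_comm]
    gcongr
    linarith
  have hsc : ∀ t : ℝ, 0 ≤ t → t ≤ θ + Θ → 1 + ν * t ≤ 1 + θ + Θ := fun t ht ht' => by
    nlinarith
  have h3 : |(1 + ν * T) * (ν⁻¹ * (|1 - u| ^ ν - 1))| ≤ (1 + θ + Θ) * (ν₀⁻¹ * E) := by
    rw [abs_mul, abs_of_nonneg (by positivity : 0 ≤ 1 + ν * T)]
    exact mul_le_mul (hsc T hT0 hT1) h1 (abs_nonneg _) (by positivity)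
  have h4 : |(1 + ν * θ) * (ν⁻¹ * ((1 + u) ^ ν - 1))| ≤ (1 + θ + Θ) * (2 * (ν₀⁻¹ * E)) := by
    rw [abs_mul, abs_of_nonneg (by positivity : 0 ≤ 1 + ν * θ)]
    exact mul_le_mul (hsc θ hθ (by linarith)) h2 (abs_nonneg _) (by positivity)
  have h5 : |T - θ| ≤ (1 + θ + Θ) * (ν₀⁻¹ * E) := by
    have : |T - θ| ≤ 1 + θ + Θ := abs_le.2 ⟨by linarith, by linarith⟩
    refine this.trans (le_mul_of_one_le_right (by positivity) ?_)
    nlinarith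
  have h6 : 0 ≤ (1 + θ + Θ) * (ν₀⁻¹ * E) := (abs_nonneg _).trans h5
  rw [b.inv_mul_growth_sub hν.ne']
  cases b
  · simp only [← hT]
    refine (abs_add_le _ _).trans ?_
    linarith
  · simp only [← hT]
    rw [abs_div, abs_two, div_le_iff₀ two_pos]
    refine (abs_add_le _ _).trans ?_
    have := abs_add_le ((1 + ν * T) * (ν⁻¹ * (|1 - u| ^ ν - 1))) (T - θ)
    linarith

/-- On a symmetric branch only one of the two directions can cross, so after halving both the
logarithms and the change of weight carry the same factor `χ`. For this reason `logProfile` is a sum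
and not a mean. -/
theorem tendsto_inv_mul_growth_sub (b : BranchType) {θ Θ u : ℝ} (hu : 0 < u) (hu1 : u ≠ 1) :
    Tendsto (fun ν => ν⁻¹ * (b.growth ν θ Θ u - (1 + ν * θ))) (𝓝[>] 0)
      (𝓝 (b.chi * (b.logProfile u + ((if u ≤ 1 then θ else Θ) - θ)))) := by
  set T : ℝ := if u ≤ 1 then θ else Θ with hT
  have hy : 0 < |1 - u| := abs_pos.2 (sub_ne_zero.2 hu1.symm)
  have hid : Tendsto (fun ν : ℝ => ν) (𝓝[>] 0) (𝓝 0) := tendsto_id.mono_left nhdsWithin_le_nhds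
  have h1 := tendsto_rpow_sub_one_log hy
  rw [Real.log_abs] at h1
  have h2 := tendsto_rpow_sub_one_log (by linarith : 0 < 1 + u)
  have h3 : Tendsto (fun ν => (1 + ν * T) * (ν⁻¹ * (|1 - u| ^ ν - 1)) + (T - θ)) (𝓝[>] 0)
      (𝓝 ((1 + 0 * T) * Real.log (1 - u) + (T - θ))) :=
    (((hid.mul_const T).const_add 1).mul h1).add_const _
  have h4 : Tendsto (fun ν => (1 + ν * θ) * (ν⁻¹ * ((1 + u) ^ ν - 1))) (𝓝[>] 0)
      (𝓝 ((1 + 0 * θ) * Real.log (1 + u))) := ((hid.mul_const θ).const_add 1).mul h2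
  have hev : ∀ᶠ ν : ℝ in 𝓝[>] 0, ν ≠ 0 := by
    filter_upwards [self_mem_nhdsWithin] with ν hν using ne_of_gt hν
  cases b
  · refine (Tendsto.congr' ?_ h3).trans (le_of_eq ?_)
    · filter_upwards [hev] with ν hν
      rw [inv_mul_growth_sub _ hν]
    · simp only [chi, logProfile]; ring_nf
  · refine (Tendsto.congr' ?_ ((h3.add h4).div_const 2)).trans (le_of_eq ?_)
    · filter_upwards [hev] with ν hν
      rw [inv_mul_growth_sub _ hν]
    · simp only [chi, logProfile]; ring_nf

theorem integral_Ioi_ite_mul_rpow {α η θ Θ : ℝ} (hα : 0 < α) (hη1 : η ≤ 1) :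
    IntegrableOn (fun u : ℝ => ((if u ≤ 1 then θ else Θ) - θ) * u ^ (-1 - α)) (Ioi η) ∧
      ∫ u in Ioi η, ((if u ≤ 1 then θ else Θ) - θ) * u ^ (-1 - α) = (Θ - θ) / α := by
  have e1 : EqOn (fun _ : ℝ => (0 : ℝ))
      (fun u : ℝ => ((if u ≤ 1 then θ else Θ) - θ) * u ^ (-1 - α)) (Ioc η 1) := by
    intro u hu; simp [hu.2]
  have e2 : EqOn (fun u : ℝ => (Θ - θ) * u ^ (-1 - α))
      (fun u : ℝ => ((if u ≤ 1 then θ else Θ) - θ) * u ^ (-1 - α)) (Ioi 1) := by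
    intro u hu; simp [not_le.2 (show 1 < u from hu)]
  have i1 := (integrableOn_zero (μ := volume) (s := Ioc η 1)).congr_fun e1 measurableSet_Ioc
  have i3 : IntegrableOn (fun u : ℝ => (Θ - θ) * u ^ (-1 - α)) (Ioi 1) :=
    (integrableOn_Ioi_rpow_of_lt (by linarith : -1 - α < -1) one_pos).const_mul (Θ - θ)
  have i2 := i3.congr_fun e2 measurableSet_Ioi
  rw [← Ioc_union_Ioi_eq_Ioi hη1]
  refine ⟨i1.union i2, ?_⟩
  rw [setIntegral_union (Ioc_disjoint_Ioi le_rfl) measurableSet_Ioi i1 i2,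
    ← setIntegral_congr_fun measurableSet_Ioc e1, ← setIntegral_congr_fun measurableSet_Ioi e2,
    integral_zero, zero_add, integral_const_mul,
    integral_Ioi_rpow_of_lt (by linarith : -1 - α < -1) one_pos, Real.one_rpow,
    show -1 - α + 1 = -α by ring, neg_div_neg_eq]
  ring

/-- After division by `ν`, dominated convergence gives a limit integral equal to `χ / α` times the
quantity assumed negative; the crossing term contributes `∫ u in Ioi 1, u ^ (-1 - α) = 1 / α`. -/
theorem eventually_integral_growth_sub_neg (b : BranchType) {α η θ Θ : ℝ} (hα : 0 < α)
    (hη : 0 < η) (hη1 : η ≤ 1) (hθ : 0 ≤ θ) (hΘ : 0 ≤ Θ)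
    (h : α * (∫ u in Ioi η, b.logProfile u * u ^ (-1 - α)) + (Θ - θ) < 0) :
    ∀ᶠ ν in 𝓝[>] 0,
      IntegrableOn (fun u => (b.growth ν θ Θ u - (1 + ν * θ)) * u ^ (-1 - α)) (Ioi η) ∧
      ∫ u in Ioi η, (b.growth ν θ Θ u - (1 + ν * θ)) * u ^ (-1 - α) < 0 := by
  obtain ⟨ν₀, hν₀, hν₀'⟩ := exists_between (lt_min one_pos hα)
  have hν1 : ν₀ < 1 := hν₀'.trans_le (min_le_left _ _)
  have hD := (integrableOn_Ioi_rpow_add_rpow_mul_rpow hν₀ hν1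
    (hν₀'.trans_le (min_le_right _ _)) hη hη1).const_mul (4 * ν₀⁻¹ * (1 + θ + Θ))
  have hm : ∀ ν, Measurable fun u => ν⁻¹ * (b.growth ν θ Θ u - (1 + ν * θ)) * u ^ (-1 - α) :=
    fun ν => (((b.measurable_growth ν θ Θ).sub_const _).const_mul _).mul (by fun_prop)
  have hbd : ∀ ν ∈ Ioo 0 ν₀, ∀ᵐ u ∂volume.restrict (Ioi η),
      ‖ν⁻¹ * (b.growth ν θ Θ u - (1 + ν * θ)) * u ^ (-1 - α)‖ ≤
      4 * ν₀⁻¹ * (1 + θ + Θ) * ((|1 - u| ^ (-ν₀) + (1 + u) ^ ν₀) * u ^ (-1 - α)) := by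
    intro ν hν
    filter_upwards [ae_restrict_mem measurableSet_Ioi, ae_ne_one _] with u hu hu1
    have hu0 : 0 < u := hη.trans hu
    have hp := Real.rpow_nonneg hu0.le (-1 - α)
    rw [norm_mul, Real.norm_eq_abs, Real.norm_of_nonneg hp, ← mul_assoc]
    gcongr
    exact b.abs_inv_mul_growth_sub_le hν.1 hν.2.le hν1.le hθ hΘ hu0 hu1
  have hIoo : ∀ᶠ ν : ℝ in 𝓝[>] 0, ν ∈ Ioo 0 ν₀ := Ioo_mem_nhdsGT hν₀
  have hlim : Tendsto (fun ν => ∫ u in Ioi η,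
      ν⁻¹ * (b.growth ν θ Θ u - (1 + ν * θ)) * u ^ (-1 - α)) (𝓝[>] 0) (𝓝 (∫ u in Ioi η,
        b.chi * (b.logProfile u + ((if u ≤ 1 then θ else Θ) - θ)) * u ^ (-1 - α))) := by
    refine tendsto_integral_filter_of_dominated_convergence _
      (.of_forall fun ν => (hm ν).aestronglyMeasurable) (hIoo.mono hbd) hD ?_
    filter_upwards [ae_restrict_mem measurableSet_Ioi, ae_ne_one _] with u hu hu1
    exact (b.tendsto_inv_mul_growth_sub (hη.trans hu) hu1).mul_const _
  have hval : ∫ u in Ioi η, b.chi * (b.logProfile u + ((if u ≤ 1 then θ else Θ) - θ)) *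
      u ^ (-1 - α) < 0 := by
    obtain ⟨i1, e1⟩ := integral_Ioi_ite_mul_rpow (θ := θ) (Θ := Θ) hα hη1
    have i2 := b.integrableOn_logProfile hα hη hη1
    simp only [mul_assoc, add_mul]
    rw [integral_const_mul, integral_add i2 i1, e1]
    refine mul_neg_of_pos_of_neg b.chi_pos ?_
    refine neg_of_mul_neg_right ?_ hα.le
    rw [mul_add, mul_div_cancel₀ _ hα.ne']
    exact h
  filter_upwards [hIoo, hlim.eventually (gt_mem_nhds hval)] with ν hν hneg
  have hi : IntegrableOn (fun u => ν⁻¹ * (b.growth ν θ Θ u - (1 + ν * θ)) * u ^ (-1 - α)) (Ioi η) :=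
    hD.mono' (hm ν).aestronglyMeasurable (hbd ν hν)
  have hν0 : ν ≠ 0 := hν.1.ne'
  constructor
  · refine (hi.const_mul ν).congr (.of_forall fun u => ?_)
    simp only
    rw [← mul_assoc, ← mul_assoc, mul_inv_cancel₀ hν0, one_mul]
  · simp only [mul_assoc] at hneg
    rw [integral_const_mul] at hneg
    exact neg_of_mul_neg_right hneg (inv_pos.2 hν.1).le

end BranchType

/-- Under `t = x u`, `x ^ (1 + α) * v (x u)` converges to `c u ^ (-1 - α)` and is bounded by a
multiple of `u ^ (-1 - α)` because the prefactor of the density is bounded; dominated convergence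
applies. -/
theorem TailClass.tendsto_rpow_mul_integral {α c : ℝ} {v : ℝ → ℝ} (hv : TailClass α c v) {η : ℝ}
    (hη : 0 < η) {g : ℝ → ℝ} (hg : Measurable g)
    (hi : IntegrableOn (fun u => g u * u ^ (-1 - α)) (Ioi η)) :
    (∀ x, 0 < x → IntegrableOn (fun t => v t * g (t / x)) (Ioi (x * η))) ∧
      Tendsto (fun x => x ^ α * ∫ t in Ioi (x * η), v t * g (t / x)) atTop
        (𝓝 (c * ∫ u in Ioi η, g u * u ^ (-1 - α))) := by
  obtain ⟨K, hK, hvK⟩ := hv.exists_le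
  have hscale : ∀ x : ℝ, 0 < x → ∀ u : ℝ, v (x * u) * g (x * u / x) = v (x * u) * g u := by
    intro x hx u; rw [mul_div_cancel_left₀ _ hx.ne']
  have hm : ∀ x : ℝ, Measurable fun u => v (x * u) * g u := fun x =>
    (hv.measurable.comp (by fun_prop)).mul hg
  have hbd : ∀ x : ℝ, 0 < x → ∀ u ∈ Ioi η, x ^ (1 + α) * ‖v (x * u) * g u‖ ≤
      K * ‖g u * u ^ (-1 - α)‖ := by
    intro x hx u hu
    have hu0 : 0 < u := hη.trans hu
    have h1 := hvK (x * u) (by positivity)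
    rw [Real.mul_rpow hx.le hu0.le] at h1
    rw [norm_mul, norm_mul, Real.norm_of_nonneg (hv.nonneg _),
      Real.norm_of_nonneg (Real.rpow_nonneg hu0.le _)]
    have h2 : x ^ (1 + α) * x ^ (-1 - α) = 1 := by
      rw [← Real.rpow_add hx]; simp
    calc x ^ (1 + α) * (v (x * u) * ‖g u‖) ≤
          x ^ (1 + α) * (K * (x ^ (-1 - α) * u ^ (-1 - α)) * ‖g u‖) := by gcongr
      _ = (x ^ (1 + α) * x ^ (-1 - α)) * (K * (‖g u‖ * u ^ (-1 - α))) := by ring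
      _ = _ := by rw [h2, one_mul]
  constructor
  · intro x hx
    rw [← integrableOn_Ioi_comp_mul_left_iff _ _ hx]
    simp only [hscale x hx]
    refine (hi.norm.const_mul (K * (x ^ (1 + α))⁻¹)).mono' (hm x).aestronglyMeasurable ?_
    filter_upwards [ae_restrict_mem measurableSet_Ioi] with u hu
    have hp : 0 < x ^ (1 + α) := Real.rpow_pos_of_pos hx _
    have := hbd x hx u hu
    rw [← le_div_iff₀' hp] at this
    refine this.trans (le_of_eq ?_)
    rw [div_eq_mul_inv]; ring
  · have heq : ∀ᶠ x : ℝ in atTop, ∫ u in Ioi η, x ^ (1 + α) * (v (x * u) * g u) =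
        x ^ α * ∫ t in Ioi (x * η), v t * g (t / x) := by
      filter_upwards [eventually_gt_atTop 0] with x hx
      rw [integral_const_mul, ← integral_comp_mul_left_Ioi' (fun t => v t * g (t / x)) η hx]
      simp only [hscale x hx, smul_eq_mul]
      rw [Real.rpow_add hx, Real.rpow_one]
      ring
    refine Tendsto.congr' heq ?_
    rw [← integral_const_mul]
    refine tendsto_integral_filter_of_dominated_convergence
      (fun u => K * ‖g u * u ^ (-1 - α)‖) ?_ ?_ (hi.norm.const_mul K) ?_
    · exact .of_forall fun x => ((hm x).const_mul _).aestronglyMeasurable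
    · filter_upwards [eventually_gt_atTop 0] with x hx
      filter_upwards [ae_restrict_mem measurableSet_Ioi] with u hu
      rw [norm_mul, Real.norm_of_nonneg (Real.rpow_nonneg hx.le _)]
      exact hbd x hx u hu
    · filter_upwards [ae_restrict_mem measurableSet_Ioi] with u hu
      have hu0 : 0 < u := hη.trans hu
      obtain ⟨-, C, -, -, hlim, hC, -⟩ := hv
      have h1 : Tendsto (fun x : ℝ => C (x * u)) atTop (𝓝 c) :=
        hlim.comp (tendsto_id.atTop_mul_const hu0)
      refine (h1.mul_const (g u * u ^ (-1 - α))).congr' ?_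
      filter_upwards [eventually_gt_atTop 0] with x hx
      rw [hC (x * u) (by positivity), Real.mul_rpow hx.le hu0.le]
      have h2 : x ^ (1 + α) * x ^ (-1 - α) = 1 := by
        rw [← Real.rpow_add hx]; simp
      calc C (x * u) * (g u * u ^ (-1 - α)) =
            x ^ (1 + α) * x ^ (-1 - α) * (C (x * u) * (g u * u ^ (-1 - α))) := by rw [h2, one_mul]
        _ = _ := by ring

/-! ### The routing matrix and its Fredholm alternative -/

namespace BranchWalk

section routing

variable {S : Type*} [Fintype S] (W : BranchWalk S)

theorem exists_pow_p_pos [DecidableEq S] (i j : S) : ∃ n : ℕ, 0 < n ∧ 0 < (W.p ^ n) i j := by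
  obtain ⟨n, h1, h2⟩ :=
    (Matrix.isIrreducible_iff_exists_pow_pos W.irreducible.nonneg).1 W.irreducible i j
  exact ⟨n, h1, h2⟩

theorem pow_p_nonneg [DecidableEq S] (n : ℕ) (i j : S) : 0 ≤ (W.p ^ n) i j :=
  Matrix.pow_apply_nonneg W.irreducible.nonneg n i j

theorem pow_p_mulVec_eq [DecidableEq S] {φ : S → ℝ} (h : W.p.mulVec φ = φ) (n : ℕ) :
    (W.p ^ n).mulVec φ = φ := by
  induction n with
  | zero => simp
  | succ n ih => rw [pow_succ, ← Matrix.mulVec_mulVec, h, ih]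

theorem mulVec_one : W.p.mulVec 1 = 1 := by
  ext i; simp [Matrix.mulVec, dotProduct, W.row_sum]

theorem exists_p_pos (j : S) : ∃ i, 0 < W.p i j := by
  classical
  obtain ⟨n, hn, h⟩ := W.exists_pow_p_pos j j
  obtain ⟨m, rfl⟩ := Nat.exists_eq_succ_of_ne_zero hn.ne'
  by_contra! hc
  have : (W.p ^ (m + 1)) j j = 0 := by
    rw [pow_succ, Matrix.mul_apply]
    exact Finset.sum_eq_zero fun i _ => by
      rw [le_antisymm (hc i) (W.irreducible.nonneg i j), mul_zero]
  exact h.ne' this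

theorem eq_of_mulVec_eq {φ : S → ℝ} (h : W.p.mulVec φ = φ) (i j : S) : φ i = φ j := by
  classical
  have : Nonempty S := ⟨i⟩
  obtain ⟨m, -, hm⟩ := Finset.exists_max_image Finset.univ φ Finset.univ_nonempty
  suffices H : ∀ k, φ k = φ m by rw [H i, H j]
  intro k
  refine le_antisymm (hm k (Finset.mem_univ k)) (not_lt.1 fun hlt => ?_)
  obtain ⟨n, -, hn⟩ := W.exists_pow_p_pos m k
  have h1 := congrFun (W.pow_p_mulVec_eq h n) m
  have h2 := congrFun (W.pow_p_mulVec_eq W.mulVec_one n) m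
  simp only [Matrix.mulVec, dotProduct, Pi.one_apply, mul_one] at h1 h2
  have h3 : ∑ l, (W.p ^ n) m l * φ l < ∑ l, (W.p ^ n) m l * φ m :=
    Finset.sum_lt_sum (fun l _ => mul_le_mul_of_nonneg_left (hm l (Finset.mem_univ l))
      (W.pow_p_nonneg n m l)) ⟨k, Finset.mem_univ k, mul_lt_mul_of_pos_left hlt hn⟩
  rw [h1, ← Finset.sum_mul, h2, one_mul] at h3
  exact lt_irrefl _ h3

variable {W}

theorem IsInvariant.vecMul_eq {μ : S → ℝ} (hμ : W.IsInvariant μ) : Matrix.vecMul μ W.p = μ := by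
  ext k
  exact sub_eq_zero.1 (hμ.2.2 k)

theorem IsInvariant.pos {μ : S → ℝ} (hμ : W.IsInvariant μ) (k : S) : 0 < μ k := by
  classical
  obtain ⟨j, hj⟩ : ∃ j, 0 < μ j := by
    by_contra! h
    have : ∑ k, μ k ≤ 0 := Finset.sum_nonpos fun i _ => h i
    linarith [hμ.2.1]
  obtain ⟨n, -, hn⟩ := W.exists_pow_p_pos j k
  have h1 : ∀ n : ℕ, Matrix.vecMul μ (W.p ^ n) = μ := by
    intro n
    induction n with
    | zero => simp
    | succ n ih => rw [pow_succ, ← Matrix.vecMul_vecMul, ih, hμ.vecMul_eq]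
  rw [← congrFun (h1 n) k]
  simp only [Matrix.vecMul, dotProduct]
  exact Finset.sum_pos' (fun i _ => mul_nonneg (hμ.1 i) (W.pow_p_nonneg n i k))
    ⟨j, Finset.mem_univ j, mul_pos hj hn⟩

/-- The range of `P - 1` lies in the hyperplane orthogonal to `μ`, and the two have equal dimension
since harmonic functions are constant by the maximum principle. So `Pθ - θ = m - b` is solvable with
`m` the `μ`-average of `b`, and adding a constant to `θ` makes it non-negative. -/
theorem IsInvariant.exists_add_mulVec_sub_neg {μ : S → ℝ} (hμ : W.IsInvariant μ) {b : S → ℝ}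
    (hb : ∑ k, μ k * b k < 0) :
    ∃ θ : S → ℝ, (∀ k, 0 ≤ θ k) ∧ ∀ i, b i + (∑ j, W.p i j * θ j - θ i) < 0 := by
  classical
  have hne : Nonempty S := by
    by_contra h
    have := not_nonempty_iff.1 h
    simpa using hμ.2.1
  let T : (S → ℝ) →ₗ[ℝ] (S → ℝ) := W.p.mulVecLin - LinearMap.id
  let L : (S → ℝ) →ₗ[ℝ] ℝ := Fintype.linearCombination ℝ μ
  have hT : ∀ φ i, T φ i = ∑ j, W.p i j * φ j - φ i := fun φ i => rfl
  have hL : ∀ φ, L φ = ∑ k, μ k * φ k := fun φ => by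
    simp [L, Fintype.linearCombination_apply, mul_comm]
  have hker : Module.finrank ℝ (LinearMap.ker T) ≤ 1 := by
    refine (Submodule.finrank_mono (t := Submodule.span ℝ {(1 : S → ℝ)}) fun φ hφ => ?_).trans
      (finrank_span_singleton one_ne_zero).le
    have h1 : W.p.mulVec φ = φ := by
      ext i
      exact sub_eq_zero.1 (congrFun (LinearMap.mem_ker.1 hφ) i)
    rw [Submodule.mem_span_singleton]
    refine ⟨φ hne.some, ?_⟩
    ext i
    simp [W.eq_of_mulVec_eq h1 hne.some i]
  have hrange : LinearMap.range T = LinearMap.ker L := by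
    refine Submodule.eq_of_le_of_finrank_le ?_ ?_
    · rintro _ ⟨φ, rfl⟩
      rw [LinearMap.mem_ker, hL]
      simp only [hT, mul_sub, Finset.mul_sum, Finset.sum_sub_distrib]
      rw [Finset.sum_comm, sub_eq_zero]
      refine Finset.sum_congr rfl fun k _ => ?_
      have := congrFun hμ.vecMul_eq k
      simp only [Matrix.vecMul, dotProduct] at this
      conv_rhs => rw [← this, Finset.sum_mul]
      exact Finset.sum_congr rfl fun j _ => (mul_assoc _ _ _).symm
    · have h1 := T.finrank_range_add_finrank_ker
      have h2 := L.finrank_range_add_finrank_ker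
      have h3 : Module.finrank ℝ (LinearMap.range L) = 1 := by
        have : LinearMap.range L = ⊤ := by
          refine LinearMap.range_eq_top.2 (LinearMap.surjective fun h => ?_)
          have := hL 1
          simp [h, hμ.2.1] at this
        rw [this]; simp
      omega
  set m := ∑ k, μ k * b k with hm
  have hmem : (fun i => m - b i) ∈ LinearMap.range T := by
    rw [hrange, LinearMap.mem_ker, hL]
    simp only [mul_sub, Finset.sum_sub_distrib, ← Finset.sum_mul, hμ.2.1, one_mul]
    rw [← hm, sub_self]
  obtain ⟨θ, hθ⟩ := hmem
  obtain ⟨l, -, hl⟩ := Finset.exists_min_image Finset.univ θ Finset.univ_nonempty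
  refine ⟨fun k => θ k - θ l, fun k => sub_nonneg.2 (hl k (Finset.mem_univ k)), fun i => ?_⟩
  have h1 := congrFun hθ i
  rw [hT] at h1
  simp only [mul_sub, Finset.sum_sub_distrib, ← Finset.sum_mul, W.row_sum, one_mul]
  linarith

end routing

/-! ### Negative drift of the Lyapunov function -/

section drift

variable {S : Type*} [Fintype S]

theorem exists_sum_mul_integral_logProfile_neg [Nonempty S] {μ : S → ℝ} (hμ : ∀ k, 0 < μ k)
    (hμ1 : ∑ k, μ k = 1) {ty : S → BranchType} {α : S → ℝ} (hα : ∀ k, 0 < α k)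
    (hcase : CaseA ty α ∨ CaseBI ty α μ) :
    ∃ η : S → ℝ, (∀ k, 0 < η k ∧ η k < 1) ∧
      ∑ k, μ k * (α k * ∫ u in Ioi (η k), (ty k).logProfile u * u ^ (-1 - α k)) < 0 := by
  classical
  rcases hcase with h | ⟨h, hsum⟩
  · obtain ⟨k, -, hk⟩ := (Finset.le_sup'_iff _).1 h
    set F : S → ℝ → ℝ := fun j η => μ j * (α j * ∫ u in Ioi η, (ty j).logProfile u * u ^ (-1 - α j))
    -- All other branches keep the cutoff `1 / 2`; the one with `χ α ≥ 1` is then cut off so close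
    -- to `0` that it outweighs their total.
    set R := ∑ j ∈ Finset.univ.erase k, F j (1 / 2) with hR
    obtain ⟨η, h1, h2, h3⟩ := (ty k).exists_mul_integral_logProfile_lt (hα k) hk (-R / μ k)
    refine ⟨Function.update (fun _ => (1 / 2 : ℝ)) k η, fun j => ?_, ?_⟩
    · rcases eq_or_ne j k with rfl | hj
      · simpa using ⟨h1, h2⟩
      · simp only [Function.update_of_ne hj]; norm_num
    · change ∑ j, F j (Function.update (fun _ => (1 / 2 : ℝ)) k η j) < 0
      rw [← Finset.add_sum_erase _ _ (Finset.mem_univ k), Function.update_self,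
        Finset.sum_congr rfl (g := fun j => F j (1 / 2)) fun j hj => by
          rw [Function.update_of_ne (Finset.ne_of_mem_erase hj)], ← hR]
      have : μ k * (α k * ∫ u in Ioi η, (ty k).logProfile u * u ^ (-1 - α k)) <
          μ k * (-R / μ k) := mul_lt_mul_of_pos_left h3 (hμ k)
      rw [mul_div_cancel₀ _ (hμ k).ne'] at this
      linarith
  · set σ := ∑ k, μ k * Real.cot ((ty k).chi * Real.pi * α k) with hσ
    -- This is all the room there is: with this error on every branch the `μ`-average of the bounds
    -- is exactly `0`, and strictness comes from the individual inequalities.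
    have hε : 0 < -(Real.pi * σ) := by
      have := mul_neg_of_pos_of_neg Real.pi_pos hsum
      linarith
    have h' := fun k => (ty k).exists_mul_integral_logProfile_lt_cot (hα k)
      ((Finset.sup'_lt_iff _).1 h k (Finset.mem_univ k)) hε
    choose η h1 h2 h3 using h'
    refine ⟨η, fun k => ⟨h1 k, h2 k⟩, ?_⟩
    calc _ < ∑ k, μ k * (Real.pi * Real.cot ((ty k).chi * Real.pi * α k) + -(Real.pi * σ)) :=
          Finset.sum_lt_sum_of_nonempty Finset.univ_nonempty fun k _ =>
            mul_lt_mul_of_pos_left (h3 k) (hμ k)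
      _ = 0 := by
          simp only [mul_add, Finset.sum_add_distrib, ← Finset.sum_mul, hμ1, one_mul, hσ]
          rw [Finset.mul_sum, ← sub_eq_add_neg, ← Finset.sum_sub_distrib]
          exact Finset.sum_eq_zero fun k _ => by ring

/-- The Lyapunov function `(1 + ν θ_i) x ^ ν`. -/
noncomputable def lyapunov (ν : ℝ) (θ : S → ℝ) (s : ℝ≥0 × S) : ℝ≥0∞ :=
  ENNReal.ofReal ((1 + ν * θ s.2) * (s.1 : ℝ) ^ ν)

theorem landing_lyapunov (W : BranchWalk S) {ν x t : ℝ} (hν : 0 ≤ ν) (hx : 0 < x) {θ : S → ℝ}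
    (hθ : ∀ k, 0 ≤ θ k) (i : S) :
    W.landing i (lyapunov ν θ) (x - t) = ENNReal.ofReal (x ^ ν * ((1 + ν * if t / x ≤ 1 then θ i
      else ∑ j, W.p i j * θ j) * |1 - t / x| ^ ν)) := by
  have habs : |x - t| ^ ν = x ^ ν * |1 - t / x| ^ ν := by
    rw [← Real.mul_rpow hx.le (abs_nonneg _)]
    congr 1
    rw [← abs_of_pos hx, ← abs_mul, abs_of_pos hx, mul_sub, mul_one, mul_div_cancel₀ _ hx.ne']
  by_cases h : t / x ≤ 1
  · have h' : 0 ≤ x - t := by rw [div_le_one hx] at h; linarith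
    rw [W.landing_of_nonneg _ _ h', if_pos h, lyapunov, Real.coe_toNNReal _ h', mul_left_comm,
      ← habs, abs_of_nonneg h']
  · have h' : x - t < 0 := by rw [div_le_one hx] at h; linarith
    rw [W.landing_of_neg _ _ h', if_neg h, mul_left_comm, ← habs, abs_of_neg h']
    simp only [lyapunov, Real.coe_toNNReal _ (neg_nonneg.2 h'.le)]
    have hp := W.irreducible.nonneg i
    have hy : 0 ≤ (-(x - t)) ^ ν := Real.rpow_nonneg (neg_nonneg.2 h'.le) ν
    calc _ = ∑ j, ENNReal.ofReal (W.p i j * ((1 + ν * θ j) * (-(x - t)) ^ ν)) :=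
          Finset.sum_congr rfl fun j _ => (ENNReal.ofReal_mul (hp j)).symm
      _ = ENNReal.ofReal (∑ j, W.p i j * ((1 + ν * θ j) * (-(x - t)) ^ ν)) := by
          refine (ENNReal.ofReal_sum_of_nonneg fun j _ => ?_).symm
          have := hp j
          have := hθ j
          positivity
      _ = _ := by
          congr 1
          simp only [← mul_assoc, ← Finset.sum_mul]
          congr 1
          simp only [mul_add, mul_one, Finset.sum_add_distrib, W.row_sum, Finset.mul_sum]
          congr 1
          exact Finset.sum_congr rfl fun j _ => by ring

theorem avg_landing_lyapunov (W : BranchWalk S) (b : BranchType) {ν x t : ℝ} (hν : 0 ≤ ν)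
    (hx : 0 < x) (ht : 0 ≤ t) {θ : S → ℝ} (hθ : ∀ k, 0 ≤ θ k) (i : S) :
    b.avg (W.landing i (lyapunov ν θ)) x t =
      ENNReal.ofReal (x ^ ν * b.growth ν (θ i) (∑ j, W.p i j * θ j) (t / x)) := by
  have h1 := W.landing_lyapunov (t := t) hν hx hθ i
  cases b
  · simp only [BranchType.avg, BranchType.growth, h1]
  · have h2 : W.landing i (lyapunov ν θ) (x + t) =
        ENNReal.ofReal (x ^ ν * ((1 + ν * θ i) * (1 + t / x) ^ ν)) := by
      have h' : 0 ≤ x + t := by positivity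
      rw [W.landing_of_nonneg _ _ h', lyapunov, Real.coe_toNNReal _ h', mul_left_comm (x ^ ν),
        ← Real.mul_rpow hx.le (by positivity), mul_add, mul_one, mul_div_cancel₀ _ hx.ne']
    have hΘ : 0 ≤ if t / x ≤ 1 then θ i else ∑ j, W.p i j * θ j := by
      split_ifs
      · exact hθ i
      · exact Finset.sum_nonneg fun j _ => mul_nonneg (W.irreducible.nonneg i j) (hθ j)
    have hi := hθ i
    simp only [BranchType.avg, BranchType.growth, h1, h2]
    rw [← ENNReal.ofReal_add (by positivity) (by positivity), ← mul_add, ← mul_div_assoc,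
      ENNReal.ofReal_div_of_pos two_pos, ENNReal.ofReal_ofNat]

theorem measurable_lyapunov [MeasurableSpace S] [DiscreteMeasurableSpace S] (ν : ℝ) (θ : S → ℝ) :
    Measurable (lyapunov ν θ) := by
  have : Measurable fun s : ℝ≥0 × S => θ s.2 := (measurable_of_countable θ).comp measurable_snd
  exact (((this.const_mul ν).const_add 1).mul (by fun_prop)).ennreal_ofReal

variable {W : BranchWalk S} {ty : S → BranchType} {α c : S → ℝ} {v : S → ℝ → ℝ}
  [MeasurableSpace S] [DiscreteMeasurableSpace S]

/-- Jumps below `x * η` are bounded by `growth_le`. The others change the mean by `x ^ ν * Z`, where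
the scaling limit gives `x ^ α * Z → J < 0`; half of `J` is kept as the drift constant. -/
theorem HeavyTailed.eventually_lintegral_lyapunov_le (hW : W.HeavyTailed ty α c v) {ν η : ℝ}
    (hν : 0 ≤ ν) (hν1 : ν ≤ 1) (hη : 0 < η) (hη1 : η < 1) {θ : S → ℝ} (hθ : ∀ k, 0 ≤ θ k) (i : S)
    (hi : IntegrableOn (fun u => ((ty i).growth ν (θ i) (∑ j, W.p i j * θ j) u - (1 + ν * θ i)) *
      u ^ (-1 - α i)) (Ioi η))
    (hneg : ∫ u in Ioi η, ((ty i).growth ν (θ i) (∑ j, W.p i j * θ j) u - (1 + ν * θ i)) *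
      u ^ (-1 - α i) < 0) :
    ∃ ε : ℝ, 0 < ε ∧ ∀ᶠ x : ℝ≥0 in atTop, ∫⁻ s, lyapunov ν θ s ∂W.kernel (x, i) +
      ENNReal.ofReal (ε * (x : ℝ) ^ (ν - α i)) ≤ lyapunov ν θ (x, i) := by
  set Θ := ∑ j, W.p i j * θ j with hΘ
  have hΘ0 : 0 ≤ Θ := Finset.sum_nonneg fun j _ => mul_nonneg (W.irreducible.nonneg i j) (hθ j)
  set l := 1 + ν * θ i with hl
  have hl0 : 0 < l := by have := hθ i; positivity
  set R := (ty i).growth ν (θ i) Θ with hR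
  have hRm : Measurable R := (ty i).measurable_growth _ _ _
  have hv := hW.tailClass i
  obtain ⟨hint, hlim⟩ := hv.tendsto_rpow_mul_integral hη (hRm.sub_const l) hi
  set J := c i * ∫ u in Ioi η, (R u - l) * u ^ (-1 - α i) with hJ
  have hJ0 : J < 0 := mul_neg_of_pos_of_neg (hW.c_pos i) hneg
  refine ⟨-J / 2, by linarith, ?_⟩
  have hev := hlim.eventually (gt_mem_nhds (show J < J / 2 by linarith))
  have hcoe : Tendsto (fun x : ℝ≥0 => (x : ℝ)) atTop atTop := NNReal.tendsto_coe_atTop.2 tendsto_id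
  filter_upwards [hcoe.eventually hev, hcoe.eventually (eventually_gt_atTop 0)] with x hx hx0
  set Z := ∫ t in Ioi ((x : ℝ) * η), v i t * (R (t / x) - l) with hZ
  have hxη : 0 < (x : ℝ) * η := by positivity
  have hxα : (0 : ℝ) < (x : ℝ) ^ α i := Real.rpow_pos_of_pos hx0 _
  have hZle : Z ≤ J / 2 * (x : ℝ) ^ (-α i) := by
    rw [Real.rpow_neg hx0.le, ← div_eq_mul_inv, le_div_iff₀ hxα, mul_comm]
    exact hx.le
  have hvint : IntegrableOn (v i) (Ioi 0) := by
    refine ⟨hv.measurable.aestronglyMeasurable, ?_⟩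
    rw [hasFiniteIntegral_iff_ofReal (.of_forall hv.nonneg), hv.lintegral_Ioi_eq_one]
    exact ENNReal.one_lt_top
  have hvone : ∫ t in Ioi 0, v i t = 1 := by
    rw [integral_eq_lintegral_of_nonneg_ae (.of_forall hv.nonneg)
      hv.measurable.aestronglyMeasurable, hv.lintegral_Ioi_eq_one, ENNReal.toReal_one]
  have hv1 := hvint.mono_set (show Ioc 0 ((x : ℝ) * η) ⊆ Ioi 0 from Ioc_subset_Ioi_self)
  have hv2 := hvint.mono_set (Ioi_subset_Ioi hxη.le)
  have hvsplit : (∫ t in Ioc 0 ((x : ℝ) * η), v i t) + ∫ t in Ioi ((x : ℝ) * η), v i t = 1 := by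
    rw [← setIntegral_union (Ioc_disjoint_Ioi le_rfl) measurableSet_Ioi hv1 hv2,
      Ioc_union_Ioi_eq_Ioi hxη.le, hvone]
  have hxν : 0 < (x : ℝ) ^ ν := Real.rpow_pos_of_pos hx0 _
  have hRnn : ∀ t, 0 < t → 0 ≤ R (t / x) := fun t ht =>
    (ty i).growth_nonneg hν (hθ i) hΘ0 (by positivity)
  have hvR : IntegrableOn (fun t => v i t * R (t / x)) (Ioi ((x : ℝ) * η)) := by
    refine ((hint x hx0).add (hv2.mul_const l)).congr (.of_forall fun t => ?_)
    simp only [Pi.add_apply]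
    ring
  have hI1 : 0 ≤ ∫ t in Ioc 0 ((x : ℝ) * η), v i t := integral_nonneg hv.nonneg
  have hI2 : 0 ≤ ∫ t in Ioi ((x : ℝ) * η), v i t * R (t / x) :=
    setIntegral_nonneg measurableSet_Ioi fun t ht =>
      mul_nonneg (hv.nonneg t) (hRnn t (hxη.trans ht))
  have hlZ : l + Z = l * (∫ t in Ioc 0 ((x : ℝ) * η), v i t) +
      ∫ t in Ioi ((x : ℝ) * η), v i t * R (t / x) := by
    have hZ' : Z = (∫ t in Ioi ((x : ℝ) * η), v i t * R (t / x)) -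
        (∫ t in Ioi ((x : ℝ) * η), v i t) * l := by
      rw [← integral_mul_const, ← integral_sub hvR (hv2.mul_const l)]
      simp only [hZ, mul_sub]
    rw [hZ']
    linear_combination (-l) * hvsplit
  have hkey : ∫⁻ s, lyapunov ν θ s ∂W.kernel (x, i) ≤ ENNReal.ofReal ((x : ℝ) ^ ν * (l + Z)) := by
    rw [hW.lintegral_kernel x i (measurable_lyapunov ν θ), ← Ioc_union_Ioi_eq_Ioi hxη.le,
      lintegral_union measurableSet_Ioi (Ioc_disjoint_Ioi le_rfl)]
    have e1 : ∫⁻ t in Ioc 0 ((x : ℝ) * η), ENNReal.ofReal (v i t) *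
        (ty i).avg (W.landing i (lyapunov ν θ)) x t ≤
        ENNReal.ofReal ((x : ℝ) ^ ν * (l * ∫ t in Ioc 0 ((x : ℝ) * η), v i t)) := by
      calc _ ≤ ∫⁻ t in Ioc 0 ((x : ℝ) * η), ENNReal.ofReal (v i t * ((x : ℝ) ^ ν * l)) := by
            refine setLIntegral_mono' measurableSet_Ioc fun t ht => ?_
            rw [W.avg_landing_lyapunov _ hν hx0 ht.1.le hθ, ENNReal.ofReal_mul (hv.nonneg t)]
            gcongr
            refine (ty i).growth_le hν hν1 (hθ i) (div_nonneg ht.1.le hx0.le) ?_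
            rw [div_le_one hx0]
            exact ht.2.trans (mul_le_of_le_one_right hx0.le hη1.le)
        _ = ENNReal.ofReal (∫ t in Ioc 0 ((x : ℝ) * η), v i t * ((x : ℝ) ^ ν * l)) := by
            rw [ofReal_integral_eq_lintegral_ofReal (hv1.mul_const _)]
            exact .of_forall fun t => mul_nonneg (hv.nonneg t) (by positivity)
        _ = _ := by rw [integral_mul_const]; ring_nf
    have e2 : ∫⁻ t in Ioi ((x : ℝ) * η), ENNReal.ofReal (v i t) *
        (ty i).avg (W.landing i (lyapunov ν θ)) x t =
        ENNReal.ofReal ((x : ℝ) ^ ν * ∫ t in Ioi ((x : ℝ) * η), v i t * R (t / x)) := by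
      rw [← integral_const_mul, ofReal_integral_eq_lintegral_ofReal (hvR.const_mul _)]
      · refine setLIntegral_congr_fun measurableSet_Ioi fun t ht => ?_
        rw [W.avg_landing_lyapunov _ hν hx0 (hxη.trans ht).le hθ,
          ← ENNReal.ofReal_mul (hv.nonneg t)]
        congr 1
        ring
      · filter_upwards [ae_restrict_mem measurableSet_Ioi] with t ht
        exact mul_nonneg hxν.le (mul_nonneg (hv.nonneg t) (hRnn t (hxη.trans ht)))
    rw [e2]
    refine (add_le_add_left e1 _).trans (le_of_eq ?_)
    rw [← ENNReal.ofReal_add (by positivity) (by positivity), ← mul_add, hlZ]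
  refine (add_le_add_left hkey _).trans ?_
  have hεx : 0 ≤ -J / 2 * (x : ℝ) ^ (ν - α i) :=
    mul_nonneg (by linarith) (Real.rpow_nonneg hx0.le _)
  have h0 : 0 ≤ (x : ℝ) ^ ν * (l + Z) := by rw [hlZ]; positivity
  rw [← ENNReal.ofReal_add h0 hεx, lyapunov]
  refine ENNReal.ofReal_le_ofReal ?_
  change _ ≤ l * (x : ℝ) ^ ν
  rw [sub_eq_add_neg, Real.rpow_add hx0]
  nlinarith

end drift

end BranchWalk

/-! ### A polynomial upper bound for survival -/

namespace BranchWalk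

variable {S : Type*} [Fintype S] [MeasurableSpace S] [DiscreteMeasurableSpace S]

section staying

variable (W : BranchWalk S)

/-- The probability that the chain started at `s` stays in `D` up to time `n`. -/
noncomputable def staying (D : Set (ℝ≥0 × S)) : ℕ → ℝ≥0 × S → ℝ≥0∞
  | 0 => D.indicator 1
  | n + 1 => D.indicator fun s => ∫⁻ s', staying D n s' ∂W.kernel s

variable {D : Set (ℝ≥0 × S)}

theorem measurable_staying (hD : MeasurableSet D) (n : ℕ) : Measurable (W.staying D n) := by
  induction n with
  | zero => exact measurable_one.indicator hD
  | succ n ih => exact (ih.lintegral_kernel).indicator hD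

theorem staying_of_notMem {s : ℝ≥0 × S} (h : s ∉ D) (n : ℕ) : W.staying D n s = 0 := by
  cases n <;> exact indicator_of_notMem h _

theorem staying_zero_of_mem {s : ℝ≥0 × S} (h : s ∈ D) : W.staying D 0 s = 1 :=
  indicator_of_mem h _

theorem staying_succ_of_mem {s : ℝ≥0 × S} (h : s ∈ D) (n : ℕ) :
    W.staying D (n + 1) s = ∫⁻ s', W.staying D n s' ∂W.kernel s :=
  indicator_of_mem h _

theorem staying_le_one (n : ℕ) (s : ℝ≥0 × S) : W.staying D n s ≤ 1 := by
  induction n generalizing s with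
  | zero => exact indicator_le_self _ _ _
  | succ n ih =>
    refine (indicator_le_self _ _ _).trans ?_
    calc _ ≤ ∫⁻ _, 1 ∂W.kernel s := lintegral_mono ih
      _ = 1 := by simp

theorem staying_succ_le_self (n : ℕ) (s : ℝ≥0 × S) :
    W.staying D (n + 1) s ≤ W.staying D n s := by
  induction n generalizing s with
  | zero =>
    by_cases h : s ∈ D
    · rw [W.staying_zero_of_mem h]; exact W.staying_le_one _ _
    · rw [W.staying_of_notMem h]; exact zero_le
  | succ n ih =>
    by_cases h : s ∈ D
    · rw [W.staying_succ_of_mem h, W.staying_succ_of_mem h]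
      exact lintegral_mono ih
    · rw [W.staying_of_notMem h]; exact zero_le

/-- Each step begun in `D` costs `f` at least `δ` in mean, and `f` cannot become negative, so the
expected number of steps before leaving `D` is at most `f s / δ`. -/
theorem mul_sum_staying_le (hD : MeasurableSet D) {f : ℝ≥0 × S → ℝ≥0∞} {δ : ℝ≥0∞}
    (h : ∀ s ∈ D, ∫⁻ s', f s' ∂W.kernel s + δ ≤ f s) (n : ℕ) (s : ℝ≥0 × S) :
    δ * ∑ m ∈ Finset.range n, W.staying D m s ≤ f s := by
  induction n generalizing s with
  | zero => simp
  | succ n ih =>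
    by_cases hs : s ∈ D
    · rw [Finset.sum_range_succ']
      simp only [W.staying_succ_of_mem hs, W.staying_zero_of_mem hs]
      rw [← lintegral_finsetSum _ fun m _ => W.measurable_staying hD m, mul_add, mul_one,
        ← lintegral_const_mul _ (Finset.measurable_sum _ fun m _ => W.measurable_staying hD m)]
      exact (add_le_add_left (lintegral_mono ih) _).trans (h s hs)
    · simp [W.staying_of_notMem hs]

theorem mul_staying_le (hD : MeasurableSet D) {f : ℝ≥0 × S → ℝ≥0∞} {δ : ℝ≥0∞}
    (h : ∀ s ∈ D, ∫⁻ s', f s' ∂W.kernel s + δ ≤ f s) (n : ℕ) (s : ℝ≥0 × S) :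
    δ * (n + 1) * W.staying D n s ≤ f s := by
  refine le_trans ?_ (W.mul_sum_staying_le hD h (n + 1) s)
  rw [mul_assoc]
  gcongr
  have : Antitone fun m => W.staying D m s := antitone_nat_of_succ_le fun m =>
    W.staying_succ_le_self m s
  calc ((n : ℝ≥0∞) + 1) * W.staying D n s = ∑ m ∈ Finset.range (n + 1), W.staying D n s := by simp
    _ ≤ _ := Finset.sum_le_sum fun m hm => this (Nat.lt_succ_iff.1 (Finset.mem_range.1 hm))

/-- To stay above `a` the chain either remains in `D` or leaves it at a point above `a`, where the
supermartingale `g` is at least `1`. -/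
theorem survival_le_staying_add (hD : MeasurableSet D) {a : ℝ} {g : ℝ≥0 × S → ℝ≥0∞}
    (h : ∀ s ∈ D, ∫⁻ s', g s' ∂W.kernel s ≤ g s) (hg : ∀ s, a < s.1 → s ∉ D → 1 ≤ g s)
    (n : ℕ) (s : ℝ≥0 × S) : W.survival a n s ≤ W.staying D n s + g s := by
  induction n generalizing s with
  | zero =>
    by_cases hs : s ∈ D
    · rw [W.staying_zero_of_mem hs]; exact (W.survival_le_one _ _ _).trans le_self_add
    · rcases le_or_gt (s.1 : ℝ) a with h' | h'
      · rw [W.survival_of_le h']; exact zero_le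
      · exact (W.survival_le_one _ _ _).trans ((hg s h' hs).trans le_add_self)
  | succ n ih =>
    by_cases hs : s ∈ D
    · rw [W.staying_succ_of_mem hs]
      calc _ ≤ _ := W.survival_succ_le a n s
        _ ≤ ∫⁻ s', (W.staying D n s' + g s') ∂W.kernel s := lintegral_mono ih
        _ = ∫⁻ s', W.staying D n s' ∂W.kernel s + ∫⁻ s', g s' ∂W.kernel s :=
          lintegral_add_left (W.measurable_staying hD n) _
        _ ≤ _ := by gcongr; exact h s hs
    · rcases le_or_gt (s.1 : ℝ) a with h' | h'
      · rw [W.survival_of_le h']; exact zero_le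
      · exact (W.survival_le_one _ _ _).trans ((hg s h' hs).trans le_add_self)

end staying

variable {W : BranchWalk S} {ty : S → BranchType} {α c : S → ℝ} {v : S → ℝ → ℝ} {μ : S → ℝ}

theorem HeavyTailed.exists_drift [Nonempty S] (hW : W.HeavyTailed ty α c v) (hμ : W.IsInvariant μ)
    (hcase : CaseA ty α ∨ CaseBI ty α μ) :
    ∃ (ν β ε A : ℝ) (θ : S → ℝ), 0 < ν ∧ ν ≤ β ∧ 0 < ε ∧ 1 ≤ A ∧ (∀ k, 0 ≤ θ k) ∧
      ∀ s : ℝ≥0 × S, A < s.1 → ∫⁻ s', lyapunov ν θ s' ∂W.kernel s +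
        ENNReal.ofReal (ε * (s.1 : ℝ) ^ (ν - β)) ≤ lyapunov ν θ s := by
  obtain ⟨η, hη, hneg⟩ := exists_sum_mul_integral_logProfile_neg hμ.pos hμ.2.1 hW.alpha_pos hcase
  obtain ⟨θ, hθ, hθ'⟩ := hμ.exists_add_mulVec_sub_neg hneg
  have hΘ : ∀ i, 0 ≤ ∑ j, W.p i j * θ j := fun i =>
    Finset.sum_nonneg fun j _ => mul_nonneg (W.irreducible.nonneg i j) (hθ j)
  have hν := fun i => (ty i).eventually_integral_growth_sub_neg (hW.alpha_pos i) (hη i).1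
    (hη i).2.le (hθ i) (hΘ i) (hθ' i)
  obtain ⟨ν, hν', hν0⟩ := ((eventually_all.2 hν).and (Ioo_mem_nhdsGT one_pos)).exists
  have hd := fun i => hW.eventually_lintegral_lyapunov_le hν0.1.le hν0.2.le (hη i).1 (hη i).2 hθ i
    (hν' i).1 (hν' i).2
  choose ε hε hεx using hd
  obtain ⟨k, -, hk⟩ := Finset.exists_min_image Finset.univ ε Finset.univ_nonempty
  obtain ⟨l, -, hl⟩ := Finset.exists_max_image Finset.univ α Finset.univ_nonempty
  obtain ⟨A, hA⟩ := eventually_atTop.1 (eventually_all.2 hεx)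
  -- Taking `β` at least `ν` makes `x ^ (ν - β)` non-increasing, and heights above `1` make it a
  -- lower bound for `x ^ (ν - α i)` on every branch.
  refine ⟨ν, max ν (α l), ε k, max A 1, θ, hν0.1, le_max_left _ _, hε k, le_max_right _ _, hθ, ?_⟩
  rintro ⟨x, i⟩ hx
  have hx1 : 1 < (x : ℝ) := (le_max_right _ _).trans_lt hx
  have hxA : A ≤ x := by
    have : (A : ℝ) < x := (le_max_left _ _).trans_lt hx
    exact_mod_cast this.le
  refine le_trans ?_ (hA x hxA i)
  gcongr
  · exact (hε i).le
  · exact hk i (Finset.mem_univ i)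
  · exact hx1.le
  · exact (hl i (Finset.mem_univ i)).trans (le_max_right _ _)

theorem HeavyTailed.exists_survival_le [Nonempty S] (hW : W.HeavyTailed ty α c v)
    (hμ : W.IsInvariant μ) (hcase : CaseA ty α ∨ CaseBI ty α μ) :
    ∃ (q A : ℝ) (f : ℝ≥0 × S → ℝ≥0∞), 0 < q ∧ 0 < A ∧ (∀ s, f s ≠ ⊤) ∧
      ∀ (n : ℕ) (s : ℝ≥0 × S),
        W.survival A n s ≤ f s * ENNReal.ofReal (((n : ℝ) + 1) ^ (-q)) := by
  obtain ⟨ν, β, ε, A, θ, hν, hνβ, hε, hA, hθ, hd⟩ := hW.exists_drift hμ hcase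
  have hβ : 0 < β := hν.trans_le hνβ
  refine ⟨ν / β, A, fun s => lyapunov ν θ s * ENNReal.ofReal (1 / ε + 1), by positivity,
    by linarith, fun s => ENNReal.mul_ne_top ENNReal.ofReal_ne_top ENNReal.ofReal_ne_top,
    fun n s => ?_⟩
  have hn : (0 : ℝ) < (n : ℝ) + 1 := by positivity
  -- This height balances the two ways to survive: `n` steps below `r` and an excursion above `r`
  -- both have probability of order `(n + 1) ^ (-(ν / β))`.
  set r : ℝ := ((n : ℝ) + 1) ^ (1 / β) with hr
  have hr0 : 0 < r := Real.rpow_pos_of_pos hn _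
  set D : Set (ℝ≥0 × S) := {s | A < s.1 ∧ (s.1 : ℝ) ≤ r} with hD
  have hfst : Measurable fun s : ℝ≥0 × S => (s.1 : ℝ) := by fun_prop
  have hDm : MeasurableSet D :=
    (measurableSet_lt measurable_const hfst).inter (measurableSet_le hfst measurable_const)
  have hrν : r ^ ν = ((n : ℝ) + 1) ^ (ν / β) := by
    rw [hr, ← Real.rpow_mul hn.le]; ring_nf
  have hrβ : r ^ (ν - β) * ((n : ℝ) + 1) = ((n : ℝ) + 1) ^ (ν / β) := by
    rw [hr, ← Real.rpow_mul hn.le, ← Real.rpow_add_one hn.ne']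
    congr 1
    field_simp
    ring
  have h1 : ∀ s ∈ D, ∫⁻ s', lyapunov ν θ s' ∂W.kernel s + ENNReal.ofReal (ε * r ^ (ν - β)) ≤
      lyapunov ν θ s := by
    intro s hs
    refine le_trans ?_ (hd s hs.1)
    have : (0 : ℝ) < s.1 := by linarith [hs.1]
    refine add_le_add le_rfl (ENNReal.ofReal_le_ofReal (mul_le_mul_of_nonneg_left ?_ hε.le))
    exact Real.rpow_le_rpow_of_nonpos this hs.2 (sub_nonpos.2 hνβ)
  have h2 := W.mul_staying_le hDm h1 n s
  have hP : (0 : ℝ) < ((n : ℝ) + 1) ^ (ν / β) := Real.rpow_pos_of_pos hn _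
  have h3 : W.staying D n s ≤
      lyapunov ν θ s * ENNReal.ofReal (1 / ε * ((n : ℝ) + 1) ^ (-(ν / β))) := by
    have e : ENNReal.ofReal (ε * r ^ (ν - β)) * ((n : ℝ≥0∞) + 1) =
        ENNReal.ofReal (ε * ((n : ℝ) + 1) ^ (ν / β)) := by
      have hx : 0 ≤ ε * r ^ (ν - β) := by positivity
      rw [← hrβ, ← mul_assoc, ENNReal.ofReal_mul hx]
      congr 1
      rw [ENNReal.ofReal_add (by positivity) zero_le_one, ENNReal.ofReal_natCast,
          ENNReal.ofReal_one]
    rw [e] at h2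
    calc W.staying D n s = ENNReal.ofReal (1 / ε * ((n : ℝ) + 1) ^ (-(ν / β))) *
          (ENNReal.ofReal (ε * ((n : ℝ) + 1) ^ (ν / β)) * W.staying D n s) := by
          rw [← mul_assoc, ← ENNReal.ofReal_mul (by positivity), Real.rpow_neg hn.le]
          have : 1 / ε * (((n : ℝ) + 1) ^ (ν / β))⁻¹ * (ε * ((n : ℝ) + 1) ^ (ν / β)) = 1 := by
            field_simp
          rw [this, ENNReal.ofReal_one, one_mul]
      _ ≤ _ := by rw [mul_comm (lyapunov ν θ s)]; gcongr
  have h4 := W.survival_le_staying_add (a := A) (D := D) hDm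
    (g := fun s => lyapunov ν θ s * ENNReal.ofReal (((n : ℝ) + 1) ^ (-(ν / β)))) ?_ ?_ n s
  · refine h4.trans ((add_le_add_left h3 _).trans (le_of_eq ?_))
    rw [← mul_add, mul_assoc, ← ENNReal.ofReal_mul (by positivity),
      ← ENNReal.ofReal_add (by positivity) (by positivity)]
    congr 2
    ring
  · intro s hs
    rw [lintegral_mul_const _ (measurable_lyapunov ν θ)]
    gcongr
    exact le_self_add.trans (h1 s hs)
  · intro s hs hsD
    have hsr : r < s.1 := by
      by_contra h
      exact hsD ⟨hs, not_lt.1 h⟩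
    rw [lyapunov, ← ENNReal.ofReal_mul (by have := hθ s.2; positivity), ← ENNReal.ofReal_one]
    refine ENNReal.ofReal_le_ofReal ?_
    rw [Real.rpow_neg hn.le, ← div_eq_mul_inv, le_div_iff₀ hP, ← hrν, one_mul]
    have h5 : r ^ ν ≤ (s.1 : ℝ) ^ ν := Real.rpow_le_rpow hr0.le hsr.le hν.le
    have h6 : 0 ≤ ν * θ s.2 * (s.1 : ℝ) ^ ν := by have := hθ s.2; positivity
    linarith

theorem HeavyTailed.exists_passageMoment_lt_top [Nonempty S] (hW : W.HeavyTailed ty α c v)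
    (hμ : W.IsInvariant μ) (hcase : CaseA ty α ∨ CaseBI ty α μ) :
    ∃ q : ℝ, 0 < q ∧ ∃ a : ℝ, 0 < a ∧ ∃ x : ℝ≥0, a < x ∧ ∃ k : S,
      W.passageMoment a x k q < ⊤ := by
  obtain ⟨q, A, f, hq, hA, hf, h⟩ := hW.exists_survival_le hμ hcase
  have hx : A < ((A + 1).toNNReal : ℝ) := by rw [Real.coe_toNNReal _ (by linarith)]; linarith
  obtain ⟨k⟩ := ‹Nonempty S›
  exact ⟨q / 2, half_pos hq, A, hA, _, hx, k,
    W.passageMoment_lt_top_of_survival_le (half_lt_self hq) hx (hf _) fun n => h n _⟩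

end BranchWalk

/-! ### Jump densities averaged over the starting point -/

section TailClass

variable {α c : ℝ} {v : ℝ → ℝ}

/-- The density is positive off the origin but need not be locally bounded below. Still, the set
where it is less than `1 / (m + 1)` on a bounded interval has measure tending to `0`. For large `m`
every translate of this set misses at least half of `E`. -/
theorem TailClass.exists_le_setLIntegral_of_abs_le (hv : TailClass α c v) {E : Set ℝ} {L : ℝ}
    (hE : MeasurableSet E) (hE0 : volume E ≠ 0) (hEL : E ⊆ Icc 0 L) (T : ℝ) :
    ∃ k : ℝ, 0 < k ∧ ∀ t : ℝ, |t| ≤ T →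
      ENNReal.ofReal k ≤ ∫⁻ y in E, ENNReal.ofReal (v |t - y|) := by
  have hEtop : volume E ≠ ⊤ := ((measure_mono hEL).trans_lt (by simp)).ne
  have hvm : Measurable fun u : ℝ => v |u| := hv.measurable.comp (by fun_prop)
  let B : ℕ → Set ℝ := fun m => Icc (-(T + L)) (T + L) ∩ {u | v |u| < 1 / ((m : ℝ) + 1)}
  have hB : ∀ m, MeasurableSet (B m) := fun m =>
    measurableSet_Icc.inter (measurableSet_lt hvm measurable_const)
  have hBanti : Antitone B := by
    intro m n hmn u hu
    have h2 : v |u| < 1 / ((n : ℝ) + 1) := hu.2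
    exact ⟨hu.1, show v |u| < _ from
      h2.trans_le (one_div_le_one_div_of_le (by positivity) (by gcongr))⟩
  have hlim := tendsto_measure_iInter_atTop (μ := volume) (s := B)
    (fun m => (hB m).nullMeasurableSet) hBanti
    ⟨0, ((measure_mono inter_subset_left).trans_lt
      (by simp : volume (Icc (-(T + L)) (T + L)) < ⊤)).ne⟩
  have hinter : volume (⋂ m, B m) = 0 := by
    refine measure_mono_null (t := {0}) (fun u hu => ?_) (by simp)
    by_contra hne
    have hpos := hv.pos (abs_pos.2 hne)
    obtain ⟨m, hm⟩ := exists_nat_one_div_lt hpos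
    exact lt_asymm hm (mem_iInter.1 hu m).2
  rw [hinter] at hlim
  obtain ⟨m, hm⟩ := (hlim.eventually (gt_mem_nhds (ENNReal.half_pos hE0))).exists
  have hEr : 0 < (volume E).toReal := ENNReal.toReal_pos hE0 hEtop
  refine ⟨1 / ((m : ℝ) + 1) * ((volume E).toReal / 2), by positivity, fun t ht => ?_⟩
  have hpre : volume ((fun y => t - y) ⁻¹' B m) = volume (B m) :=
    (Measure.measurePreserving_sub_left volume t).measure_preimage (hB m).nullMeasurableSet
  have hpm : MeasurableSet ((fun y => t - y) ⁻¹' B m) := (hB m).preimage (by fun_prop)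
  have hvol : volume E / 2 ≤ volume (E \ (fun y => t - y) ⁻¹' B m) := by
    have h1 : volume E - volume ((fun y => t - y) ⁻¹' B m) ≤
        volume (E \ (fun y => t - y) ⁻¹' B m) := le_measure_sdiff
    refine le_trans ?_ h1
    rw [hpre]
    refine ENNReal.le_sub_of_add_le_right (ne_top_of_lt hm) ?_
    calc volume E / 2 + volume (B m) ≤ volume E / 2 + volume E / 2 := by gcongr; exact hm.le
      _ = volume E := ENNReal.add_halves _
  calc ENNReal.ofReal (1 / ((m : ℝ) + 1) * ((volume E).toReal / 2))
      = ENNReal.ofReal (1 / ((m : ℝ) + 1)) * (volume E / 2) := by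
        rw [ENNReal.ofReal_mul (by positivity), ENNReal.ofReal_div_of_pos two_pos,
          ENNReal.ofReal_toReal hEtop, ENNReal.ofReal_ofNat]
    _ ≤ ENNReal.ofReal (1 / ((m : ℝ) + 1)) * volume (E \ (fun y => t - y) ⁻¹' B m) := by gcongr
    _ = ∫⁻ _ in E \ (fun y => t - y) ⁻¹' B m, ENNReal.ofReal (1 / ((m : ℝ) + 1)) :=
        (setLIntegral_const _ _).symm
    _ ≤ ∫⁻ y in E \ (fun y => t - y) ⁻¹' B m, ENNReal.ofReal (v |t - y|) := by
        refine setLIntegral_mono' (hE.diff hpm) fun y hy => ENNReal.ofReal_le_ofReal ?_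
        by_contra! hlt
        refine hy.2 ⟨?_, hlt⟩
        have hyL := hEL hy.1
        have := abs_le.1 ht
        constructor <;> linarith [hyL.1, hyL.2]
    _ ≤ _ := lintegral_mono_set sdiff_subset

theorem TailClass.exists_le_setLIntegral (hα : 0 < α) (hc : 0 < c) (hv : TailClass α c v)
    {E : Set ℝ} {L : ℝ} (hE : MeasurableSet E) (hE0 : volume E ≠ 0) (hEL : E ⊆ Icc 0 L) :
    ∃ k : ℝ, 0 < k ∧ ∀ t : ℝ, ENNReal.ofReal (k * (1 + |t|) ^ (-1 - α)) ≤
      ∫⁻ y in E, ENNReal.ofReal (v |t - y|) := by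
  have hEtop : volume E ≠ ⊤ := ((measure_mono hEL).trans_lt (by simp)).ne
  have hEr : 0 < (volume E).toReal := ENNReal.toReal_pos hE0 hEtop
  have hL : 0 ≤ L := by
    obtain ⟨y, hy⟩ := nonempty_of_measure_ne_zero hE0
    exact (hEL hy).1.trans (hEL hy).2
  obtain ⟨k₁, R, hk₁, hR, h₁⟩ := hv.exists_ge hc
  obtain ⟨k₂, hk₂, h₂⟩ := hv.exists_le_setLIntegral_of_abs_le hE hE0 hEL (R + L)
  refine ⟨min k₂ (k₁ * (1 + L) ^ (-1 - α) * (volume E).toReal), by positivity, fun t => ?_⟩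
  have ht0 : 0 ≤ |t| := abs_nonneg t
  have hp : 0 < (1 + |t|) ^ (-1 - α) := Real.rpow_pos_of_pos (by linarith) _
  rcases le_or_gt |t| (R + L) with ht | ht
  · refine le_trans (ENNReal.ofReal_le_ofReal ?_) (h₂ t ht)
    calc _ ≤ k₂ * (1 + |t|) ^ (-1 - α) := by gcongr; exact min_le_left _ _
      _ ≤ k₂ * 1 := by
        gcongr
        exact Real.rpow_le_one_of_one_le_of_nonpos (by linarith) (by linarith)
      _ = k₂ := mul_one _
  · calc ENNReal.ofReal _ ≤ ENNReal.ofReal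
          (k₁ * ((1 + L) ^ (-1 - α) * (1 + |t|) ^ (-1 - α)) * (volume E).toReal) := by
          refine ENNReal.ofReal_le_ofReal ?_
          calc _ ≤ k₁ * (1 + L) ^ (-1 - α) * (volume E).toReal * (1 + |t|) ^ (-1 - α) := by
                gcongr; exact min_le_right _ _
            _ = _ := by ring
      _ = ENNReal.ofReal (k₁ * ((1 + L) * (1 + |t|)) ^ (-1 - α)) * volume E := by
          rw [Real.mul_rpow (by linarith) (by linarith), ENNReal.ofReal_mul (by positivity),
            ENNReal.ofReal_toReal hEtop]
      _ = ∫⁻ _ in E, ENNReal.ofReal (k₁ * ((1 + L) * (1 + |t|)) ^ (-1 - α)) :=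
          (setLIntegral_const _ _).symm
      _ ≤ _ := by
          refine setLIntegral_mono' hE fun y hy => ENNReal.ofReal_le_ofReal ?_
          have hyL := hEL hy
          have habs : |y| ≤ L := by rw [abs_of_nonneg hyL.1]; exact hyL.2
          have hge : R ≤ |t - y| := by have := abs_sub_abs_le_abs_sub t y; linarith
          refine le_trans ?_ (h₁ _ hge)
          refine mul_le_mul_of_nonneg_left ?_ hk₁.le
          refine Real.rpow_le_rpow_of_nonpos (by linarith) ?_ (by linarith)
          have := abs_sub t y
          nlinarith

end TailClass

namespace BranchType

theorem stepDensity_le (b : BranchType) {α c : ℝ} {v : ℝ → ℝ} (hv : TailClass α c v) (y : ℝ) :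
    b.stepDensity v y ≤ v |y| := by
  have h0 : ∀ z, z ≤ 0 → v z = 0 := by obtain ⟨-, C, -, -, -, -, h⟩ := hv; exact h
  cases b
  · simp only [stepDensity]
    rcases le_or_gt y 0 with h | h
    · rw [abs_of_nonpos h]
    · rw [h0 (-y) (by linarith)]; exact hv.nonneg _
  · simp only [stepDensity]
    linarith [hv.nonneg |y|]

theorem half_le_stepDensity (b : BranchType) {α c : ℝ} {v : ℝ → ℝ} (hv : TailClass α c v) {y : ℝ}
    (hy : y < 0) : 1 / 2 * v |y| ≤ b.stepDensity v y := by
  cases b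
  · simp only [stepDensity]
    rw [abs_of_neg hy]
    linarith [hv.nonneg (-y)]
  · exact le_rfl

end BranchType

namespace BranchWalk

variable {S : Type*} [Fintype S] {W : BranchWalk S} {ty : S → BranchType} {α c : S → ℝ}
  {v : S → ℝ → ℝ}

theorem HeavyTailed.w_le (hW : W.HeavyTailed ty α c v) (i : S) (y : ℝ) : W.w i y ≤ v i |y| := by
  rw [hW.2.2.2 i y]; exact (ty i).stepDensity_le (hW.tailClass i) y

theorem HeavyTailed.half_le_w (hW : W.HeavyTailed ty α c v) (i : S) {y : ℝ} (hy : y < 0) :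
    1 / 2 * v i |y| ≤ W.w i y := by
  rw [hW.2.2.2 i y]; exact (ty i).half_le_stepDensity (hW.tailClass i) hy

theorem HeavyTailed.w_pos (hW : W.HeavyTailed ty α c v) (i : S) {y : ℝ} (hy : y < 0) :
    0 < W.w i y := by
  have := hW.half_le_w i hy
  have := (hW.tailClass i).pos (abs_pos.2 hy.ne)
  linarith

variable [MeasurableSpace S] [DiscreteMeasurableSpace S]

theorem lintegral_kernel_eq_sum (W : BranchWalk S) (x : ℝ≥0) (i : S) {h : ℝ≥0 × S → ℝ≥0∞}
    (hh : Measurable h) : ∫⁻ s, h s ∂W.kernel (x, i) =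
      (∑ j, ENNReal.ofReal (W.p i j) *
        ∫⁻ z in Ioi 0, ENNReal.ofReal (W.w i (-z - x)) * h (z.toNNReal, j)) +
      ∫⁻ z in Ioi 0, ENNReal.ofReal (W.w i (z - x)) * h (z.toNNReal, i) := by
  have hw := (W.isProbDensity i).measurable
  have hw1 : Measurable fun z : ℝ => W.w i (-z - x) := hw.comp (by fun_prop)
  have hw2 : Measurable fun z : ℝ => W.w i (z - x) := hw.comp (by fun_prop)
  have hk : W.kernel (x, i) = (∑ j, ENNReal.ofReal (W.p i j) •
      onBranch (fun z => W.w i (-z - x)) j) + onBranch (fun z => W.w i (z - x)) i := rfl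
  rw [hk, lintegral_add_measure, lintegral_finsetSum_measure, lintegral_onBranch hw2 i hh]
  simp only [lintegral_smul_measure, smul_eq_mul, lintegral_onBranch hw1 _ hh,
    restrict_Ioi_eq_restrict_Ici]

theorem mul_lintegral_cross_le (W : BranchWalk S) (x : ℝ≥0) (i j : S) {h : ℝ≥0 × S → ℝ≥0∞}
    (hh : Measurable h) : ENNReal.ofReal (W.p i j) *
      ∫⁻ z in Ioi 0, ENNReal.ofReal (W.w i (-z - x)) * h (z.toNNReal, j) ≤
      ∫⁻ s, h s ∂W.kernel (x, i) := by
  rw [W.lintegral_kernel_eq_sum x i hh]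
  refine le_trans ?_ le_self_add
  exact Finset.single_le_sum (f := fun j => ENNReal.ofReal (W.p i j) *
      ∫⁻ z in Ioi 0, ENNReal.ofReal (W.w i (-z - x)) * h (z.toNNReal, j))
    (fun _ _ => zero_le) (Finset.mem_univ j)

theorem lintegral_stay_le (W : BranchWalk S) (x : ℝ≥0) (i : S) {h : ℝ≥0 × S → ℝ≥0∞}
    (hh : Measurable h) :
      ∫⁻ z in Ioi 0, ENNReal.ofReal (W.w i (z - x)) * h (z.toNNReal, i) ≤
      ∫⁻ s, h s ∂W.kernel (x, i) := by
  rw [W.lintegral_kernel_eq_sum x i hh]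
  exact le_add_self

end BranchWalk

/-- Tonelli's theorem: averaging the bound over starting points in `E` replaces the individual
densities by their average, which is bounded below by a multiple of `b`. -/
theorem lintegral_mul_lt_top_of_setLIntegral_le {E : Set ℝ} (hE : volume E ≠ ⊤)
    (hEm : MeasurableSet E) {w : ℝ → ℝ → ℝ≥0∞} (hw : Measurable (Function.uncurry w))
    {b g : ℝ → ℝ≥0∞} (hg : Measurable g) {κ : ℝ≥0∞} (hκ : κ ≠ 0) (hκ' : κ ≠ ⊤)
    (hb : ∀ z, 0 < z → κ * b z ≤ ∫⁻ y in E, w y z) {M : ℝ≥0∞}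
    (hM : M ≠ ⊤) (h : ∀ y ∈ E, ∫⁻ z in Ioi 0, w y z * g z ≤ M) :
    ∫⁻ z in Ioi 0, b z * g z < ⊤ := by
  have key : κ * ∫⁻ z in Ioi 0, b z * g z < ⊤ := by
    rw [← lintegral_const_mul' _ _ hκ']
    calc ∫⁻ z in Ioi 0, κ * (b z * g z) ≤ ∫⁻ z in Ioi 0, ∫⁻ y in E, w y z * g z := by
          refine setLIntegral_mono' measurableSet_Ioi fun z hz => ?_
          have hwz : Measurable fun y => w y z :=
            hw.comp (by fun_prop : Measurable fun y : ℝ => (y, z))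
          rw [lintegral_mul_const _ hwz, ← mul_assoc]
          gcongr
          exact hb z hz
      _ = ∫⁻ y in E, ∫⁻ z in Ioi 0, w y z * g z := by
          refine lintegral_lintegral_swap (Measurable.aemeasurable ?_)
          exact (hw.comp measurable_swap).mul (hg.comp measurable_fst)
      _ ≤ ∫⁻ _ in E, M := setLIntegral_mono' hEm h
      _ = M * volume E := setLIntegral_const _ _
      _ < ⊤ := ENNReal.mul_lt_top hM.lt_top hE.lt_top
  exact lt_top_iff_ne_top.2 fun h => by
    rw [h, ENNReal.mul_top hκ] at key; exact lt_irrefl _ key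

/-! ### Propagation of finiteness over all branches -/

namespace BranchWalk

variable {S : Type*} [Fintype S] {W : BranchWalk S} {ty : S → BranchType} {α c : S → ℝ}
  {v : S → ℝ → ℝ} [MeasurableSpace S] [DiscreteMeasurableSpace S]

/-- Above `a` the kernel turns survival up to `n` into survival up to `n + 1`, and the weights at
neighbouring indices differ by a factor of at most `2 ^ |r|`. -/
theorem lintegral_tsum_mul_survival_le (W : BranchWalk S) (r a : ℝ) {s : ℝ≥0 × S} (hs : a < s.1) :
    ∫⁻ s', ∑' n : ℕ, ENNReal.ofReal (((n : ℝ) + 1) ^ r) * W.survival a n s' ∂W.kernel s ≤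
      ENNReal.ofReal (2 ^ |r|) *
        ∑' n : ℕ, ENNReal.ofReal (((n : ℝ) + 1) ^ r) * W.survival a n s := by
  rw [lintegral_tsum fun n => ((W.measurable_survival a n).const_mul _).aemeasurable]
  have h1 : ∀ n : ℕ, ((n : ℝ) + 1) ^ r ≤ 2 ^ |r| * (((n + 1 : ℕ) : ℝ) + 1) ^ r := by
    intro n
    have hn : (0 : ℝ) ≤ n := n.cast_nonneg
    push_cast
    rcases le_or_gt 0 r with hr | hr
    · calc ((n : ℝ) + 1) ^ r ≤ ((n : ℝ) + 1 + 1) ^ r :=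
            Real.rpow_le_rpow (by linarith) (by linarith) hr
        _ ≤ _ := le_mul_of_one_le_left (by positivity)
            (Real.one_le_rpow one_le_two (abs_nonneg r))
    · calc ((n : ℝ) + 1) ^ r ≤ (2⁻¹ * ((n : ℝ) + 1 + 1)) ^ r :=
            Real.rpow_le_rpow_of_nonpos (by linarith) (by linarith) hr.le
        _ = _ := by
            rw [Real.mul_rpow (by norm_num) (by linarith), Real.inv_rpow (by norm_num),
              abs_of_neg hr, Real.rpow_neg (by norm_num)]
  calc ∑' n : ℕ, ∫⁻ s', ENNReal.ofReal (((n : ℝ) + 1) ^ r) * W.survival a n s' ∂W.kernel s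
      ≤ ∑' n : ℕ, ENNReal.ofReal (2 ^ |r|) * (ENNReal.ofReal ((((n + 1 : ℕ) : ℝ) + 1) ^ r) *
          W.survival a (n + 1) s) := by
        refine ENNReal.tsum_le_tsum fun n => ?_
        rw [lintegral_const_mul _ (W.measurable_survival a n), ← W.survival_succ_of_lt hs n,
          ← mul_assoc, ← ENNReal.ofReal_mul (by positivity)]
        gcongr
        exact h1 n
    _ = ENNReal.ofReal (2 ^ |r|) * ∑' n : ℕ, (ENNReal.ofReal ((((n + 1 : ℕ) : ℝ) + 1) ^ r) *
          W.survival a (n + 1) s) := ENNReal.tsum_mul_left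
    _ ≤ _ := by
        refine mul_le_mul_right ?_ _
        exact ENNReal.tsum_comp_le_tsum_of_injective (add_left_injective 1)
          (fun n : ℕ => ENNReal.ofReal (((n : ℝ) + 1) ^ r) * W.survival a n s)

section propagation

variable {a : ℝ} {C : ℝ≥0∞} {G : ℝ≥0 × S → ℝ≥0∞}

theorem HeavyTailed.ae_lt_top_of_p_pos (hW : W.HeavyTailed ty α c v) (hGm : Measurable G)
    (hC : C ≠ ⊤) (hG : ∀ s : ℝ≥0 × S, a < s.1 → ∫⁻ s', G s' ∂W.kernel s ≤ C * G s) {x : ℝ≥0}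
    {i j : S} (hx : a < x) (hxi : G (x, i) < ⊤) (hp : 0 < W.p i j) :
    ∀ᵐ z ∂volume.restrict (Ioi (0 : ℝ)), G (z.toNNReal, j) < ⊤ := by
  have hw := (W.isProbDensity i).measurable
  have hw1 : Measurable fun z : ℝ => W.w i (-z - x) := hw.comp (by fun_prop)
  have h1 := (W.mul_lintegral_cross_le x i j hGm).trans (hG (x, i) hx)
  have h2 : ∫⁻ z in Ioi 0, ENNReal.ofReal (W.w i (-z - x)) * G (z.toNNReal, j) ≠ ⊤ := by
    intro h
    rw [h, ENNReal.mul_top (by simpa using hp), top_le_iff] at h1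
    exact (ENNReal.mul_lt_top hC.lt_top hxi).ne h1
  have h3 := ae_lt_top (hw1.ennreal_ofReal.mul (hGm.comp (by fun_prop))) h2
  filter_upwards [h3, ae_restrict_mem measurableSet_Ioi] with z hz hz0
  have hz0 : 0 < z := hz0
  have hwz : 0 < W.w i (-z - x) := hW.w_pos i (by have := x.coe_nonneg; linarith)
  by_contra hcon
  have hcon : G (z.toNNReal, j) = ⊤ := not_lt_top_iff.1 hcon
  simp only [Function.comp, Pi.mul_apply, hcon] at hz
  rw [ENNReal.mul_top (by simpa using hwz)] at hz
  exact lt_irrefl _ hz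

theorem exists_lt_top_of_ae_lt_top {S : Type*} {a : ℝ} {G : ℝ≥0 × S → ℝ≥0∞} (ha : 0 ≤ a)
    {j : S} (h : ∀ᵐ z ∂volume.restrict (Ioi (0 : ℝ)), G (z.toNNReal, j) < ⊤) :
    ∃ y : ℝ≥0, a < y ∧ G (y, j) < ⊤ := by
  have h1 := ae_restrict_of_ae_restrict_of_subset (Ioi_subset_Ioi ha) h
  have : (ae (volume.restrict (Ioi a))).NeBot := by
    rw [ae_neBot]; simp [Measure.restrict_eq_zero]
  obtain ⟨z, hz, hza⟩ := (h1.and (ae_restrict_mem measurableSet_Ioi)).exists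
  exact ⟨z.toNNReal, by rw [Real.coe_toNNReal _ (ha.trans (le_of_lt hza))]; exact hza, hz⟩

/-- The density of crossing jumps is positive, so finiteness at one point above `a` spreads to
almost every point of each branch reachable by one crossing; irreducibility links all branches. -/
theorem HeavyTailed.ae_lt_top (hW : W.HeavyTailed ty α c v) (hGm : Measurable G) (ha : 0 ≤ a)
    (hC : C ≠ ⊤) (hG : ∀ s : ℝ≥0 × S, a < s.1 → ∫⁻ s', G s' ∂W.kernel s ≤ C * G s) {x : ℝ≥0}
    {i : S} (hx : a < x) (hxi : G (x, i) < ⊤) (j : S) :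
    ∀ᵐ z ∂volume.restrict (Ioi (0 : ℝ)), G (z.toNNReal, j) < ⊤ := by
  classical
  have key : ∀ n j, 0 < (W.p ^ n) i j → ∃ y : ℝ≥0, a < y ∧ G (y, j) < ⊤ := by
    intro n
    induction n with
    | zero =>
      intro j hj
      rw [pow_zero, Matrix.one_apply] at hj
      by_cases h : i = j
      · subst h; exact ⟨x, hx, hxi⟩
      · simp [h] at hj
    | succ n ih =>
      intro j hj
      rw [pow_succ, Matrix.mul_apply] at hj
      obtain ⟨l, -, hl⟩ := Finset.exists_lt_of_sum_lt (f := fun _ => (0 : ℝ)) (by simpa using hj)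
      have h1 := W.pow_p_nonneg n i l
      have h2 := W.irreducible.nonneg l j
      have h1' : 0 < (W.p ^ n) i l := h1.lt_of_ne fun h => by simp [← h] at hl
      have h2' : 0 < W.p l j := h2.lt_of_ne fun h => by simp [← h] at hl
      obtain ⟨y, hy, hyG⟩ := ih l h1'
      exact exists_lt_top_of_ae_lt_top ha (hW.ae_lt_top_of_p_pos hGm hC hG hy hyG h2')
  obtain ⟨l, hl⟩ := W.exists_p_pos j
  obtain ⟨n, -, hn⟩ := W.exists_pow_p_pos i l
  obtain ⟨y, hy, hyG⟩ := key n l hn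
  exact hW.ae_lt_top_of_p_pos hGm hC hG hy hyG hl

theorem exists_le_natCast_of_ae_lt_top {S : Type*} [MeasurableSpace S] {a : ℝ}
    {G : ℝ≥0 × S → ℝ≥0∞} (hGm : Measurable G) (ha : 0 ≤ a) {j : S}
    (h : ∀ᵐ z ∂volume.restrict (Ioi (0 : ℝ)), G (z.toNNReal, j) < ⊤) :
    ∃ (M : ℕ) (E : Set ℝ), MeasurableSet E ∧ volume E ≠ 0 ∧ E ⊆ Ioo a (a + 1) ∧
      ∀ z ∈ E, G (z.toNNReal, j) ≤ M := by
  have hm : Measurable fun z : ℝ => G (z.toNNReal, j) := hGm.comp (by fun_prop)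
  by_contra! hcon
  let E : ℕ → Set ℝ := fun M => Ioo a (a + 1) ∩ {z | G (z.toNNReal, j) ≤ M}
  have hE : ∀ M, volume (E M) = 0 := by
    intro M
    by_contra hne
    obtain ⟨z, hz, hz'⟩ := hcon M (E M)
      (measurableSet_Ioo.inter (measurableSet_le hm measurable_const)) hne inter_subset_left
    exact absurd hz.2 (not_le.2 hz')
  have hU : volume (⋃ M, E M) = 0 := measure_iUnion_null hE
  have h1 := ae_restrict_of_ae_restrict_of_subset
    (show Ioo a (a + 1) ⊆ Ioi 0 from fun z hz => ha.trans_lt hz.1) h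
  rw [ae_restrict_iff' measurableSet_Ioo] at h1
  have h2 : ∀ᵐ z, z ∉ ⋃ M, E M := measure_eq_zero_iff_ae_notMem.1 hU
  have h3 : volume (Ioo a (a + 1)) = 0 := by
    rw [measure_eq_zero_iff_ae_notMem]
    filter_upwards [h1, h2] with z hz hz2 hmem
    obtain ⟨M, hM⟩ := ENNReal.exists_nat_gt (hz hmem).ne
    exact hz2 (mem_iUnion.2 ⟨M, hmem, hM.le⟩)
  simp at h3

/-- `G` is bounded on a set of starting points of positive measure on branch `j`, and the density of
crossing jumps averaged over that set has a lower bound of order `(1 + z) ^ (-1 - α j)`. -/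
theorem HeavyTailed.lintegral_rpow_mul_lt_top_of_p_pos (hW : W.HeavyTailed ty α c v)
    (hGm : Measurable G) (ha : 0 ≤ a) (hC : C ≠ ⊤)
    (hG : ∀ s : ℝ≥0 × S, a < s.1 → ∫⁻ s', G s' ∂W.kernel s ≤ C * G s) {j k : S}
    (hj : ∀ᵐ z ∂volume.restrict (Ioi (0 : ℝ)), G (z.toNNReal, j) < ⊤) (hp : 0 < W.p j k) :
    ∫⁻ z in Ioi 0, ENNReal.ofReal ((1 + z) ^ (-1 - α j)) * G (z.toNNReal, k) < ⊤ := by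
  obtain ⟨M, E, hE, hE0, hEa, hEM⟩ := exists_le_natCast_of_ae_lt_top hGm ha hj
  have hEL : E ⊆ Icc 0 (a + 1) := fun z hz => ⟨ha.trans (hEa hz).1.le, (hEa hz).2.le⟩
  have hEtop : volume E ≠ ⊤ := ((measure_mono hEL).trans_lt (by simp)).ne
  obtain ⟨κ, hκ, hκE⟩ := (hW.tailClass j).exists_le_setLIntegral (hW.alpha_pos j) (hW.c_pos j)
    hE hE0 hEL
  have hw := (W.isProbDensity j).measurable
  have hm : Measurable fun z : ℝ => G (z.toNNReal, k) := hGm.comp (by fun_prop)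
  refine lintegral_mul_lt_top_of_setLIntegral_le hEtop hE
    (w := fun y z => ENNReal.ofReal (W.w j (-z - y)))
    (hw.comp (by fun_prop : Measurable fun q : ℝ × ℝ => -q.2 - q.1)).ennreal_ofReal hm
    (κ := ENNReal.ofReal (κ / 2)) (by simpa using hκ) (by finiteness) ?_
    (M := C * M / ENNReal.ofReal (W.p j k))
    (ENNReal.div_ne_top (by finiteness) (by simpa using hp)) ?_
  · intro z hz
    have h1 := hκE (-z)
    rw [abs_neg, abs_of_pos hz] at h1
    have hvm : Measurable fun y : ℝ => ENNReal.ofReal (v j |-z - y|) :=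
      ((hW.tailClass j).measurable.comp (by fun_prop)).ennreal_ofReal
    calc ENNReal.ofReal (κ / 2) * ENNReal.ofReal ((1 + z) ^ (-1 - α j))
        = ENNReal.ofReal (1 / 2) * ENNReal.ofReal (κ * (1 + z) ^ (-1 - α j)) := by
          rw [← ENNReal.ofReal_mul (by positivity), ← ENNReal.ofReal_mul (by norm_num)]; ring_nf
      _ ≤ ENNReal.ofReal (1 / 2) * ∫⁻ y in E, ENNReal.ofReal (v j |-z - y|) := by gcongr
      _ = ∫⁻ y in E, ENNReal.ofReal (1 / 2) * ENNReal.ofReal (v j |-z - y|) :=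
          (lintegral_const_mul _ hvm).symm
      _ ≤ _ := by
          refine setLIntegral_mono' hE fun y hy => ?_
          rw [← ENNReal.ofReal_mul (by norm_num)]
          exact ENNReal.ofReal_le_ofReal (hW.half_le_w j (by linarith [(hEL hy).1]))
  · intro y hy
    have hy0 : 0 ≤ y := (hEL hy).1
    rw [ENNReal.le_div_iff_mul_le (Or.inl (by simpa using hp)) (Or.inl (by finiteness)), mul_comm]
    have h1 := W.mul_lintegral_cross_le y.toNNReal j k hGm
    rw [Real.coe_toNNReal _ hy0] at h1
    refine h1.trans ((hG _ ?_).trans ?_)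
    · simpa [Real.coe_toNNReal _ hy0] using (hEa hy).1
    · gcongr; exact hEM y hy

theorem HeavyTailed.lintegral_rpow_mul_lt_top_of_symmetric (hW : W.HeavyTailed ty α c v)
    (hGm : Measurable G) (ha : 0 ≤ a) (hC : C ≠ ⊤)
    (hG : ∀ s : ℝ≥0 × S, a < s.1 → ∫⁻ s', G s' ∂W.kernel s ≤ C * G s) {k : S}
    (hk : ∀ᵐ z ∂volume.restrict (Ioi (0 : ℝ)), G (z.toNNReal, k) < ⊤)
    (hty : ty k = .symmetric) :
    ∫⁻ z in Ioi 0, ENNReal.ofReal ((1 + z) ^ (-1 - α k)) * G (z.toNNReal, k) < ⊤ := by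
  obtain ⟨M, E, hE, hE0, hEa, hEM⟩ := exists_le_natCast_of_ae_lt_top hGm ha hk
  have hEL : E ⊆ Icc 0 (a + 1) := fun z hz => ⟨ha.trans (hEa hz).1.le, (hEa hz).2.le⟩
  have hEtop : volume E ≠ ⊤ := ((measure_mono hEL).trans_lt (by simp)).ne
  obtain ⟨κ, hκ, hκE⟩ := (hW.tailClass k).exists_le_setLIntegral (hW.alpha_pos k) (hW.c_pos k)
    hE hE0 hEL
  have hw := (W.isProbDensity k).measurable
  have hm : Measurable fun z : ℝ => G (z.toNNReal, k) := hGm.comp (by fun_prop)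
  refine lintegral_mul_lt_top_of_setLIntegral_le hEtop hE
    (w := fun y z => ENNReal.ofReal (W.w k (z - y)))
    (hw.comp (by fun_prop : Measurable fun q : ℝ × ℝ => q.2 - q.1)).ennreal_ofReal hm
    (κ := ENNReal.ofReal (κ / 2)) (by simpa using hκ) (by finiteness) ?_
    (M := C * M) (by finiteness) ?_
  · intro z hz
    have h1 := hκE z
    rw [abs_of_pos hz] at h1
    have hvm : Measurable fun y : ℝ => ENNReal.ofReal (v k |z - y|) :=
      ((hW.tailClass k).measurable.comp (by fun_prop)).ennreal_ofReal
    calc ENNReal.ofReal (κ / 2) * ENNReal.ofReal ((1 + z) ^ (-1 - α k))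
        = ENNReal.ofReal (1 / 2) * ENNReal.ofReal (κ * (1 + z) ^ (-1 - α k)) := by
          rw [← ENNReal.ofReal_mul (by positivity), ← ENNReal.ofReal_mul (by norm_num)]; ring_nf
      _ ≤ ENNReal.ofReal (1 / 2) * ∫⁻ y in E, ENNReal.ofReal (v k |z - y|) := by gcongr
      _ = ∫⁻ y in E, ENNReal.ofReal (1 / 2) * ENNReal.ofReal (v k |z - y|) :=
          (lintegral_const_mul _ hvm).symm
      _ = _ := by
          refine setLIntegral_congr_fun hE fun y hy => ?_
          simp only [hW.2.2.2 k, hty, BranchType.stepDensity]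
          rw [← ENNReal.ofReal_mul (by norm_num)]
  · intro y hy
    have hy0 : 0 ≤ y := (hEL hy).1
    have h1 := W.lintegral_stay_le y.toNNReal k hGm
    rw [Real.coe_toNNReal _ hy0] at h1
    refine h1.trans ((hG _ ?_).trans ?_)
    · simpa [Real.coe_toNNReal _ hy0] using (hEa hy).1
    · gcongr; exact hEM y hy

end propagation

end BranchWalk

/-! ### Separating short and long jumps -/

namespace BranchWalk

variable {S : Type*} [Fintype S] {W : BranchWalk S} {ty : S → BranchType} {α c : S → ℝ}
  {v : S → ℝ → ℝ}

/-- The dependence on the start becomes a polynomial factor. On a one-sided branch, positions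
reached without crossing lie below `x`, so any exponent `γ` is possible there. This freedom is
needed because `G` on such a branch is only known to be integrable with exponents of branches
leading into it. -/
theorem HeavyTailed.exists_w_sub_le (hW : W.HeavyTailed ty α c v) (i : S) {γ : ℝ} (hγ : 0 < γ)
    (hty : ty i = .symmetric → γ = α i) :
    ∃ K M : ℝ, 0 ≤ K ∧ 0 ≤ M ∧ ∀ x z : ℝ, 0 ≤ x → 1 < |z - x| →
      W.w i (z - x) ≤ K * (1 + x) ^ M * (1 + |z|) ^ (-1 - if z < 0 then α i else γ) := by
  obtain ⟨K, hK, hle⟩ := (hW.tailClass i).exists_le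
  have hα := hW.alpha_pos i
  refine ⟨K * 2 ^ (1 + α i), 1 + (α i + γ), by positivity, by positivity, fun x z hx hxz => ?_⟩
  have hz0 : 0 ≤ |z| := abs_nonneg z
  have hvle : v i |z - x| ≤ K * |z - x| ^ (-1 - α i) := hle _ (by linarith)
  have hscale : ∀ {D β : ℝ}, 0 < D → 0 < β → 1 + |z| ≤ D * |z - x| →
      |z - x| ^ (-1 - β) ≤ D ^ (1 + β) * (1 + |z|) ^ (-1 - β) := by
    intro D β hD hβ h
    calc |z - x| ^ (-1 - β) ≤ ((1 + |z|) / D) ^ (-1 - β) := by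
          refine Real.rpow_le_rpow_of_nonpos (by positivity) ?_ (by linarith)
          rw [div_le_iff₀ hD]; linarith
      _ = _ := by
          rw [Real.div_rpow (by positivity) hD.le, div_eq_mul_inv, ← Real.rpow_neg hD.le, mul_comm]
          ring_nf
  have h2 : (1 : ℝ) ≤ 2 ^ (1 + α i) := Real.one_le_rpow one_le_two (by linarith)
  have hx1 : (1 : ℝ) ≤ (1 + x) ^ (1 + (α i + γ)) := Real.one_le_rpow (by linarith) (by linarith)
  rcases lt_or_ge z 0 with hz | hz
  · rw [if_pos hz]
    have habs : |z - x| = |z| + x := by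
      rw [abs_of_neg hz, abs_of_neg (by linarith)]; ring
    calc W.w i (z - x) ≤ K * |z - x| ^ (-1 - α i) := (hW.w_le i _).trans hvle
      _ ≤ K * (2 ^ (1 + α i) * (1 + |z|) ^ (-1 - α i)) := by
          gcongr
          exact hscale two_pos hα (by linarith)
      _ = K * 2 ^ (1 + α i) * 1 * (1 + |z|) ^ (-1 - α i) := by ring
      _ ≤ _ := by gcongr
  · rw [if_neg (not_lt.2 hz)]
    rw [abs_of_nonneg hz] at *
    cases hti : ty i
    · rcases le_or_gt x z with hxz' | hxz'
      · rw [hW.2.2.2 i, hti]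
        simp only [BranchType.stepDensity]
        obtain ⟨-, C, -, -, -, -, h0⟩ := hW.tailClass i
        rw [h0 _ (by linarith)]
        positivity
      · calc W.w i (z - x) ≤ K * |z - x| ^ (-1 - α i) := (hW.w_le i _).trans hvle
          _ ≤ K * 1 := by
              gcongr
              exact Real.rpow_le_one_of_one_le_of_nonpos hxz.le (by linarith)
          _ ≤ K * ((1 + x) ^ (1 + γ) * (1 + z) ^ (-1 - γ)) := by
              gcongr
              calc (1 : ℝ) = (1 + z) ^ (1 + γ) * (1 + z) ^ (-1 - γ) := by
                    rw [← Real.rpow_add (by linarith)]; simp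
                _ ≤ _ := by gcongr
          _ = K * 1 * (1 + x) ^ (1 + γ) * (1 + z) ^ (-1 - γ) := by ring
          _ ≤ _ := by
              gcongr <;> linarith
    · rw [hty hti]
      have hD : 1 + z ≤ 2 * (1 + x) * |z - x| := by
        have := le_abs_self (z - x)
        nlinarith
      calc W.w i (z - x) ≤ K * |z - x| ^ (-1 - α i) := (hW.w_le i _).trans hvle
        _ ≤ K * ((2 * (1 + x)) ^ (1 + α i) * (1 + z) ^ (-1 - α i)) := by
            gcongr
            exact hscale (by positivity) hα hD
        _ = K * 2 ^ (1 + α i) * (1 + x) ^ (1 + α i) * (1 + z) ^ (-1 - α i) := by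
            rw [Real.mul_rpow (by norm_num) (by positivity)]; ring
        _ ≤ _ := by
            gcongr <;> linarith

/-- The integral, against a power weight on the branches reachable from `i`, that dominates the
contribution of jumps of size at least `1`. -/
noncomputable def weighted (W : BranchWalk S) (β γ : ℝ) (i : S) (h : ℝ≥0 × S → ℝ≥0∞) : ℝ≥0∞ :=
  (∑ j, ENNReal.ofReal (W.p i j) *
    ∫⁻ z in Ioi 0, ENNReal.ofReal ((1 + z) ^ (-1 - β)) * h (z.toNNReal, j)) +
  ∫⁻ z in Ioi 0, ENNReal.ofReal ((1 + z) ^ (-1 - γ)) * h (z.toNNReal, i)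

theorem HeavyTailed.exists_setLIntegral_w_le [Nonempty S] (hW : W.HeavyTailed ty α c v) :
    ∃ ρ : ℝ, 0 ≤ ρ ∧ ρ < 1 ∧
      ∀ i, ∫⁻ y in {y | |y| ≤ 1}, ENNReal.ofReal (W.w i y) ≤ ENNReal.ofReal ρ := by
  have hA : MeasurableSet {y : ℝ | |y| ≤ 1} := measurableSet_le (by fun_prop) measurable_const
  have hlt : ∀ i, ∫⁻ y in {y | |y| ≤ 1}, ENNReal.ofReal (W.w i y) < 1 := by
    intro i
    have hwm := (W.isProbDensity i).measurable
    have h1 := (W.isProbDensity i).lintegral_eq_one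
    rw [← lintegral_add_compl _ hA] at h1
    have hpos : 0 < ∫⁻ y in {y | |y| ≤ 1}ᶜ, ENNReal.ofReal (W.w i y) := by
      refine lt_of_lt_of_le ?_ (lintegral_mono_set (show Iio (-1) ⊆ {y : ℝ | |y| ≤ 1}ᶜ from
        fun y hy => ?_))
      · rw [setLIntegral_pos_iff hwm.ennreal_ofReal]
        have : Function.support (fun y => ENNReal.ofReal (W.w i y)) ∩ Iio (-1) = Iio (-1) := by
          refine inter_eq_right.2 fun y hy => ?_
          have hy : y < -1 := hy
          simpa using hW.w_pos i (by linarith : y < 0)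
        rw [this]; simp
      · have hy : y < -1 := hy
        simp only [mem_compl_iff, mem_ofPred_eq, not_le]
        rw [abs_of_neg (by linarith)]; linarith
    rw [← h1]
    refine ENNReal.lt_add_right (fun h => ?_) hpos.ne'
    rw [h] at h1; simp at h1
  obtain ⟨i₀, hi₀⟩ := Finite.exists_max fun i => ∫⁻ y in {y | |y| ≤ 1}, ENNReal.ofReal (W.w i y)
  refine ⟨(∫⁻ y in {y | |y| ≤ 1}, ENNReal.ofReal (W.w i₀ y)).toReal, ENNReal.toReal_nonneg, ?_, ?_⟩
  · have := (ENNReal.toReal_lt_toReal (hlt i₀).ne_top ENNReal.one_ne_top).2 (hlt i₀)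
    simpa using this
  · intro i
    rw [ENNReal.ofReal_toReal (hlt i₀).ne_top]
    exact hi₀ i

variable [MeasurableSpace S]

theorem lintegral_rpow_mul_landing (W : BranchWalk S) (β γ : ℝ) (i : S) {h : ℝ≥0 × S → ℝ≥0∞}
    (hh : Measurable h) :
    ∫⁻ z : ℝ, ENNReal.ofReal ((1 + |z|) ^ (-1 - if z < 0 then β else γ)) * W.landing i h z =
      W.weighted β γ i h := by
  have hm : ∀ j, Measurable fun z : ℝ => h (z.toNNReal, j) := fun j => hh.comp (by fun_prop)
  have hr : ∀ δ : ℝ, Measurable fun z : ℝ => ENNReal.ofReal ((1 + z) ^ (-1 - δ)) := by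
    intro δ; fun_prop
  rw [lintegral_eq_Ici_add_Ioi_neg, ← restrict_Ioi_eq_restrict_Ici, add_comm, weighted]
  congr 1
  · have hm2 : ∀ j, Measurable fun z : ℝ =>
        ENNReal.ofReal ((1 + z) ^ (-1 - β)) * h (z.toNNReal, j) := fun j => (hr β).mul (hm j)
    have h1 : ∀ j, ENNReal.ofReal (W.p i j) *
        ∫⁻ z in Ioi 0, ENNReal.ofReal ((1 + z) ^ (-1 - β)) * h (z.toNNReal, j) =
        ∫⁻ z in Ioi 0, ENNReal.ofReal (W.p i j) *
          (ENNReal.ofReal ((1 + z) ^ (-1 - β)) * h (z.toNNReal, j)) := fun j =>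
      (lintegral_const_mul _ (hm2 j)).symm
    simp only [h1]
    rw [← lintegral_finsetSum _ fun j _ => (hm2 j).const_mul _]
    refine setLIntegral_congr_fun measurableSet_Ioi fun z hz => ?_
    have hz : 0 < z := hz
    have hz' : -z < 0 := neg_lt_zero.2 hz
    simp only [W.landing_of_neg i h hz', neg_neg, Finset.mul_sum, abs_neg, abs_of_pos hz,
      if_pos hz']
    exact Finset.sum_congr rfl fun j _ => mul_left_comm _ _ _
  · refine setLIntegral_congr_fun measurableSet_Ioi fun z hz => ?_
    have hz : 0 < z := hz
    simp only [W.landing_of_nonneg i h hz.le, abs_of_pos hz, if_neg (not_lt.2 hz.le)]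

variable [DiscreteMeasurableSpace S]

/-- Jumps of size at most `1`, whose density may be unbounded near the origin, are charged to the
supremum of `h` up to height `x + 1`; for longer jumps the power bound on the density applies. -/
theorem lintegral_kernel_le_add_weighted (W : BranchWalk S) {i : S} {β γ K M : ℝ} (hK : 0 ≤ K)
    (hw : ∀ x z : ℝ, 0 ≤ x → 1 < |z - x| →
      W.w i (z - x) ≤ K * (1 + x) ^ M * (1 + |z|) ^ (-1 - if z < 0 then β else γ))
    {h : ℝ≥0 × S → ℝ≥0∞} (hh : Measurable h) (x : ℝ≥0) {b : ℝ≥0∞}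
    (hb : ∀ s : ℝ≥0 × S, (s.1 : ℝ) ≤ x + 1 → h s ≤ b) :
    ∫⁻ s, h s ∂W.kernel (x, i) ≤ (∫⁻ y in {y | |y| ≤ 1}, ENNReal.ofReal (W.w i y)) * b +
      ENNReal.ofReal (K * (1 + x) ^ M) * W.weighted β γ i h := by
  have hx : (0 : ℝ) ≤ x := x.coe_nonneg
  have hwm := (W.isProbDensity i).measurable
  have hA : MeasurableSet {y : ℝ | |y| ≤ 1} := measurableSet_le (by fun_prop) measurable_const
  rw [W.lintegral_kernel x i hh, ← lintegral_add_compl _ hA]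
  gcongr
  · rw [← lintegral_mul_const _ hwm.ennreal_ofReal]
    refine setLIntegral_mono' hA fun y hy => ?_
    gcongr
    refine W.landing_le i fun j => hb _ ?_
    rw [Real.coe_toNNReal _ (abs_nonneg _)]
    calc |(x : ℝ) + y| ≤ |(x : ℝ)| + |y| := abs_add_le _ _
      _ ≤ x + 1 := by rw [abs_of_nonneg hx]; gcongr; exact hy
  · rw [← W.lintegral_rpow_mul_landing β γ i hh, ← lintegral_const_mul' _ _ ENNReal.ofReal_ne_top,
      ← lintegral_add_left_eq_self (fun z => ENNReal.ofReal (K * (1 + (x : ℝ)) ^ M) *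
        (ENNReal.ofReal ((1 + |z|) ^ (-1 - if z < 0 then β else γ)) * W.landing i h z)) (x : ℝ)]
    refine le_trans (setLIntegral_mono' hA.compl fun y hy => ?_) (setLIntegral_le_lintegral _ _)
    have hy1 : 1 < |y| := not_le.1 hy
    have := hw x (x + y) hx (by simpa using hy1)
    rw [← mul_assoc, ← ENNReal.ofReal_mul (by positivity)]
    gcongr
    simpa using this

end BranchWalk

namespace BranchWalk

variable {S : Type*} [Fintype S] {W : BranchWalk S} {ty : S → BranchType} {α c : S → ℝ}
  {v : S → ℝ → ℝ}

theorem weighted_le (W : BranchWalk S) (β γ : ℝ) (i : S) {h G : ℝ≥0 × S → ℝ≥0∞} {b : ℝ≥0∞}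
    (hb : b ≠ ⊤) (hle : ∀ s, h s ≤ b * G s) : W.weighted β γ i h ≤ b * W.weighted β γ i G := by
  have h1 : ∀ (δ : ℝ) (j : S),
      ∫⁻ z in Ioi 0, ENNReal.ofReal ((1 + z) ^ (-1 - δ)) * h (z.toNNReal, j) ≤
      b * ∫⁻ z in Ioi 0, ENNReal.ofReal ((1 + z) ^ (-1 - δ)) * G (z.toNNReal, j) := by
    intro δ j
    rw [← lintegral_const_mul' _ _ hb]
    refine lintegral_mono fun z => ?_
    rw [mul_left_comm]
    gcongr
    exact hle _
  unfold weighted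
  rw [mul_add, Finset.mul_sum]
  refine add_le_add (Finset.sum_le_sum fun j _ => ?_) (h1 _ _)
  rw [mul_left_comm]
  exact mul_le_mul_right (h1 _ _) _

theorem weighted_lt_top (W : BranchWalk S) {β γ : ℝ} {i : S} {G : ℝ≥0 × S → ℝ≥0∞}
    (h1 : ∀ j, 0 < W.p i j →
      ∫⁻ z in Ioi 0, ENNReal.ofReal ((1 + z) ^ (-1 - β)) * G (z.toNNReal, j) < ⊤)
    (h2 : ∫⁻ z in Ioi 0, ENNReal.ofReal ((1 + z) ^ (-1 - γ)) * G (z.toNNReal, i) < ⊤) :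
    W.weighted β γ i G < ⊤ := by
  refine ENNReal.add_lt_top.2 ⟨ENNReal.sum_lt_top.2 fun j _ => ?_, h2⟩
  rcases (W.irreducible.nonneg i j).eq_or_lt with h | h
  · rw [← h]; simp
  · exact ENNReal.mul_lt_top ENNReal.ofReal_lt_top (h1 j h)

end BranchWalk

theorem exists_one_add_rpow_le_exp {ε M : ℝ} (hε : 0 < ε) (hM : 0 < M) :
    ∃ D, 0 ≤ D ∧ ∀ x : ℝ, 0 ≤ x → (1 + x) ^ M ≤ D * Real.exp (ε * x) := by
  refine ⟨(max 1 (M / ε)) ^ M, by positivity, fun x hx => ?_⟩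
  have h1 : 1 + x ≤ max 1 (M / ε) * Real.exp (ε / M * x) := by
    have h2 := Real.add_one_le_exp (ε / M * x)
    calc 1 + x = 1 + M / ε * (ε / M * x) := by field_simp
      _ ≤ max 1 (M / ε) * 1 + max 1 (M / ε) * (ε / M * x) := by
        gcongr
        · rw [mul_one]; exact le_max_left _ _
        · exact le_max_right _ _
      _ = max 1 (M / ε) * (ε / M * x + 1) := by ring
      _ ≤ _ := by gcongr
  calc (1 + x) ^ M ≤ (max 1 (M / ε) * Real.exp (ε / M * x)) ^ M := by gcongr
    _ = _ := by
      rw [Real.mul_rpow (by positivity) (by positivity), ← Real.exp_mul]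
      congr 2
      field_simp

theorem tendsto_succ_div_succ_rpow (q : ℝ) :
    Tendsto (fun n : ℕ => (((n : ℝ) + 1) / ((n : ℝ) + 2)) ^ q) atTop (𝓝 1) := by
  have h1 : Tendsto (fun n : ℕ => ((n : ℝ) + 1) / ((n : ℝ) + 2)) atTop (𝓝 1) := by
    have h2 : Tendsto (fun n : ℕ => 1 - 1 / ((n : ℝ) + 2)) atTop (𝓝 (1 - 0)) := by
      refine tendsto_const_nhds.sub ?_
      refine Tendsto.const_div_atTop ?_ _
      exact tendsto_atTop_add_const_right _ _ tendsto_natCast_atTop_atTop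
    rw [sub_zero] at h2
    refine h2.congr fun n => ?_
    field_simp
    ring
  simpa using h1.rpow_const (p := q) (Or.inl one_ne_zero)

/-! ### Survival decay from every starting point -/

namespace BranchWalk

variable {S : Type*} [Fintype S] {W : BranchWalk S} {ty : S → BranchType} {α c : S → ℝ}
  {v : S → ℝ → ℝ} [MeasurableSpace S] [DiscreteMeasurableSpace S]

/-- Moving up by `1` costs a factor `exp ε`, which the short-jump mass absorbs since `ρ * exp ε <
1`; the exponential also dominates the polynomial factor of the long jumps. The bound on the kernel
integral is kept because at starts below the level `survival` vanishes but its integral need not. -/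
theorem exists_le_exp_mul_rpow {u : ℕ → ℝ≥0 × S → ℝ≥0∞} (hu : ∀ n s, u n s ≤ 1)
    (hsucc : ∀ n s, u (n + 1) s ≤ ∫⁻ s', u n s' ∂W.kernel s) {ρ K M q : ℝ} (hρ0 : 0 ≤ ρ)
    (hρ : ρ < 1) (hK : 0 ≤ K) (hM : 0 < M) (hq : 0 < q)
    (hstep : ∀ (n : ℕ) (x : ℝ≥0) (i : S) (b : ℝ≥0∞),
      (∀ s : ℝ≥0 × S, (s.1 : ℝ) ≤ x + 1 → u n s ≤ b) → ∫⁻ s, u n s ∂W.kernel (x, i) ≤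
        ENNReal.ofReal ρ * b + ENNReal.ofReal (K * (1 + x) ^ M * ((n : ℝ) + 1) ^ (-q))) :
    ∃ B ε : ℝ, ∀ (n : ℕ) (s : ℝ≥0 × S),
      u n s ≤ ENNReal.ofReal (B * Real.exp (ε * s.1) * ((n : ℝ) + 1) ^ (-q)) ∧
      ∫⁻ s', u n s' ∂W.kernel s ≤
        ENNReal.ofReal (B * Real.exp (ε * s.1) * ((n : ℝ) + 1) ^ (-q)) := by
  obtain ⟨ε, hε, hρε⟩ : ∃ ε : ℝ, 0 < ε ∧ ρ * Real.exp ε < 1 := by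
    have h1 : Tendsto (fun ε : ℝ => ρ * Real.exp ε) (𝓝[>] 0) (𝓝 (ρ * Real.exp 0)) :=
      ((by fun_prop : Continuous fun ε : ℝ => ρ * Real.exp ε).tendsto 0).mono_left
        nhdsWithin_le_nhds
    rw [Real.exp_zero, mul_one] at h1
    obtain ⟨ε, h, h'⟩ := ((h1.eventually (gt_mem_nhds hρ)).and self_mem_nhdsWithin).exists
    exact ⟨ε, h', h⟩
  set σ := ρ * Real.exp ε with hσ
  have hσ0 : 0 ≤ σ := by positivity
  obtain ⟨D, hD, hDle⟩ := exists_one_add_rpow_le_exp hε hM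
  obtain ⟨n₀, hn₀⟩ := eventually_atTop.1
    ((tendsto_succ_div_succ_rpow q).eventually (lt_mem_nhds (show (1 + σ) / 2 < 1 by linarith)))
  -- The first entry makes the bound trivial up to time `n₀`. The second leaves a factor `(1 + σ) /
  -- 2` after one step, which past `n₀` pays for replacing `n + 1` by `n + 2`.
  set B := max (((n₀ : ℝ) + 1) ^ q) (K * D * (2 / (1 - σ))) with hB
  have hB0 : 0 < B := lt_max_of_lt_left (by positivity)
  have hBσ : σ * B + K * D ≤ (1 + σ) / 2 * B := by
    have h1 : K * D * (2 / (1 - σ)) ≤ B := le_max_right _ _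
    rw [← mul_div_assoc, div_le_iff₀ (by linarith)] at h1
    linarith
  have hint : ∀ n : ℕ, (∀ s : ℝ≥0 × S,
      u n s ≤ ENNReal.ofReal (B * Real.exp (ε * s.1) * ((n : ℝ) + 1) ^ (-q))) → ∀ s : ℝ≥0 × S,
      ∫⁻ s', u n s' ∂W.kernel s ≤
        ENNReal.ofReal ((1 + σ) / 2 * B * Real.exp (ε * s.1) * ((n : ℝ) + 1) ^ (-q)) := by
    rintro n hn ⟨x, i⟩
    have hx : (0 : ℝ) ≤ x := x.coe_nonneg
    refine (hstep n x i (ENNReal.ofReal (B * Real.exp (ε * (x + 1)) * ((n : ℝ) + 1) ^ (-q)))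
      fun s hs => (hn s).trans (ENNReal.ofReal_le_ofReal (by gcongr))).trans ?_
    rw [← ENNReal.ofReal_mul hρ0, ← ENNReal.ofReal_add (by positivity) (by positivity)]
    refine ENNReal.ofReal_le_ofReal ?_
    calc ρ * (B * Real.exp (ε * (x + 1)) * ((n : ℝ) + 1) ^ (-q)) +
          K * (1 + x) ^ M * ((n : ℝ) + 1) ^ (-q)
        ≤ ρ * (B * Real.exp (ε * (x + 1)) * ((n : ℝ) + 1) ^ (-q)) +
          K * (D * Real.exp (ε * x)) * ((n : ℝ) + 1) ^ (-q) := by gcongr; exact hDle x hx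
      _ = (σ * B + K * D) * Real.exp (ε * x) * ((n : ℝ) + 1) ^ (-q) := by
          rw [mul_add, Real.exp_add, mul_one, hσ]; ring
      _ ≤ _ := by gcongr
  have hall : ∀ (n : ℕ) (s : ℝ≥0 × S),
      u n s ≤ ENNReal.ofReal (B * Real.exp (ε * s.1) * ((n : ℝ) + 1) ^ (-q)) := by
    have hsmall : ∀ (n : ℕ) (s : ℝ≥0 × S), n ≤ n₀ →
        u n s ≤ ENNReal.ofReal (B * Real.exp (ε * s.1) * ((n : ℝ) + 1) ^ (-q)) := by
      intro n s hn
      refine (hu n s).trans (ENNReal.one_le_ofReal.2 ?_)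
      have hx : (0 : ℝ) ≤ s.1 := s.1.coe_nonneg
      calc (1 : ℝ) = ((n : ℝ) + 1) ^ q * 1 * ((n : ℝ) + 1) ^ (-q) := by
            rw [mul_one, ← Real.rpow_add (by positivity)]; simp
        _ ≤ _ := by
            gcongr
            · exact (le_max_left _ _).trans' (by gcongr)
            · exact Real.one_le_exp (by positivity)
    intro n
    induction n with
    | zero => exact fun s => hsmall 0 s (Nat.zero_le _)
    | succ n ih =>
      intro s
      rcases le_or_gt (n + 1) n₀ with h | h
      · exact hsmall _ s h
      · refine ((hsucc n s).trans (hint n ih s)).trans (ENNReal.ofReal_le_ofReal ?_)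
        have h1 := (hn₀ n (by omega)).le
        have h2 : ((n : ℝ) + 1) ^ (-q) * (((n : ℝ) + 1) / ((n : ℝ) + 2)) ^ q =
            ((n : ℝ) + 2) ^ (-q) := by
          rw [Real.div_rpow (by positivity) (by positivity), ← mul_div_assoc,
            ← Real.rpow_add (by positivity), Real.rpow_neg (by positivity)]
          simp
        push_cast
        rw [show (n : ℝ) + 1 + 1 = n + 2 by ring, ← h2]
        calc (1 + σ) / 2 * B * Real.exp (ε * s.1) * ((n : ℝ) + 1) ^ (-q)
            = B * Real.exp (ε * s.1) * (((n : ℝ) + 1) ^ (-q) * ((1 + σ) / 2)) := by ring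
          _ ≤ _ := by gcongr
  refine ⟨B, ε, fun n s => ⟨hall n s, (hint n (hall n) s).trans (ENNReal.ofReal_le_ofReal ?_)⟩⟩
  gcongr
  nlinarith

/-- Survival decreases in time, so the first `n + 1` terms of the series already give `(n + 1) ^ q`
times survival up to `n`, up to the constant. -/
theorem survival_le_mul_tsum (W : BranchWalk S) {q : ℝ} (hq : 0 < q) (a : ℝ) (n : ℕ)
    (s : ℝ≥0 × S) : W.survival a n s ≤ ENNReal.ofReal (max q 1 * ((n : ℝ) + 1) ^ (-q)) *
      ∑' m : ℕ, ENNReal.ofReal (((m : ℝ) + 1) ^ (q - 1)) * W.survival a m s := by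
  have h1 : ENNReal.ofReal (((n : ℝ) + 1) ^ q) * W.survival a n s ≤ ENNReal.ofReal (max q 1) *
      ∑' m : ℕ, ENNReal.ofReal (((m : ℝ) + 1) ^ (q - 1)) * W.survival a m s := by
    have h2 := Nat.rpow_le_sum hq (n + 1)
    push_cast at h2
    calc _ ≤ ENNReal.ofReal (max q 1 * ∑ m ∈ Finset.range (n + 1), ((m : ℝ) + 1) ^ (q - 1)) *
          W.survival a n s := by gcongr
      _ = ENNReal.ofReal (max q 1) * ∑ m ∈ Finset.range (n + 1),
          ENNReal.ofReal (((m : ℝ) + 1) ^ (q - 1)) * W.survival a n s := by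
        rw [ENNReal.ofReal_mul (by positivity),
          ENNReal.ofReal_sum_of_nonneg fun _ _ => by positivity, mul_assoc, Finset.sum_mul]
      _ ≤ ENNReal.ofReal (max q 1) * ∑ m ∈ Finset.range (n + 1),
          ENNReal.ofReal (((m : ℝ) + 1) ^ (q - 1)) * W.survival a m s := by
        gcongr with m hm
        exact W.survival_antitone a s (by simpa [Nat.lt_succ_iff] using hm)
      _ ≤ _ := by gcongr; exact ENNReal.sum_le_tsum _
  calc W.survival a n s = ENNReal.ofReal (((n : ℝ) + 1) ^ (-q)) *
        (ENNReal.ofReal (((n : ℝ) + 1) ^ q) * W.survival a n s) := by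
        rw [← mul_assoc, ← ENNReal.ofReal_mul (by positivity), ← Real.rpow_add (by positivity)]
        simp
    _ ≤ ENNReal.ofReal (((n : ℝ) + 1) ^ (-q)) * (ENNReal.ofReal (max q 1) *
        ∑' m : ℕ, ENNReal.ofReal (((m : ℝ) + 1) ^ (q - 1)) * W.survival a m s) := by gcongr
    _ = _ := by
        rw [← mul_assoc, ← ENNReal.ofReal_mul (by positivity), mul_comm (max q 1)]

theorem HeavyTailed.exists_survival_le_exp_mul_rpow [Nonempty S] (hW : W.HeavyTailed ty α c v)
    {a q : ℝ} (ha : 0 ≤ a) (hq : 0 < q) {x : ℝ≥0} (hx : a < x) {k : S}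
    (hsum : ∑' n : ℕ, ENNReal.ofReal (((n : ℝ) + 1) ^ (q - 1)) * W.survival a n (x, k) < ⊤) :
    ∃ B ε : ℝ, ∀ (n : ℕ) (s : ℝ≥0 × S),
      W.survival a n s ≤ ENNReal.ofReal (B * Real.exp (ε * s.1) * ((n : ℝ) + 1) ^ (-q)) ∧
      ∫⁻ s', W.survival a n s' ∂W.kernel s ≤
        ENNReal.ofReal (B * Real.exp (ε * s.1) * ((n : ℝ) + 1) ^ (-q)) := by
  set G : ℝ≥0 × S → ℝ≥0∞ := fun s =>
    ∑' n : ℕ, ENNReal.ofReal (((n : ℝ) + 1) ^ (q - 1)) * W.survival a n s with hGdef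
  have hGm : Measurable G := Measurable.tsum fun n =>
    (W.measurable_survival a n).const_mul _
  have hC : ENNReal.ofReal (2 ^ |q - 1|) ≠ ⊤ := ENNReal.ofReal_ne_top
  have hG : ∀ s : ℝ≥0 × S, a < s.1 → ∫⁻ s', G s' ∂W.kernel s ≤
      ENNReal.ofReal (2 ^ |q - 1|) * G s := fun s hs => W.lintegral_tsum_mul_survival_le _ a hs
  have hae := hW.ae_lt_top hGm ha hC hG hx hsum
  have hγ : ∀ i, ∃ γ : ℝ, 0 < γ ∧ (ty i = .symmetric → γ = α i) ∧
      ∫⁻ z in Ioi 0, ENNReal.ofReal ((1 + z) ^ (-1 - γ)) * G (z.toNNReal, i) < ⊤ := by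
    intro i
    cases hti : ty i
    · obtain ⟨l, hl⟩ := W.exists_p_pos i
      exact ⟨α l, hW.alpha_pos l, by simp,
        hW.lintegral_rpow_mul_lt_top_of_p_pos hGm ha hC hG (hae l) hl⟩
    · exact ⟨α i, hW.alpha_pos i, fun _ => rfl,
        hW.lintegral_rpow_mul_lt_top_of_symmetric hGm ha hC hG (hae i) hti⟩
  choose γ hγ0 hγty hγint using hγ
  choose K M hK hM hw using fun i => hW.exists_w_sub_le i (hγ0 i) (hγty i)
  have hIG : ∀ i, W.weighted (α i) (γ i) i G < ⊤ := fun i => W.weighted_lt_top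
    (fun j hj => hW.lintegral_rpow_mul_lt_top_of_p_pos hGm ha hC hG (hae i) hj) (hγint i)
  obtain ⟨ρ, hρ0, hρ1, hρ⟩ := hW.exists_setLIntegral_w_le
  have hT : ∀ i, 0 ≤ K i * (max q 1 * (W.weighted (α i) (γ i) i G).toReal) := fun i =>
    mul_nonneg (hK i) (by positivity)
  refine exists_le_exp_mul_rpow (W.survival_le_one a) (W.survival_succ_le a) hρ0 hρ1
    (K := ∑ i, K i * (max q 1 * (W.weighted (α i) (γ i) i G).toReal)) (M := 1 + ∑ i, M i)
    (Finset.sum_nonneg fun i _ => hT i)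
    (by linarith [Finset.sum_nonneg fun i (_ : i ∈ Finset.univ) => hM i]) hq ?_
  intro n y i b hb
  have hy : (0 : ℝ) ≤ y := y.coe_nonneg
  refine (W.lintegral_kernel_le_add_weighted (hK i) (hw i) (W.measurable_survival a n) y
    hb).trans ?_
  gcongr
  · exact hρ i
  · calc ENNReal.ofReal (K i * (1 + y) ^ M i) * W.weighted (α i) (γ i) i (W.survival a n)
        ≤ ENNReal.ofReal (K i * (1 + y) ^ M i) *
          (ENNReal.ofReal (max q 1 * ((n : ℝ) + 1) ^ (-q)) * W.weighted (α i) (γ i) i G) := by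
          gcongr
          exact W.weighted_le _ _ _ ENNReal.ofReal_ne_top (W.survival_le_mul_tsum hq a n)
      _ = ENNReal.ofReal (K i * (max q 1 * (W.weighted (α i) (γ i) i G).toReal) *
          (1 + y) ^ M i * ((n : ℝ) + 1) ^ (-q)) := by
          rw [← ENNReal.ofReal_toReal (hIG i).ne, ← ENNReal.ofReal_mul (by positivity),
            ← ENNReal.ofReal_mul (mul_nonneg (hK i) (by positivity)),
            ENNReal.toReal_ofReal ENNReal.toReal_nonneg]
          ring_nf
      _ ≤ _ := by
          refine ENNReal.ofReal_le_ofReal ?_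
          have h1 := Finset.single_le_sum (fun j _ => hT j) (Finset.mem_univ i)
          have h2 := Finset.single_le_sum (fun j _ => hM j) (Finset.mem_univ i)
          have h3 : 0 ≤ ∑ i, K i * (max q 1 * (W.weighted (α i) (γ i) i G).toReal) :=
            Finset.sum_nonneg fun i _ => hT i
          gcongr
          · linarith
          · linarith

end BranchWalk

/-! ### Changing the level -/

theorem exists_le_mul_rpow_of_le_add_mul {H : ℕ → ℝ} {C θ q : ℝ} (hH : ∀ n, H n ≤ 1) (hC : 0 ≤ C)
    (hθ0 : 0 ≤ θ) (hθ : θ < 1) (hq : 0 < q)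
    (h : ∀ n l : ℕ, H (n + l + 1) ≤ C * ((l : ℝ) + 1) ^ (-q) + θ * H n) :
    ∃ D, 0 ≤ D ∧ ∀ n : ℕ, H n ≤ D * ((n : ℝ) + 1) ^ (-q) := by
  -- Time `m` is split with a fraction `1 / N` given to `l`. The remaining time is so close to `m`
  -- that the contraction `θ` survives the loss in the power.
  obtain ⟨N, hN, hNθ⟩ : ∃ N : ℕ, 3 ≤ N ∧ θ * (1 - 2 / (N : ℝ)) ^ (-q) < (1 + θ) / 2 := by
    have h1 : Tendsto (fun N : ℕ => 1 - 2 / (N : ℝ)) atTop (𝓝 (1 - 0)) :=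
      tendsto_const_nhds.sub (tendsto_const_nhds.div_atTop tendsto_natCast_atTop_atTop)
    rw [sub_zero] at h1
    have h2 := (h1.rpow_const (p := -q) (Or.inl one_ne_zero)).const_mul θ
    rw [Real.one_rpow, mul_one] at h2
    obtain ⟨N, hN, hN'⟩ := ((h2.eventually (gt_mem_nhds (show θ < (1 + θ) / 2 by linarith))).and
      (eventually_ge_atTop 3)).exists
    exact ⟨N, hN', hN⟩
  have hN0 : (3 : ℝ) ≤ N := by exact_mod_cast hN
  have hfrac : 0 < 1 - 2 / (N : ℝ) := by
    rw [sub_pos, div_lt_one (by linarith)]; linarith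
  set D := max ((N : ℝ) ^ q) (C * (N : ℝ) ^ q * (2 / (1 - θ))) with hD
  have hD0 : 0 ≤ D := le_max_of_le_left (by positivity)
  have hDle : C * (N : ℝ) ^ q + (1 + θ) / 2 * D ≤ D := by
    have h1 : C * (N : ℝ) ^ q * (2 / (1 - θ)) ≤ D := le_max_right _ _
    rw [← mul_div_assoc, div_le_iff₀ (by linarith)] at h1
    linarith
  refine ⟨D, hD0, fun m => ?_⟩
  induction m using Nat.strong_induction_on with
  | _ m ih =>
  rcases lt_or_ge m N with hm | hm
  · refine (hH m).trans ?_
    calc (1 : ℝ) = ((m : ℝ) + 1) ^ q * ((m : ℝ) + 1) ^ (-q) := by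
          rw [← Real.rpow_add (by positivity)]; simp
      _ ≤ _ := by
          gcongr
          refine le_trans ?_ (le_max_left _ _)
          gcongr
          exact_mod_cast hm
  · have hl : m / N + 1 ≤ m := by
      have := Nat.div_le_self m 2
      have : m / N ≤ m / 2 := Nat.div_le_div_left (by omega) two_pos
      omega
    have hm0 : (N : ℝ) ≤ m := by exact_mod_cast hm
    have hl1 : ((m : ℝ) + 1) / N ≤ ((m / N : ℕ) : ℝ) + 1 := by
      rw [div_le_iff₀ (by linarith)]
      have := Nat.lt_div_mul_add (a := m) (b := N) (by omega)
      have h2 : m + 1 ≤ (m / N + 1) * N := by rw [add_mul, one_mul]; omega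
      exact_mod_cast h2
    have hn1 : (1 - 2 / (N : ℝ)) * ((m : ℝ) + 1) ≤ ((m - 1 - m / N : ℕ) : ℝ) + 1 := by
      have h1 : ((m / N : ℕ) : ℝ) ≤ (m : ℝ) / N := Nat.cast_div_le
      have h2 : ((m - 1 - m / N : ℕ) : ℝ) + 1 = m - ((m / N : ℕ) : ℝ) := by
        have h3 : m - 1 - m / N + 1 + m / N = m := by
          generalize m / N = l at hl ⊢
          omega
        have h4 : ((m - 1 - m / N : ℕ) : ℝ) + 1 + ((m / N : ℕ) : ℝ) = m := by exact_mod_cast h3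
        linarith
      rw [h2]
      have h5 : 1 ≤ (m : ℝ) / N := by rw [le_div_iff₀ (by linarith)]; linarith
      have h6 : 0 < 2 / (N : ℝ) := by positivity
      have h7 : 2 / (N : ℝ) * m = 2 * (m / N) := by ring
      nlinarith
    have key := h (m - 1 - m / N) (m / N)
    rw [show m - 1 - m / N + m / N + 1 = m by generalize m / N = l at hl ⊢; omega] at key
    have hi := ih (m - 1 - m / N) (by generalize m / N = l at hl ⊢; omega)
    calc H m ≤ C * (((m / N : ℕ) : ℝ) + 1) ^ (-q) + θ * H (m - 1 - m / N) := key
      _ ≤ C * (((m : ℝ) + 1) / N) ^ (-q) +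
          θ * (D * ((1 - 2 / (N : ℝ)) * ((m : ℝ) + 1)) ^ (-q)) := by
          have e1 := Real.rpow_le_rpow_of_nonpos (by positivity) hl1 (neg_nonpos.2 hq.le)
          have e2 := Real.rpow_le_rpow_of_nonpos (by positivity) hn1 (neg_nonpos.2 hq.le)
          gcongr
          exact hi.trans (by gcongr)
      _ = (C * (N : ℝ) ^ q + θ * (1 - 2 / (N : ℝ)) ^ (-q) * D) * ((m : ℝ) + 1) ^ (-q) := by
          rw [Real.div_rpow (by positivity) (by positivity), Real.mul_rpow hfrac.le (by positivity),
            Real.rpow_neg (by positivity : (0 : ℝ) ≤ N), div_inv_eq_mul]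
          ring
      _ ≤ _ := by
          gcongr
          refine le_trans ?_ hDle
          gcongr

namespace BranchWalk

variable {S : Type*} [Fintype S] {W : BranchWalk S} {ty : S → BranchType} {α c : S → ℝ}
  {v : S → ℝ → ℝ} [MeasurableSpace S] [DiscreteMeasurableSpace S]

theorem survival_add_le (W : BranchWalk S) {a' a : ℝ} {n : ℕ} {b : ℝ≥0∞}
    (hb : ∀ s : ℝ≥0 × S, (s.1 : ℝ) ≤ a → W.survival a' n s ≤ b) (l : ℕ) (s : ℝ≥0 × S) :
    W.survival a' (n + l) s ≤ W.survival a l s + b := by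
  induction l generalizing s with
  | zero =>
    rcases le_or_gt (s.1 : ℝ) a with h | h
    · exact (hb s h).trans le_add_self
    · rw [W.survival_zero_of_lt h]
      exact (W.survival_le_one _ _ _).trans le_self_add
  | succ l ih =>
    rcases le_or_gt (s.1 : ℝ) a with h | h
    · exact ((W.survival_antitone a' s (Nat.le_add_right _ _)).trans (hb s h)).trans le_add_self
    · rw [W.survival_succ_of_lt h]
      calc W.survival a' (n + (l + 1)) s ≤ ∫⁻ s', W.survival a' (n + l) s' ∂W.kernel s :=
            W.survival_succ_le _ _ _
        _ ≤ ∫⁻ s', (W.survival a l s' + b) ∂W.kernel s := lintegral_mono ih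
        _ = _ := by rw [lintegral_add_right _ measurable_const]; simp

/-- After the first step the chain either stays above `a` for `l` more steps, or is at or below `a`
at some time, with at least `n` steps left to survive above `a'`. The second alternative also
requires the first step to end above `a'`, which provides the contraction. -/
theorem survival_add_succ_le (W : BranchWalk S) {a' a : ℝ} {n : ℕ} {b : ℝ≥0∞}
    (hb : ∀ s : ℝ≥0 × S, (s.1 : ℝ) ≤ a → W.survival a' n s ≤ b) (l : ℕ) (s : ℝ≥0 × S) :
    W.survival a' (n + l + 1) s ≤
      ∫⁻ s', W.survival a l s' ∂W.kernel s + b * W.kernel s (above S a') := by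
  calc W.survival a' (n + l + 1) s ≤ ∫⁻ s', W.survival a' (n + l) s' ∂W.kernel s :=
        W.survival_succ_le _ _ _
    _ ≤ ∫⁻ s', (W.survival a l s' + (above S a').indicator (fun _ => b) s') ∂W.kernel s := by
        refine lintegral_mono fun s' => ?_
        by_cases h : s' ∈ above S a'
        · rw [indicator_of_mem h]; exact W.survival_add_le hb l s'
        · rw [W.survival_of_le (not_lt.1 h)]; exact zero_le
    _ = _ := by
        rw [lintegral_add_left (W.measurable_survival a l),
          lintegral_indicator_const (measurableSet_above a')]

/-- From heights in `[0, a]`, a jump across the origin lands in `(0, a']` with probability bounded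
below, whichever branch is chosen next. -/
theorem HeavyTailed.exists_kernel_above_le [Nonempty S] (hW : W.HeavyTailed ty α c v) {a' a : ℝ}
    (ha' : 0 < a') : ∃ θ : ℝ, 0 ≤ θ ∧ θ < 1 ∧ ∀ s : ℝ≥0 × S, (s.1 : ℝ) ≤ a →
      W.kernel s (above S a') ≤ ENNReal.ofReal θ := by
  have hE : MeasurableSet (Ioc 0 a') := measurableSet_Ioc
  choose κ hκ0 hκ using fun i => (hW.tailClass i).exists_le_setLIntegral_of_abs_le hE
    (by simpa using ha') Ioc_subset_Icc_self a
  obtain ⟨i₀, hi₀⟩ := Finite.exists_min κ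
  refine ⟨1 - min 1 (1 / 2 * κ i₀), by linarith [min_le_left 1 (1 / 2 * κ i₀)],
    by linarith [lt_min one_pos (mul_pos one_half_pos (hκ0 i₀))], ?_⟩
  rintro ⟨x, i⟩ hx
  have hx0 : (0 : ℝ) ≤ x := x.coe_nonneg
  have hx : (x : ℝ) ≤ a := hx
  have hcompl : ENNReal.ofReal (1 / 2 * κ i₀) ≤ W.kernel (x, i) (above S a')ᶜ := by
    have hA := (measurableSet_above (S := S) a').compl
    have hvm : Measurable fun y : ℝ => ENNReal.ofReal (v i |-x - y|) :=
      ((hW.tailClass i).measurable.comp (by fun_prop)).ennreal_ofReal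
    have hI : ENNReal.ofReal (1 / 2 * κ i₀) ≤
        ∫⁻ z in Ioc 0 a', ENNReal.ofReal (W.w i (-z - x)) := by
      calc ENNReal.ofReal (1 / 2 * κ i₀) ≤ ENNReal.ofReal (1 / 2) *
            ∫⁻ y in Ioc 0 a', ENNReal.ofReal (v i |-x - y|) := by
            rw [ENNReal.ofReal_mul (by norm_num)]
            gcongr
            refine (ENNReal.ofReal_le_ofReal (hi₀ i)).trans (hκ i _ ?_)
            rwa [abs_neg, abs_of_nonneg hx0]
        _ = ∫⁻ y in Ioc 0 a', ENNReal.ofReal (1 / 2) * ENNReal.ofReal (v i |-x - y|) :=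
            (lintegral_const_mul _ hvm).symm
        _ ≤ _ := by
            refine setLIntegral_mono' hE fun y hy => ?_
            rw [← ENNReal.ofReal_mul (by norm_num)]
            have h1 := hW.half_le_w i (show -y - (x : ℝ) < 0 by linarith [hy.1])
            rw [show -y - (x : ℝ) = -x - y by ring] at h1 ⊢
            exact ENNReal.ofReal_le_ofReal h1
    have hcross : ∀ j, ∫⁻ z in Ioc 0 a', ENNReal.ofReal (W.w i (-z - x)) ≤
        ∫⁻ z in Ioi 0, ENNReal.ofReal (W.w i (-z - x)) *
          (above S a')ᶜ.indicator 1 (z.toNNReal, j) := by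
      intro j
      refine le_trans (le_of_eq ?_) (lintegral_mono_set (s := Ioc 0 a') Ioc_subset_Ioi_self)
      refine setLIntegral_congr_fun hE fun z hz => ?_
      have : (z.toNNReal, j) ∈ (above S a')ᶜ := by
        simp [above, Real.coe_toNNReal _ hz.1.le, hz.2]
      simp only [indicator_of_mem this, Pi.one_apply, mul_one]
    rw [← lintegral_indicator_one hA, W.lintegral_kernel_eq_sum x i (measurable_one.indicator hA)]
    refine hI.trans (le_trans ?_ le_self_add)
    calc ∫⁻ z in Ioc 0 a', ENNReal.ofReal (W.w i (-z - x))
        = ∑ j, ENNReal.ofReal (W.p i j) * ∫⁻ z in Ioc 0 a', ENNReal.ofReal (W.w i (-z - x)) := by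
          rw [← Finset.sum_mul, W.sum_ofReal_p, one_mul]
      _ ≤ _ := Finset.sum_le_sum fun j _ => mul_le_mul_right (hcross j) _
  have h1 : W.kernel (x, i) (above S a') = 1 - W.kernel (x, i) (above S a')ᶜ := by
    rw [prob_compl_eq_one_sub (measurableSet_above a'),
      ENNReal.sub_sub_cancel ENNReal.one_ne_top prob_le_one]
  rw [h1, ENNReal.ofReal_sub _ (le_min zero_le_one (by have := hκ0 i₀; positivity)),
    ENNReal.ofReal_one]
  exact tsub_le_tsub_left ((ENNReal.ofReal_le_ofReal (min_le_right _ _)).trans hcompl) _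

theorem HeavyTailed.exists_survival_le_of_level_le [Nonempty S] (hW : W.HeavyTailed ty α c v)
    {a' a q B ε : ℝ} (ha' : 0 < a') (hq : 0 < q)
    (hB : ∀ (n : ℕ) (s : ℝ≥0 × S),
      W.survival a n s ≤ ENNReal.ofReal (B * Real.exp (ε * s.1) * ((n : ℝ) + 1) ^ (-q)) ∧
      ∫⁻ s', W.survival a n s' ∂W.kernel s ≤
        ENNReal.ofReal (B * Real.exp (ε * s.1) * ((n : ℝ) + 1) ^ (-q))) (s : ℝ≥0 × S) :
    ∃ C : ℝ≥0∞, C ≠ ⊤ ∧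
      ∀ n : ℕ, W.survival a' n s ≤ C * ENNReal.ofReal (((n : ℝ) + 1) ^ (-q)) := by
  obtain ⟨θ, hθ0, hθ1, hθ⟩ := hW.exists_kernel_above_le (a := a) ha'
  set h : ℕ → ℝ≥0∞ := fun n => ⨆ (s : ℝ≥0 × S) (_ : (s.1 : ℝ) ≤ a), W.survival a' n s with hh
  have hle : ∀ n (s : ℝ≥0 × S), (s.1 : ℝ) ≤ a → W.survival a' n s ≤ h n := fun n s hs =>
    le_iSup₂_of_le s hs le_rfl
  have h1 : ∀ n, h n ≤ 1 := fun n => iSup₂_le fun s _ => W.survival_le_one _ _ _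
  have htop : ∀ n, h n ≠ ⊤ := fun n => ((h1 n).trans_lt ENNReal.one_lt_top).ne
  have hrec : ∀ n l, (h (n + l + 1)).toReal ≤
      |B| * Real.exp (|ε| * a) * ((l : ℝ) + 1) ^ (-q) + θ * (h n).toReal := by
    intro n l
    refine ENNReal.toReal_le_of_le_ofReal (by positivity) (iSup₂_le fun s hs => ?_)
    rw [ENNReal.ofReal_add (by positivity) (by positivity), ENNReal.ofReal_mul hθ0,
      ENNReal.ofReal_toReal (htop n), mul_comm (ENNReal.ofReal θ)]
    refine (W.survival_add_succ_le (hle n) l s).trans ?_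
    refine add_le_add ((hB l s).2.trans (ENNReal.ofReal_le_ofReal ?_))
      (mul_le_mul_right (hθ s hs) _)
    have hx0 : (0 : ℝ) ≤ s.1 := s.1.coe_nonneg
    gcongr
    · exact le_abs_self B
    · exact le_abs_self ε
  obtain ⟨D, hD0, hD⟩ := exists_le_mul_rpow_of_le_add_mul
    (fun n => ENNReal.toReal_le_of_le_ofReal zero_le_one (by simpa using h1 n)) (by positivity)
    hθ0 hθ1 hq hrec
  refine ⟨ENNReal.ofReal ((|B| * Real.exp (ε * s.1) + D) * 2 ^ q), ENNReal.ofReal_ne_top,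
    fun m => ?_⟩
  have hscale : ∀ l : ℕ, m + 1 ≤ (l + 1) * 2 →
      ((l : ℝ) + 1) ^ (-q) ≤ 2 ^ q * ((m : ℝ) + 1) ^ (-q) := by
    intro l hl
    have h2 : ((m : ℝ) + 1) / 2 ≤ (l : ℝ) + 1 := by
      rw [div_le_iff₀ two_pos]; exact_mod_cast hl
    calc ((l : ℝ) + 1) ^ (-q) ≤ (((m : ℝ) + 1) / 2) ^ (-q) :=
          Real.rpow_le_rpow_of_nonpos (by positivity) h2 (neg_nonpos.2 hq.le)
      _ = _ := by
          rw [Real.div_rpow (by positivity) (by norm_num), Real.rpow_neg two_pos.le,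
            div_inv_eq_mul, mul_comm]
  -- Half of the time goes to staying above `a`, the other half to surviving after a visit to `[0,
  -- a]`; the factor `2 ^ q` is the price.
  have key := W.survival_add_le (hle (m - m / 2)) (m / 2) s
  rw [show m - m / 2 + m / 2 = m by omega] at key
  calc W.survival a' m s ≤ W.survival a (m / 2) s + h (m - m / 2) := key
    _ ≤ ENNReal.ofReal (|B| * Real.exp (ε * s.1) * (((m / 2 : ℕ) : ℝ) + 1) ^ (-q)) +
        ENNReal.ofReal (D * (((m - m / 2 : ℕ) : ℝ) + 1) ^ (-q)) := by
        refine add_le_add ((hB _ s).1.trans (ENNReal.ofReal_le_ofReal ?_)) ?_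
        · gcongr
          exact le_abs_self B
        · rw [← ENNReal.ofReal_toReal (htop _)]
          exact ENNReal.ofReal_le_ofReal (hD _)
    _ ≤ ENNReal.ofReal (|B| * Real.exp (ε * s.1) * (2 ^ q * ((m : ℝ) + 1) ^ (-q))) +
        ENNReal.ofReal (D * (2 ^ q * ((m : ℝ) + 1) ^ (-q))) := by
        gcongr
        · exact hscale _ (by omega)
        · exact hscale _ (by omega)
    _ = _ := by
        rw [← ENNReal.ofReal_add (by positivity) (by positivity),
          ← ENNReal.ofReal_mul (by positivity)]
        ring_nf

theorem HeavyTailed.passageMoment_lt_top_of_lt [Nonempty S] (hW : W.HeavyTailed ty α c v)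
    {a q' : ℝ} (ha : 0 < a) {x : ℝ≥0} (hx : a < x) {k : S} (hq' : 0 < q')
    (h : W.passageMoment a x k q' < ⊤) {b : ℝ} (hb : 0 < b) {y : ℝ≥0} (hy : b < y) (j : S) {q : ℝ}
    (hq : q < q') : W.passageMoment b y j q < ⊤ := by
  -- The room between `q` and `q'` is spent twice: below `q'` to make the series converge, and above
  -- `q` to recover a moment from the decay. Positivity of `r` covers `q ≤ 0`.
  obtain ⟨r, hr, hrq'⟩ := exists_between (max_lt hq hq')
  obtain ⟨hqr, hr0⟩ := max_lt_iff.1 hr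
  have hsum : ∑' n : ℕ, ENNReal.ofReal (((n : ℝ) + 1) ^ (r - 1)) * W.survival a n (x, k) < ⊤ := by
    refine W.tsum_mul_survival_lt_top (p := q') (by linarith) h.ne fun n => ?_
    calc W.survival a n (x, k) = ENNReal.ofReal (((n : ℝ) + 1) ^ q') * W.survival a n (x, k) *
          ENNReal.ofReal (((n : ℝ) + 1) ^ (-q')) := by
          rw [mul_right_comm, ← ENNReal.ofReal_mul (by positivity), ← Real.rpow_add (by positivity)]
          simp
      _ ≤ _ := by
          gcongr
          exact W.mul_survival_le_passageMoment hq'.le a x k n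
  obtain ⟨B, ε, hB⟩ := hW.exists_survival_le_exp_mul_rpow ha.le hr0 hx hsum
  obtain ⟨C, hC, hCle⟩ := hW.exists_survival_le_of_level_le hb hr0 hB (y, j)
  exact W.passageMoment_lt_top_of_survival_le hqr hy hC hCle

end BranchWalk

/-! ### The critical exponent as a supremum -/

theorem theorem2 {S : Type*} [Fintype S] [Nonempty S] [MeasurableSpace S]
    [DiscreteMeasurableSpace S] (W : BranchWalk S) (μ : S → ℝ) (hμ : W.IsInvariant μ)
    (ty : S → BranchType) (α c : S → ℝ) (v : S → ℝ → ℝ) (hW : W.HeavyTailed ty α c v)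
    (hcase : CaseA ty α ∨ CaseBI ty α μ) :
    ∃ qstar : ℝ, 0 < qstar ∧
      ∀ (a : ℝ), 0 < a → ∀ (x : ℝ≥0), a < x → ∀ (k : S) (q : ℝ),
        (q < qstar → W.passageMoment a x k q < ∞) ∧
        (qstar < q → W.passageMoment a x k q = ∞) := by
  set A : Set ℝ := {q | 0 < q ∧ ∃ a : ℝ, 0 < a ∧ ∃ x : ℝ≥0, a < x ∧ ∃ k,
    W.passageMoment a x k q < ⊤} with hA
  obtain ⟨q₀, hq₀, hq₀A⟩ := hW.exists_passageMoment_lt_top hμ hcase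
  obtain ⟨Q, -, hQ⟩ := hW.exists_passageMoment_eq_top
  have hbdd : BddAbove A := ⟨Q, fun q ⟨_, a, ha, x, hx, k, hlt⟩ => by
    by_contra! h
    exact hlt.ne (hQ a ha x hx k q h)⟩
  have hmem : q₀ ∈ A := ⟨hq₀, hq₀A⟩
  have hpos : 0 < sSup A := hq₀.trans_le (le_csSup hbdd hmem)
  refine ⟨sSup A, hpos, fun a ha x hx k q => ⟨fun hq => ?_, fun hq => ?_⟩⟩
  · obtain ⟨q', ⟨hq', b, hb, y, hy, j, hlt⟩, hqq'⟩ := exists_lt_of_lt_csSup ⟨q₀, hmem⟩ hq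
    exact hW.passageMoment_lt_top_of_lt hb hy hq' hlt ha hx k hqq'
  · by_contra h
    exact (le_csSup hbdd ⟨hpos.trans hq, a, ha, x, hx, k, lt_top_iff_ne_top.2 h⟩).not_gt hq
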